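/- **Setting.** Let $D$ be a probability distribution on $\mathcal X\times[n]$, $n\ge 1$, with class priors $\pi_y=\mathbf P(Y=y)>0$ for all $y$, $\pi_{\min}=\min_y\pi_y$, and conditional class probabilities $\eta_y(x)=\mathbf P(Y=y\mid X=x)$. A (randomized) classifier is a measurable map $h:\mathcal X\to\Delta_n$ into the probability simplex; for a distribution $E$ on $\mathcal X\times[n]$ its confusion matrix is $\mathrm{conf}(h,E)_{i,j}=\mathbf E_{(X,Y)\sim E}[h_j(X)\mathbf 1(Y=i)]$, and $\mathcal C_D=\{\mathrm{conf}(h,D): h\text{ a classifier}\}$. For a function $\psi$ of the confusion matrix, $\mathrm{regret}^\psi_D[h]=\sup_{g}\psi(\mathrm{conf}(g,D))-\psi(\mathrm{conf}(h,D))$, the supremum being over all classifiers $g$. **Metrics.** Write $s_y=\sum_{\hat y}C_{y,\hat y}$. The metrics $\psi$ and their smoothed versions $\psi_\rho$, $\rho\in(0,1)$, are * H-mean: $\psi(C)=n\big(\sum_y \frac{s_y}{C_{y,y}}\big)^{-1}$ ($=0$ if some $C_{y,y}=0$), $\ \psi_\rho(C)=n\big(\sum_y\frac{s_y+\rho}{C_{y,y}+\rho}\big)^{-1}$;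 * Q-mean: $\psi(C)=1-\sqrt{\frac1n\sum_y\big(1-\frac{C_{y,y}}{s_y}\big)^2}$, $\ \psi_\rho(C)=1-\sqrt{\frac1n\sum_y\Big(\frac{\sum_{\hat y\neq y}C_{y,\hat y}+\rho}{s_y+\rho}\Big)^2}$; * G-mean: $\psi(C)=\big(\prod_y\frac{C_{y,y}}{s_y}\big)^{1/n}$, $\ \psi_\rho(C)=\big(\prod_y\frac{C_{y,y}+\rho}{s_y+\rho}\big)^{1/n}$. **Algorithm (BayesCG run on $\psi_\rho$).** Parameters $\alpha\in(0,1)$ and an integer $\kappa\ge1$. Given an i.i.d. sample $S\sim D^m$, split it into $S'$ (the first $\lfloor(1-\alpha)m\rfloor$ points) and $S''$ (the remaining $\lceil\alpha m\rceil$ points), with empirical distribution $D_{S''}$. Learn $\widehat\eta_{S'}:\mathcal X\to\Delta_n$ from $S'$ by a class probability estimation (CPE) procedure and choose an initial classifier $\widehat h^0$ (possibly depending on $S$). For $j=1,\dots,\kappa m$ set $\widehat G^j=\nabla\psi_\rho(\mathrm{conf}(\widehat h^{j-1},D_{S''}))$; let $\widehat u^j(x)$ be the vertex of $\Delta_n$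 at the largest $y$ maximizing $\sum_k\widehat G^j_{k,y}\,\widehat\eta_{S',k}(x)$; and set $\widehat h^j=\big(1-\tfrac2{j+1}\big)\widehat h^{j-1}+\tfrac2{j+1}\widehat u^j$. The output is $\widehat h^{\mathrm{FW},\rho}_S=\widehat h^{\kappa m}$. (The CPE procedure and the choice of $\widehat h^0$ are jointly measurable in the sample and the instance.) **Corollary (Consistency of BayesCG for H-mean, Q-mean and G-mean).** For each of the three metrics $\psi$: 1. For every $\rho\in(0,1)$, $\psi_\rho$ is concave over $\mathcal C_D$, satisfies $\sup_{C\in\mathcal C_D}|\psi(C)-\psi_\rho(C)|\le\theta(\rho)$, and over $[0,1]^{n\times n}$ it is $L_\rho$-Lipschitz with respect to the $\ell_1$ norm (entrywise) and $\beta_\rho$-smooth, i.e. it has a gradient with $\|\nabla\psi_\rho(M)-\nabla\psi_\rho(N)\|_\infty\le\beta_\rho\|M-N\|_1$, where | metric | $\theta(\rho)$ | $L_\rho$ | $\beta_\rho$ | |---|---|---|---| | H-mean | $\frac{n}{\pi_{\min}}\rho$ | $\frac n\rho$ | $\frac{2n}{\rho^2}$ | | Q-mean | $\frac{1}{\pi_{\min}}\rho$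 | $\frac1{\sqrt n}\frac1\rho$ | $\frac2{\sqrt n}\frac1{\rho^2}\big(1+\frac1\rho\big)$ | | G-mean | $2\big(\frac{\rho}{\pi_{\min}}\big)^{1/n}$ | $\frac1n\frac1\rho\big(1+\frac1\rho\big)^{1-1/n}$ | $\frac{2}{n\rho^2}$ | 2. If $\mathbf E_X\big[\|\widehat\eta_{S'}(X)-\eta(X)\|_1\big]\to0$ in probability as $m\to\infty$, then there is a sequence $\rho_m\in(0,1)$ with $\rho_m\to0$ such that $\mathrm{regret}^\psi_D\big[\widehat h^{\mathrm{FW},\rho_m}_S\big]\to0$ in probability as $m\to\infty$ (over $S\sim D^m$). -/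

import Mathlib

open MeasureTheory ProbabilityTheory Filter Topology

noncomputable section

namespace BayesCG

/-! ### Classifiers and confusion matrices -/

/-- A randomized classifier: a measurable map from the instance space to the probability
simplex over the labels. -/
def IsClassifier {X : Type*} [MeasurableSpace X] {n : ℕ} (h : X → Fin n → ℝ) : Prop :=
  Measurable h ∧ ∀ x, h x ∈ stdSimplex ℝ (Fin n)

/-- The confusion matrix of `h` under `D`: entry `(i, j)` is `E[h_j(X) 1(Y = i)]`. -/
def conf {X : Type*} [MeasurableSpace X] {n : ℕ} (D : Measure (X × Fin n))
    (h : X → Fin n → ℝ) : Matrix (Fin n) (Fin n) ℝ :=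
  fun i j => ∫ z, h z.1 j * (if z.2 = i then 1 else 0) ∂D

/-- The set of feasible confusion matrices. -/
def feasible {X : Type*} [MeasurableSpace X] {n : ℕ} (D : Measure (X × Fin n)) :
    Set (Matrix (Fin n) (Fin n) ℝ) :=
  {C | ∃ h : X → Fin n → ℝ, IsClassifier h ∧ C = conf D h}

/-- The prior probability of the label `y`. -/
def prior {X : Type*} [MeasurableSpace X] {n : ℕ} (D : Measure (X × Fin n)) (y : Fin n) : ℝ :=
  D.snd.real {y}

/-- The smallest prior probability. -/
def priorMin {X : Type*} [MeasurableSpace X] {n : ℕ} (D : Measure (X × Fin n)) : ℝ :=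
  ⨅ y, prior D y

/-- The conditional class probabilities `P(Y = y | X = x)`. -/
def condProb {X : Type*} [MeasurableSpace X] {n : ℕ} [NeZero n] (D : Measure (X × Fin n))
    [IsFiniteMeasure D] (x : X) (y : Fin n) : ℝ :=
  (D.condKernel x).real {y}

/-- The expected `ℓ₁` distance `E_X ‖η'(X) - η(X)‖₁` between a model and the true conditional
class probabilities. -/
def cpeError {X : Type*} [MeasurableSpace X] {n : ℕ} [NeZero n] (D : Measure (X × Fin n))
    [IsFiniteMeasure D] (η' : X → Fin n → ℝ) : ℝ :=
  ∫ x, ∑ y, |η' x y - condProb D x y| ∂D.fst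

/-- The `ψ`-regret of `h`: optimal value over all randomized classifiers minus the value at
`h`. -/
def regret {X : Type*} [MeasurableSpace X] {n : ℕ} (D : Measure (X × Fin n))
    (ψ : Matrix (Fin n) (Fin n) ℝ → ℝ) (h : X → Fin n → ℝ) : ℝ :=
  (⨆ g : {g : X → Fin n → ℝ // IsClassifier g}, ψ (conf D g)) - ψ (conf D h)

/-! ### Samples -/

/-- The empirical distribution of a sample. -/
def empirical {Z : Type*} [MeasurableSpace Z] {k : ℕ} (S : Fin k → Z) : Measure Z :=
  (k : ENNReal)⁻¹ • ∑ i, Measure.dirac (S i)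

/-- Convergence in probability, as the sample size tends to infinity, of a real functional of an
i.i.d. sample. -/
def TendstoInProb {Z : Type*} [MeasurableSpace Z] (D : Measure Z)
    (φ : ∀ m : ℕ, (Fin m → Z) → ℝ) (a : ℝ) : Prop :=
  ∀ ε : ℝ, 0 < ε →
    Tendsto (fun m => Measure.pi (fun _ : Fin m => D) {S | ε ≤ |φ m S - a|}) atTop (𝓝 0)

/-- A (measurable) procedure that maps samples of every size to functions from the instance
space to the probability simplex. -/
def IsLearner {X : Type*} [MeasurableSpace X] {n : ℕ}
    (A : ∀ k : ℕ, (Fin k → X × Fin n) → X → Fin n → ℝ) : Prop :=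
  ∀ k, Measurable (fun p : (Fin k → X × Fin n) × X => A k p.1 p.2) ∧
    ∀ S x, A k S x ∈ stdSimplex ℝ (Fin n)

/-- The size of the first part of the split of a sample of size `m`. -/
def size₁ (α : ℝ) (m : ℕ) : ℕ := ⌊(1 - α) * m⌋₊

/-- The size of the second part of the split of a sample of size `m`. -/
def size₂ (α : ℝ) (m : ℕ) : ℕ := ⌈α * m⌉₊

theorem size_add {α : ℝ} (hα : α ∈ Set.Ioo (0 : ℝ) 1) (m : ℕ) :
    size₁ α m + size₂ α m = m := by
  have h0 : 0 ≤ α * m := mul_nonneg hα.1.le (Nat.cast_nonneg m)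
  have h1 : 0 ≤ (1 - α) * m := mul_nonneg (by linarith [hα.2]) (Nat.cast_nonneg m)
  have a1 : (size₁ α m : ℝ) ≤ (1 - α) * m := Nat.floor_le h1
  have a2 : (1 - α) * m < (size₁ α m : ℝ) + 1 := Nat.lt_floor_add_one _
  have b1 : α * m ≤ (size₂ α m : ℝ) := Nat.le_ceil _
  have b2 : (size₂ α m : ℝ) < α * m + 1 := Nat.ceil_lt_add_one h0
  have c1 : ((size₁ α m + size₂ α m : ℕ) : ℝ) < (m + 1 : ℕ) := by push_cast; linarith
  have c2 : (m : ℝ) < ((size₁ α m + size₂ α m + 1 : ℕ) : ℝ) := by push_cast; linarith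
  have d1 := Nat.cast_lt.mp c1
  have d2 := Nat.cast_lt.mp c2
  omega

/-- The first part `S'` of the sample. -/
def part₁ {Z : Type*} {α : ℝ} (hα : α ∈ Set.Ioo (0 : ℝ) 1) {m : ℕ} (S : Fin m → Z) :
    Fin (size₁ α m) → Z :=
  fun i => S (Fin.cast (size_add hα m) (Fin.castAdd (size₂ α m) i))

/-- The second part `S''` of the sample. -/
def part₂ {Z : Type*} {α : ℝ} (hα : α ∈ Set.Ioo (0 : ℝ) 1) {m : ℕ} (S : Fin m → Z) :
    Fin (size₂ α m) → Z :=
  fun i => S (Fin.cast (size_add hα m) (Fin.natAdd (size₁ α m) i))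

/-! ### The algorithm -/

/-- The gradient of a function of a matrix: the matrix of its partial derivatives. -/
def grad {n : ℕ} (ψ : Matrix (Fin n) (Fin n) ℝ → ℝ) (C : Matrix (Fin n) (Fin n) ℝ) :
    Matrix (Fin n) (Fin n) ℝ :=
  fun i j => deriv (fun t : ℝ => ψ (C + t • Matrix.single i j (1 : ℝ))) 0

/-- `i` is the largest maximizer of `v`. -/
def IsLastArgmax {n : ℕ} (v : Fin n → ℝ) (i : Fin n) : Prop :=
  (∀ y, v y ≤ v i) ∧ ∀ y, i < y → v y < v i

open Classical in
/-- The plug-in classifier for the gain matrix `G` and the model `η'`: it puts mass one on the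
largest `i` that maximizes the inner product of the `i`-th column of `G` with `η' x`. -/
def plugIn {X : Type*} {n : ℕ} (G : Matrix (Fin n) (Fin n) ℝ) (η' : X → Fin n → ℝ) :
    X → Fin n → ℝ :=
  fun x i => if IsLastArgmax (fun y => ∑ k, G k y * η' x k) i then 1 else 0

/-- The iterates of the sample-based conditional gradient method, for the model `η'`, the
distribution `E` used for the gradients (the empirical one) and the initial classifier `h₀`. -/
def iterate {X : Type*} [MeasurableSpace X] {n : ℕ} (ψ : Matrix (Fin n) (Fin n) ℝ → ℝ)
    (η' : X → Fin n → ℝ) (E : Measure (X × Fin n)) (h₀ : X → Fin n → ℝ) :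
    ℕ → X → Fin n → ℝ
  | 0 => h₀
  | j + 1 =>
    let h := iterate ψ η' E h₀ j
    let u := plugIn (grad ψ (conf E h)) η'
    let γ : ℝ := 2 / (((j + 1 : ℕ) : ℝ) + 1)
    fun x i => (1 - γ) * h x i + γ * u x i

/-- The classifier that BayesCG returns on the sample `S` when run on `ψ` with parameters
`α` and `κ`, class probability estimation procedure `cpe` and initial classifier `h₀ m S`. -/
def bayesCG {X : Type*} [MeasurableSpace X] {n : ℕ} {α : ℝ} (hα : α ∈ Set.Ioo (0 : ℝ) 1)
    (κ : ℕ) (cpe h₀ : ∀ k : ℕ, (Fin k → X × Fin n) → X → Fin n → ℝ)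
    (ψ : Matrix (Fin n) (Fin n) ℝ → ℝ) (m : ℕ) (S : Fin m → X × Fin n) : X → Fin n → ℝ :=
  iterate ψ (cpe (size₁ α m) (part₁ hα S)) (empirical (part₂ hα S)) (h₀ m S) (κ * m)

/-! ### The metrics and their smoothed versions -/

open Classical in
/-- The H-mean. It vanishes when one of the true positive rates does, by continuity; the
displayed formula is used on all other matrices. -/
def hMean {n : ℕ} (C : Matrix (Fin n) (Fin n) ℝ) : ℝ :=
  if ∃ y, C y y = 0 then 0 else (n : ℝ) * (∑ y, (∑ z, C y z) / C y y)⁻¹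

/-- The Q-mean. -/
def qMean {n : ℕ} (C : Matrix (Fin n) (Fin n) ℝ) : ℝ :=
  1 - √((1 / (n : ℝ)) * ∑ y, (1 - C y y / ∑ z, C y z) ^ 2)

/-- The G-mean. -/
def gMean {n : ℕ} (C : Matrix (Fin n) (Fin n) ℝ) : ℝ :=
  (∏ y, C y y / ∑ z, C y z) ^ (1 / (n : ℝ))

/-- The smoothed H-mean. -/
def hMeanSmooth {n : ℕ} (ρ : ℝ) (C : Matrix (Fin n) (Fin n) ℝ) : ℝ :=
  (n : ℝ) * (∑ y, (∑ z, C y z + ρ) / (C y y + ρ))⁻¹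

/-- The smoothed Q-mean. -/
def qMeanSmooth {n : ℕ} (ρ : ℝ) (C : Matrix (Fin n) (Fin n) ℝ) : ℝ :=
  1 - √((1 / (n : ℝ)) *
    ∑ y, ((∑ z ∈ Finset.univ.erase y, C y z + ρ) / (∑ z, C y z + ρ)) ^ 2)

/-- The smoothed G-mean. -/
def gMeanSmooth {n : ℕ} (ρ : ℝ) (C : Matrix (Fin n) (Fin n) ℝ) : ℝ :=
  (∏ y, (C y y + ρ) / (∑ z, C y z + ρ)) ^ (1 / (n : ℝ))

/-! ### Regularity with respect to the `ℓ₁` norm -/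

/-- The entrywise `ℓ₁` norm of a matrix. -/
def l1Norm {n : ℕ} (M : Matrix (Fin n) (Fin n) ℝ) : ℝ := ∑ i, ∑ j, |M i j|

/-- The matrices with entries in `[0, 1]`. -/
def cube (n : ℕ) : Set (Matrix (Fin n) (Fin n) ℝ) := {C | ∀ i j, C i j ∈ Set.Icc (0 : ℝ) 1}

/-- `ψ` is `L`-Lipschitz with respect to the `ℓ₁` norm over `s`. -/
def LipschitzL1On {n : ℕ} (L : ℝ) (ψ : Matrix (Fin n) (Fin n) ℝ → ℝ)
    (s : Set (Matrix (Fin n) (Fin n) ℝ)) : Prop :=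
  ∀ M ∈ s, ∀ N ∈ s, |ψ M - ψ N| ≤ L * l1Norm (M - N)

/-- `ψ` is `β`-smooth with respect to the `ℓ₁` norm over `s`: its partial derivatives exist, and
`‖∇ψ(M) - ∇ψ(N)‖_∞ ≤ β ‖M - N‖₁`. -/
def SmoothL1On {n : ℕ} (β : ℝ) (ψ : Matrix (Fin n) (Fin n) ℝ → ℝ)
    (s : Set (Matrix (Fin n) (Fin n) ℝ)) : Prop :=
  (∀ M ∈ s, ∀ i j,
    DifferentiableAt ℝ (fun t : ℝ => ψ (M + t • Matrix.single i j (1 : ℝ))) 0) ∧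
  ∀ M ∈ s, ∀ N ∈ s, ∀ i j, |grad ψ M i j - grad ψ N i j| ≤ β * l1Norm (M - N)

/-- `ψρ` is a smoothing of `ψ` with approximation error `θ`, Lipschitz constants `L` and
smoothness parameters `β`: for every `ρ ∈ (0, 1)` the function `ψρ ρ` is concave over the
feasible confusion matrices, `L ρ`-Lipschitz and `β ρ`-smooth, and it differs from `ψ` by at most
`θ ρ` over the feasible confusion matrices. -/
def IsSmoothing {X : Type*} [MeasurableSpace X] {n : ℕ} (D : Measure (X × Fin n))
    (ψ : Matrix (Fin n) (Fin n) ℝ → ℝ) (ψρ : ℝ → Matrix (Fin n) (Fin n) ℝ → ℝ)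
    (θ L β : ℝ → ℝ) : Prop :=
  ∀ ρ ∈ Set.Ioo (0 : ℝ) 1,
    ConcaveOn ℝ (feasible D) (ψρ ρ) ∧
    LipschitzL1On (L ρ) (ψρ ρ) (cube n) ∧
    SmoothL1On (β ρ) (ψρ ρ) (cube n) ∧
    ∀ C ∈ feasible D, |ψ C - ψρ ρ C| ≤ θ ρ

end BayesCG

end

/-!
The H-, Q- and G-means are concave functions of the recalls `C_yy / s_y`, or of the miss rates, and
on the feasible confusion matrices each `s_y` is the constant `π_y`; so the metrics and their
smoothed versions are concave there. Adding `ρ` keeps all denominators at least `ρ`, which bounds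
the gradients and their moduli of continuity on the whole cube.

For a fixed `ρ`, BayesCG is the conditional gradient method over the convex set of feasible
confusion matrices, where a linear objective is maximized by a plug-in classifier. The gap of its
output has three sources: the optimization error, which is of order `1 / (κ m)`; the learnt model
in the linear maximization, which costs at most a multiple of its `ℓ₁` error; and the gradient,
which is evaluated at an empirical confusion matrix. By smoothness the latter costs at most a
multiple of the deviation of empirical confusion matrices, uniformly over all plug-in classifiers of
the model. These are cut out by pairwise comparisons, i.e. by half-spaces in `ℝⁿ`, so their growth
function is polynomial, and symmetrization with Massart's finite class lemma shows that the
deviation vanishes. Finally `ρ` is sent to zero slowly enough along the sample size.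
-/

noncomputable section

namespace BayesCG

/-! ### Harmonic, geometric and quadratic means of positive vectors -/

section Means

variable {ι : Type*}

theorem convex_setOf_forall_pos : Convex ℝ {x : ι → ℝ | ∀ i, 0 < x i} := by
  simpa [Set.pi, Set.mem_Ioi] using
    convex_pi (𝕜 := ℝ) (s := Set.univ) fun (_ : ι) _ => convex_Ioi (0 : ℝ)

theorem norm_prod_sub_prod_le {R : Type*} [NormedCommRing R] [NormOneClass R] (s : Finset ι)
    {a b : ι → R} (ha : ∀ i, ‖a i‖ ≤ 1) (hb : ∀ i, ‖b i‖ ≤ 1) :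
    ‖∏ i ∈ s, a i - ∏ i ∈ s, b i‖ ≤ ∑ i ∈ s, ‖a i - b i‖ := by
  classical
  induction s using Finset.induction_on with
  | empty => simp
  | insert i s hi ih =>
    rw [Finset.prod_insert hi, Finset.prod_insert hi, Finset.sum_insert hi]
    have hprod : ‖∏ k ∈ s, b k‖ ≤ 1 := (Finset.norm_prod_le s b).trans
      (Finset.prod_le_one (fun k _ => norm_nonneg _) fun k _ => hb k)
    calc ‖a i * ∏ k ∈ s, a k - b i * ∏ k ∈ s, b k‖
        = ‖(a i - b i) * ∏ k ∈ s, b k + a i * (∏ k ∈ s, a k - ∏ k ∈ s, b k)‖ := by ring_nf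
      _ ≤ ‖a i - b i‖ * ‖∏ k ∈ s, b k‖ + ‖a i‖ * ‖∏ k ∈ s, a k - ∏ k ∈ s, b k‖ :=
          norm_add_le_of_le (norm_mul_le _ _) (norm_mul_le _ _)
      _ ≤ ‖a i - b i‖ * 1 + 1 * ∑ k ∈ s, ‖a k - b k‖ := by
          gcongr
          exact ha i
      _ = _ := by ring

theorem abs_rpow_sub_rpow_le {x y p : ℝ} (hx : 0 ≤ x) (hy : 0 ≤ y) (hp : 0 ≤ p) (hp1 : p ≤ 1) :
    |x ^ p - y ^ p| ≤ |x - y| ^ p := by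
  wlog hxy : y ≤ x generalizing x y
  · rw [abs_sub_comm, abs_sub_comm x]
    exact this hy hx (le_of_not_ge hxy)
  rw [abs_of_nonneg (sub_nonneg.2 (Real.rpow_le_rpow hy hxy hp)), abs_of_nonneg (sub_nonneg.2 hxy),
    sub_le_iff_le_add]
  simpa using Real.rpow_add_le_add_rpow (sub_nonneg.2 hxy) hy hp hp1

theorem natCast_rpow_one_div_le_two (n : ℕ) : (n : ℝ) ^ (1 / (n : ℝ)) ≤ 2 := by
  rcases n.eq_zero_or_pos with rfl | hn
  · simp
  calc (n : ℝ) ^ (1 / (n : ℝ)) ≤ ((2 : ℝ) ^ n) ^ (1 / (n : ℝ)) := by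
        gcongr
        exact_mod_cast n.lt_two_pow_self.le
    _ = 2 := by rw [one_div, Real.pow_rpow_inv_natCast zero_le_two hn.ne']

variable [Fintype ι]

theorem concaveOn_of_exists_dotProduct_majorant {s : Set (ι → ℝ)} (hs : Convex ℝ s)
    {f : (ι → ℝ) → ℝ} (hf : ∀ z ∈ s, ∃ c : ι → ℝ, c ⬝ᵥ z ≤ f z ∧ ∀ u ∈ s, f u ≤ c ⬝ᵥ u) :
    ConcaveOn ℝ s f := by
  refine ⟨hs, fun u hu v hv a b ha hb hab => ?_⟩
  obtain ⟨c, hc, hle⟩ := hf _ (hs hu hv ha hb hab)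
  calc a • f u + b • f v ≤ a • (c ⬝ᵥ u) + b • (c ⬝ᵥ v) := by
        gcongr
        exacts [hle u hu, hle v hv]
    _ = c ⬝ᵥ (a • u + b • v) := by rw [dotProduct_add, dotProduct_smul, dotProduct_smul]
    _ ≤ f (a • u + b • v) := hc

/-- The parallel sum (`1 / card ι` times the harmonic mean) of a family of positive numbers. -/
def parallelSum (x : ι → ℝ) : ℝ := (∑ i, (x i)⁻¹)⁻¹

theorem parallelSum_nonneg {x : ι → ℝ} (hx : ∀ i, 0 ≤ x i) : 0 ≤ parallelSum x :=
  inv_nonneg.2 (Finset.sum_nonneg fun i _ => inv_nonneg.2 (hx i))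

theorem parallelSum_le_apply {x : ι → ℝ} (hx : ∀ i, 0 < x i) (i : ι) :
    parallelSum x ≤ x i := by
  rw [parallelSum, inv_le_comm₀ (Finset.sum_pos (fun j _ => inv_pos.2 (hx j)) ⟨i, by simp⟩) (hx i)]
  exact Finset.single_le_sum (fun j _ => (inv_pos.2 (hx j)).le) (Finset.mem_univ i)

theorem parallelSum_div_nonneg {x : ι → ℝ} (hx : ∀ i, 0 < x i) (i : ι) :
    0 ≤ parallelSum x / x i :=
  div_nonneg (parallelSum_nonneg fun j => (hx j).le) (hx i).le

theorem sum_parallelSum_div_le_one (x : ι → ℝ) : ∑ i, parallelSum x / x i ≤ 1 := by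
  simp_rw [div_eq_mul_inv, ← Finset.mul_sum, parallelSum]
  exact inv_mul_le_one

theorem card_mul_parallelSum_le {x : ι → ℝ} {b : ℝ} (hx : ∀ i, 0 < x i) (hb : 0 ≤ b)
    (hxb : ∀ i, x i ≤ b) : Fintype.card ι * parallelSum x ≤ b := by
  calc Fintype.card ι * parallelSum x = ∑ i, parallelSum x / x i * x i := by
        simp [(hx _).ne']
    _ ≤ ∑ i, parallelSum x / x i * b := Finset.sum_le_sum fun i _ =>
        mul_le_mul_of_nonneg_left (hxb i) (parallelSum_div_nonneg hx i)
    _ ≤ b := by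
        rw [← Finset.sum_mul]
        exact mul_le_of_le_one_left hb (sum_parallelSum_div_le_one x)

theorem parallelSum_le_dotProduct {x z : ι → ℝ} (hx : ∀ i, 0 < x i) (hz : ∀ i, 0 < z i) :
    parallelSum x ≤ (fun i => (parallelSum z / z i) ^ 2) ⬝ᵥ x := by
  have cauchy_schwarz : (∑ i, (z i)⁻¹) ^ 2 ≤ (∑ i, (x i)⁻¹) * ∑ i, ((z i)⁻¹) ^ 2 * x i :=
    Finset.sum_sq_le_sum_mul_sum_of_sq_le_mul _ (fun i _ => (inv_pos.2 (hx i)).le)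
      (fun i _ => mul_nonneg (sq_nonneg _) (hx i).le) fun i _ => by
        have := (hx i).ne'
        field_simp
        rfl
  rcases isEmpty_or_nonempty ι with hι | hι
  · simp [parallelSum]
  have hZ : 0 < ∑ i, (z i)⁻¹ :=
    Finset.sum_pos (fun i _ => inv_pos.2 (hz i)) Finset.univ_nonempty
  calc parallelSum x ≤ (∑ i, ((z i)⁻¹) ^ 2 * x i) / (∑ i, (z i)⁻¹) ^ 2 := by
        rw [parallelSum, inv_le_iff_one_le_mul₀ (Finset.sum_pos (fun i _ => inv_pos.2 (hx i))
          Finset.univ_nonempty), div_mul_eq_mul_div, one_le_div (by positivity)]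
        linarith
    _ = _ := by
        rw [dotProduct, Finset.sum_div]
        exact Finset.sum_congr rfl fun i _ => by rw [parallelSum]; field_simp

theorem dotProduct_sq_parallelSum_div {z : ι → ℝ} (hz : ∀ i, 0 < z i) :
    (fun i => (parallelSum z / z i) ^ 2) ⬝ᵥ z = parallelSum z := by
  have hterm : ∀ i, (parallelSum z / z i) ^ 2 * z i = parallelSum z ^ 2 * (z i)⁻¹ := fun i => by
    have := (hz i).ne'
    field_simp
  simp_rw [dotProduct, hterm, ← Finset.mul_sum, parallelSum]
  rcases eq_or_ne (∑ i, (z i)⁻¹) 0 with h | _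
  · simp [h]
  · field_simp

theorem concaveOn_parallelSum : ConcaveOn ℝ {x : ι → ℝ | ∀ i, 0 < x i} parallelSum :=
  concaveOn_of_exists_dotProduct_majorant convex_setOf_forall_pos fun _ hz =>
    ⟨_, (dotProduct_sq_parallelSum_div hz).le, fun _ hu => parallelSum_le_dotProduct hu hz⟩

theorem parallelSum_le_add {x y : ι → ℝ} {δ : ℝ} (hx : ∀ i, 0 < x i) (hy : ∀ i, 0 < y i)
    (hδ : 0 ≤ δ) (h : ∀ i, y i ≤ x i + δ) : parallelSum y ≤ parallelSum x + δ := by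
  have hw_sum : ∑ i, (parallelSum x / x i) ^ 2 ≤ 1 :=
    (Finset.sum_le_sum fun i _ => pow_le_of_le_one (parallelSum_div_nonneg hx i)
      ((div_le_one (hx i)).2 (parallelSum_le_apply hx i)) two_ne_zero).trans
      (sum_parallelSum_div_le_one x)
  calc parallelSum y ≤ (fun i => (parallelSum x / x i) ^ 2) ⬝ᵥ y := parallelSum_le_dotProduct hy hx
    _ ≤ (fun i => (parallelSum x / x i) ^ 2) ⬝ᵥ fun i => x i + δ :=
        Finset.sum_le_sum fun i _ => mul_le_mul_of_nonneg_left (h i) (sq_nonneg _)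
    _ = (fun i => (parallelSum x / x i) ^ 2) ⬝ᵥ x + (∑ i, (parallelSum x / x i) ^ 2) * δ := by
        simp_rw [dotProduct, mul_add, Finset.sum_add_distrib, Finset.sum_mul]
    _ ≤ parallelSum x + δ := by
        rw [dotProduct_sq_parallelSum_div hx]
        gcongr
        exact mul_le_of_le_one_left hδ hw_sum

theorem prod_rpow_inv_card_le_dotProduct [Nonempty ι] {x z : ι → ℝ} (hx : ∀ i, 0 < x i)
    (hz : ∀ i, 0 < z i) :
    (∏ i, x i) ^ (1 / (Fintype.card ι : ℝ)) ≤
      (fun i => (∏ k, z k) ^ (1 / (Fintype.card ι : ℝ)) / (Fintype.card ι * z i)) ⬝ᵥ x := by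
  have hZ : 0 < ∏ i, z i := Finset.prod_pos fun i _ => hz i
  have amgm := Real.geom_mean_le_arith_mean_weighted Finset.univ
    (fun _ : ι => 1 / (Fintype.card ι : ℝ)) (fun i => x i / z i) (fun _ _ => by positivity)
    (by simp) (fun i _ => (div_pos (hx i) (hz i)).le)
  rw [Real.finsetProd_rpow _ _ fun i _ => (div_pos (hx i) (hz i)).le, Finset.prod_div_distrib,
    Real.div_rpow (Finset.prod_nonneg fun i _ => (hx i).le) hZ.le, div_le_iff₀' (by positivity),
    Finset.mul_sum] at amgm
  refine amgm.trans_eq (Finset.sum_congr rfl fun i _ => ?_)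
  have := (hz i).ne'
  field_simp

theorem concaveOn_prod_rpow_inv_card :
    ConcaveOn ℝ {x : ι → ℝ | ∀ i, 0 < x i} fun x => (∏ i, x i) ^ (1 / (Fintype.card ι : ℝ)) := by
  rcases isEmpty_or_nonempty ι with hι | hι
  · simpa using concaveOn_const (1 : ℝ) (convex_setOf_forall_pos (ι := ι))
  refine concaveOn_of_exists_dotProduct_majorant convex_setOf_forall_pos fun z hz =>
    ⟨_, le_of_eq ?_, fun u hu => prod_rpow_inv_card_le_dotProduct hu hz⟩
  have hterm : ∀ i, (∏ k, z k) ^ (1 / (Fintype.card ι : ℝ)) / (Fintype.card ι * z i) * z i =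
      (∏ k, z k) ^ (1 / (Fintype.card ι : ℝ)) / Fintype.card ι := fun i => by
    have := (hz i).ne'
    field_simp
  simp_rw [dotProduct, hterm]
  simp [mul_div_cancel₀]

theorem abs_prod_rpow_inv_card_sub_le [Nonempty ι] {x y : ι → ℝ} {δ : ℝ}
    (hx : ∀ i, x i ∈ Set.Icc (0 : ℝ) 1) (hy : ∀ i, y i ∈ Set.Icc (0 : ℝ) 1) (hδ : 0 ≤ δ)
    (h : ∀ i, |x i - y i| ≤ δ) :
    |(∏ i, x i) ^ (1 / (Fintype.card ι : ℝ)) - (∏ i, y i) ^ (1 / (Fintype.card ι : ℝ))| ≤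
      2 * δ ^ (1 / (Fintype.card ι : ℝ)) := by
  have hprod : |∏ i, x i - ∏ i, y i| ≤ Fintype.card ι * δ := by
    calc |∏ i, x i - ∏ i, y i| ≤ ∑ i, |x i - y i| :=
          norm_prod_sub_prod_le (R := ℝ) Finset.univ
            (fun i => abs_le.2 ⟨by linarith [(hx i).1], (hx i).2⟩)
            fun i => abs_le.2 ⟨by linarith [(hy i).1], (hy i).2⟩
      _ ≤ ∑ _i : ι, δ := Finset.sum_le_sum fun i _ => h i
      _ = Fintype.card ι * δ := by simp
  calc _ ≤ |∏ i, x i - ∏ i, y i| ^ (1 / (Fintype.card ι : ℝ)) :=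
        abs_rpow_sub_rpow_le (Finset.prod_nonneg fun i _ => (hx i).1)
          (Finset.prod_nonneg fun i _ => (hy i).1) (by positivity)
          (div_le_one_of_le₀ (by exact_mod_cast Fintype.card_pos) (by positivity))
    _ ≤ (Fintype.card ι * δ) ^ (1 / (Fintype.card ι : ℝ)) := by gcongr
    _ = (Fintype.card ι : ℝ) ^ (1 / (Fintype.card ι : ℝ)) * δ ^ (1 / (Fintype.card ι : ℝ)) :=
        Real.mul_rpow (by positivity) hδ
    _ ≤ 2 * δ ^ (1 / (Fintype.card ι : ℝ)) := by
        gcongr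
        exact natCast_rpow_one_div_le_two _

/-- The quadratic mean. -/
def quadMean (x : ι → ℝ) : ℝ := √(1 / (Fintype.card ι : ℝ) * ∑ i, x i ^ 2)

theorem quadMean_eq_norm (x : ι → ℝ) :
    quadMean x = √(1 / (Fintype.card ι : ℝ)) * ‖WithLp.toLp 2 x‖ := by
  rw [quadMean, Real.sqrt_mul (by positivity), EuclideanSpace.norm_eq]
  simp

theorem convexOn_quadMean : ConvexOn ℝ Set.univ (quadMean : (ι → ℝ) → ℝ) := by
  refine ⟨convex_univ, fun x _ y _ a b ha hb hab => ?_⟩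
  have h := (convexOn_norm (convex_univ (𝕜 := ℝ) (E := EuclideanSpace ℝ ι))).2
    (Set.mem_univ (WithLp.toLp 2 x)) (Set.mem_univ (WithLp.toLp 2 y)) ha hb hab
  simp_rw [quadMean_eq_norm, WithLp.toLp_add, WithLp.toLp_smul]
  calc _ ≤ √(1 / (Fintype.card ι : ℝ)) * (a • ‖WithLp.toLp 2 x‖ + b • ‖WithLp.toLp 2 y‖) := by
        gcongr
    _ = _ := by simp only [smul_eq_mul]; ring

theorem quadMean_le {x : ι → ℝ} {δ : ℝ} (hδ : 0 ≤ δ) (h : ∀ i, |x i| ≤ δ) : quadMean x ≤ δ := by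
  refine Real.sqrt_le_iff.2 ⟨hδ, ?_⟩
  calc 1 / (Fintype.card ι : ℝ) * ∑ i, x i ^ 2
      ≤ 1 / (Fintype.card ι : ℝ) * ∑ _i : ι, δ ^ 2 := by
        gcongr 1 / (Fintype.card ι : ℝ) * ∑ i, ?_ with i
        exact sq_le_sq.2 ((h i).trans (le_abs_self δ))
    _ = (Fintype.card ι : ℝ)⁻¹ * Fintype.card ι * δ ^ 2 := by simp [mul_assoc]
    _ ≤ δ ^ 2 := mul_le_of_le_one_left (sq_nonneg δ) inv_mul_le_one

theorem abs_quadMean_sub_le {x y : ι → ℝ} {δ : ℝ} (hδ : 0 ≤ δ) (h : ∀ i, |x i - y i| ≤ δ) :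
    |quadMean x - quadMean y| ≤ δ := by
  refine le_trans ?_ (quadMean_le (x := x - y) hδ h)
  simp_rw [quadMean_eq_norm, ← mul_sub, WithLp.toLp_sub, abs_mul,
    abs_of_nonneg (Real.sqrt_nonneg _)]
  gcongr
  exact abs_norm_sub_norm_le _ _

theorem le_quadMean [Nonempty ι] {x : ι → ℝ} {δ : ℝ} (hδ : 0 ≤ δ) (h : ∀ i, δ ≤ x i) :
    δ ≤ quadMean x := by
  refine Real.le_sqrt_of_sq_le ?_
  calc δ ^ 2 = 1 / (Fintype.card ι : ℝ) * ∑ _i : ι, δ ^ 2 := by simp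
    _ ≤ 1 / (Fintype.card ι : ℝ) * ∑ i, x i ^ 2 := by
        gcongr 1 / (Fintype.card ι : ℝ) * ∑ i, ?_ ^ 2 with i
        exact h i

theorem abs_apply_le_sqrt_card_mul_quadMean (x : ι → ℝ) (i : ι) :
    |x i| ≤ √(Fintype.card ι) * quadMean x := by
  have : Nonempty ι := ⟨i⟩
  rw [quadMean_eq_norm, ← mul_assoc, ← Real.sqrt_mul (by positivity),
    mul_one_div_cancel (by positivity), Real.sqrt_one, one_mul]
  exact PiLp.norm_apply_le (WithLp.toLp 2 x) i

end Means

/-! ### Lipschitz functions and gradients for the `ℓ₁` norm on matrices -/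

section Gradients

variable {n : ℕ}

theorem l1Norm_nonneg (M : Matrix (Fin n) (Fin n) ℝ) : 0 ≤ l1Norm M :=
  Finset.sum_nonneg fun _ _ => Finset.sum_nonneg fun _ _ => abs_nonneg _

theorem l1Norm_sub_le (M N : Matrix (Fin n) (Fin n) ℝ) :
    l1Norm (M - N) ≤ l1Norm M + l1Norm N := by
  simp_rw [l1Norm, ← Finset.sum_add_distrib]
  exact Finset.sum_le_sum fun i _ => Finset.sum_le_sum fun j _ => abs_sub _ _

theorem l1Norm_smul (a : ℝ) (M : Matrix (Fin n) (Fin n) ℝ) :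
    l1Norm (a • M) = |a| * l1Norm M := by
  simp [l1Norm, abs_mul, Finset.mul_sum]

theorem l1Norm_sub_comm (M N : Matrix (Fin n) (Fin n) ℝ) : l1Norm (M - N) = l1Norm (N - M) := by
  simp [l1Norm, abs_sub_comm]

theorem l1Norm_le_of_abs_apply_le {M : Matrix (Fin n) (Fin n) ℝ} {ε : ℝ}
    (h : ∀ i j, |M i j| ≤ ε) : l1Norm M ≤ n ^ 2 * ε := by
  calc l1Norm M ≤ ∑ _i : Fin n, ∑ _j : Fin n, ε :=
        Finset.sum_le_sum fun i _ => Finset.sum_le_sum fun j _ => h i j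
    _ = n ^ 2 * ε := by simp [sq, mul_assoc]

theorem convex_cube : Convex ℝ (cube n) :=
  fun _ hM _ hN _ _ ha hb hab i j => convex_Icc (0 : ℝ) 1 (hM i j) (hN i j) ha hb hab

theorem LipschitzL1On.mono {f : Matrix (Fin n) (Fin n) ℝ → ℝ} {s : Set (Matrix (Fin n) (Fin n) ℝ)}
    {K L : ℝ} (hf : LipschitzL1On K f s) (hKL : K ≤ L) : LipschitzL1On L f s :=
  fun M hM N hN =>
    (hf M hM N hN).trans (mul_le_mul_of_nonneg_right hKL (l1Norm_nonneg _))

theorem LipschitzL1On.const_mul {f : Matrix (Fin n) (Fin n) ℝ → ℝ}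
    {s : Set (Matrix (Fin n) (Fin n) ℝ)} {K : ℝ} (hf : LipschitzL1On K f s) (c : ℝ) :
    LipschitzL1On (|c| * K) (fun M => c * f M) s := fun M hM N hN => by
  rw [← mul_sub, abs_mul, mul_assoc]
  exact mul_le_mul_of_nonneg_left (hf M hM N hN) (abs_nonneg c)

theorem LipschitzL1On.mul {f g : Matrix (Fin n) (Fin n) ℝ → ℝ}
    {s : Set (Matrix (Fin n) (Fin n) ℝ)} {A B K L : ℝ} (hf : LipschitzL1On K f s)
    (hg : LipschitzL1On L g s) (hA : ∀ M ∈ s, |f M| ≤ A) (hB : ∀ M ∈ s, |g M| ≤ B) :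
    LipschitzL1On (A * L + K * B) (fun M => f M * g M) s := fun M hM N hN => by
  calc |f M * g M - f N * g N| = |f M * (g M - g N) + (f M - f N) * g N| := by ring_nf
    _ ≤ |f M| * |g M - g N| + |f M - f N| * |g N| := by
        simpa only [abs_mul] using abs_add_le (f M * (g M - g N)) ((f M - f N) * g N)
    _ ≤ A * (L * l1Norm (M - N)) + K * l1Norm (M - N) * B := by
        gcongr
        · exact (abs_nonneg _).trans (hA M hM)
        · exact hA M hM
        · exact hg M hM N hN
        · exact (abs_nonneg _).trans (hf M hM N hN)
        · exact hf M hM N hN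
        · exact hB N hN
    _ = (A * L + K * B) * l1Norm (M - N) := by ring

/-- The entrywise inner product of matrices. -/
def frob (G V : Matrix (Fin n) (Fin n) ℝ) : ℝ := ∑ i, ∑ j, G i j * V i j

theorem frob_sub_right (G V W : Matrix (Fin n) (Fin n) ℝ) :
    frob G (V - W) = frob G V - frob G W := by
  simp [frob, mul_sub, Finset.sum_sub_distrib]

theorem frob_sub_left (G H V : Matrix (Fin n) (Fin n) ℝ) :
    frob (G - H) V = frob G V - frob H V := by
  simp [frob, sub_mul, Finset.sum_sub_distrib]

theorem frob_add_left (G H V : Matrix (Fin n) (Fin n) ℝ) :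
    frob (G + H) V = frob G V + frob H V := by
  simp [frob, add_mul, Finset.sum_add_distrib]

theorem frob_smul_left (c : ℝ) (G V : Matrix (Fin n) (Fin n) ℝ) :
    frob (c • G) V = c * frob G V := by
  simp [frob, mul_assoc, Finset.mul_sum]

theorem frob_smul_right (c : ℝ) (G V : Matrix (Fin n) (Fin n) ℝ) :
    frob G (c • V) = c * frob G V := by
  simp [frob, mul_left_comm, Finset.mul_sum]

theorem frob_single (G : Matrix (Fin n) (Fin n) ℝ) (i j : Fin n) :
    frob G (Matrix.single i j 1) = G i j := by
  simp [frob, Matrix.single_apply, ite_and]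

theorem frob_updateRow_zero (i : Fin n) (w : Fin n → ℝ) (V : Matrix (Fin n) (Fin n) ℝ) :
    frob (Matrix.updateRow 0 i w) V = w ⬝ᵥ V i := by
  rw [frob, Finset.sum_eq_single i (fun k _ hk => by simp [Matrix.updateRow_apply, hk]) (by simp)]
  simp [dotProduct]

theorem abs_frob_le {G : Matrix (Fin n) (Fin n) ℝ} {B : ℝ} (hG : ∀ i j, |G i j| ≤ B)
    (V : Matrix (Fin n) (Fin n) ℝ) : |frob G V| ≤ B * l1Norm V := by
  simp_rw [frob, l1Norm, Finset.mul_sum]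
  refine (Finset.abs_sum_le_sum_abs _ _).trans (Finset.sum_le_sum fun i _ => ?_)
  refine (Finset.abs_sum_le_sum_abs _ _).trans (Finset.sum_le_sum fun j _ => ?_)
  rw [abs_mul]
  exact mul_le_mul_of_nonneg_right (hG i j) (abs_nonneg _)

/-- `G` is the gradient of `f` at `M`, in the sense of directional (Gateaux) derivatives: these
determine `grad f` and need no choice of a norm on matrices. -/
def HasGradAt (f : Matrix (Fin n) (Fin n) ℝ → ℝ) (G M : Matrix (Fin n) (Fin n) ℝ) : Prop :=
  ∀ V, HasDerivAt (fun t : ℝ => f (M + t • V)) (frob G V) 0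

variable {f g : Matrix (Fin n) (Fin n) ℝ → ℝ} {F G M : Matrix (Fin n) (Fin n) ℝ}

theorem HasGradAt.grad_eq (hf : HasGradAt f G M) : grad f M = G := by
  ext i j
  rw [grad, (hf (Matrix.single i j 1)).deriv, frob_single]

theorem HasGradAt.congr_grad (hf : HasGradAt f G M) (h : ∀ i j, G i j = F i j) :
    HasGradAt f F M :=
  (Matrix.ext h : G = F) ▸ hf

theorem HasGradAt.comp {φ : ℝ → ℝ} {φ' : ℝ} (hφ : HasDerivAt φ φ' (f M)) (hf : HasGradAt f G M) :
    HasGradAt (fun M => φ (f M)) (φ' • G) M := fun V => by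
  rw [frob_smul_left]
  exact HasDerivAt.comp (h := fun t : ℝ => f (M + t • V)) 0 (by simpa using hφ) (hf V)

theorem HasGradAt.add_const (hf : HasGradAt f G M) (c : ℝ) :
    HasGradAt (fun M => f M + c) G M := fun V => (hf V).add_const c

theorem HasGradAt.sub (hf : HasGradAt f F M) (hg : HasGradAt g G M) :
    HasGradAt (fun M => f M - g M) (F - G) M := fun V => by
  rw [frob_sub_left]
  exact (hf V).sub (hg V)

theorem HasGradAt.const_mul (hf : HasGradAt f G M) (c : ℝ) :
    HasGradAt (fun M => c * f M) (c • G) M := fun V => by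
  rw [frob_smul_left]
  exact (hf V).const_mul c

theorem HasGradAt.mul (hf : HasGradAt f F M) (hg : HasGradAt g G M) :
    HasGradAt (fun M => f M * g M) (f M • G + g M • F) M := fun V => by
  rw [frob_add_left, frob_smul_left, frob_smul_left, add_comm, mul_comm (g M)]
  simpa using (hf V).fun_mul (hg V)

theorem HasGradAt.inv (hf : HasGradAt f G M) (h : f M ≠ 0) :
    HasGradAt (fun M => (f M)⁻¹) (-((f M)⁻¹ ^ 2) • G) M := by
  rw [inv_pow]
  exact .comp (hasDerivAt_inv h) hf

theorem abs_updateRow_zero_le {w : Fin n → ℝ} {K : ℝ} (hw : ∀ j, |w j| ≤ K) (k i j : Fin n) :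
    |Matrix.updateRow 0 k w i j| ≤ K := by
  have hK : 0 ≤ K := (abs_nonneg _).trans (hw j)
  rw [Matrix.updateRow_apply]
  split_ifs <;> simp [hw, hK]

theorem hasGradAt_sum_of_updateRow {f : Fin n → Matrix (Fin n) (Fin n) ℝ → ℝ}
    (hf : ∀ i, HasGradAt (f i) (Matrix.updateRow 0 i (G i)) M) :
    HasGradAt (fun M => ∑ i, f i M) G M := fun V => by
  simp_rw [HasGradAt, frob_updateRow_zero] at hf
  exact HasDerivAt.fun_sum fun i _ => hf i V

theorem hasGradAt_prod_of_updateRow {f : Fin n → Matrix (Fin n) (Fin n) ℝ → ℝ}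
    (hf : ∀ i, HasGradAt (f i) (Matrix.updateRow 0 i (f i M • G i)) M) :
    HasGradAt (fun M => ∏ i, f i M) ((∏ i, f i M) • G) M := fun V => by
  simp_rw [HasGradAt, frob_updateRow_zero] at hf
  have h := HasDerivAt.fun_finsetProd (u := Finset.univ) fun i _ => hf i V
  simp only [zero_smul, add_zero] at h
  refine h.congr_deriv ?_
  simp_rw [frob_smul_left, frob, Finset.mul_sum, smul_eq_mul, dotProduct, Pi.smul_apply]
  refine Finset.sum_congr rfl fun i _ => ?_
  rw [← Finset.prod_erase_mul _ _ (Finset.mem_univ i), Finset.mul_sum]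
  exact Finset.sum_congr rfl fun j _ => by simp only [smul_eq_mul]; ring

theorem hasGradAt_apply (i j : Fin n) (M : Matrix (Fin n) (Fin n) ℝ) :
    HasGradAt (fun M => M i j) (Matrix.updateRow 0 i (Pi.single j 1)) M := fun V => by
  rw [frob_updateRow_zero, single_one_dotProduct]
  simpa using ((hasDerivAt_id (0 : ℝ)).mul_const (V i j)).const_add (M i j)

theorem hasGradAt_rowSum (i : Fin n) (M : Matrix (Fin n) (Fin n) ℝ) :
    HasGradAt (fun M => ∑ j, M i j) (Matrix.updateRow 0 i 1) M := fun V => by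
  rw [frob_updateRow_zero, one_dotProduct]
  refine HasDerivAt.fun_sum fun j _ => ?_
  simpa [frob_updateRow_zero, single_one_dotProduct] using hasGradAt_apply i j M V

theorem hasDerivAt_line_of_hasDerivAt_zero {E : Type*} [AddCommGroup E] [Module ℝ E] {φ : E → ℝ}
    {x v : E} {t d : ℝ} (h : HasDerivAt (fun r : ℝ => φ (x + t • v + r • v)) d 0) :
    HasDerivAt (fun r : ℝ => φ (x + r • v)) d t := by
  have hshift := HasDerivAt.comp (h := fun r : ℝ => r - t) t (by simpa using h)
    ((hasDerivAt_id t).sub_const t)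
  rw [mul_one] at hshift
  refine hshift.congr_of_eventuallyEq (.of_forall fun r => ?_)
  simp only [Function.comp_apply]
  congr 1
  module

theorem lipschitzL1On_of_hasGradAt {s : Set (Matrix (Fin n) (Fin n) ℝ)} (hs : Convex ℝ s)
    {G : Matrix (Fin n) (Fin n) ℝ → Matrix (Fin n) (Fin n) ℝ} {K : ℝ}
    (hf : ∀ M ∈ s, HasGradAt f (G M) M) (hK : ∀ M ∈ s, ∀ i j, |G M i j| ≤ K) :
    LipschitzL1On K f s := fun M hM N hN => by
  have mem_line : ∀ t ∈ Set.Icc (0 : ℝ) 1, M + t • (N - M) ∈ s := fun t ht =>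
    hs.add_smul_sub_mem hM hN ht
  have mvt := (convex_Icc (0 : ℝ) 1).norm_image_sub_le_of_norm_hasDerivWithin_le
    (fun t ht => (hasDerivAt_line_of_hasDerivAt_zero (hf _ (mem_line t ht) _)).hasDerivWithinAt)
    (fun t ht => abs_frob_le (hK _ (mem_line t ht)) (N - M))
    (Set.left_mem_Icc.2 zero_le_one) (Set.right_mem_Icc.2 zero_le_one)
  simpa [abs_sub_comm, l1Norm_sub_comm] using mvt

theorem smoothL1On_of_hasGradAt {s : Set (Matrix (Fin n) (Fin n) ℝ)}
    {G : Matrix (Fin n) (Fin n) ℝ → Matrix (Fin n) (Fin n) ℝ} {β : ℝ}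
    (hf : ∀ M ∈ s, HasGradAt f (G M) M) (hβ : ∀ i j, LipschitzL1On β (fun M => G M i j) s) :
    SmoothL1On β f s :=
  ⟨fun M hM _ _ => (hf M hM _).differentiableAt, fun M hM N hN i j => by
    rw [(hf M hM).grad_eq, (hf N hN).grad_eq]
    exact hβ i j M hM N hN⟩

end Gradients

/-! ### Confusion matrices of randomized classifiers -/

section Conf

variable {X : Type*} [MeasurableSpace X] {n : ℕ}

theorem IsClassifier.nonneg {h : X → Fin n → ℝ} (hh : IsClassifier h) (x : X) (j : Fin n) :
    0 ≤ h x j := (hh.2 x).1 j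

theorem IsClassifier.sum_eq_one {h : X → Fin n → ℝ} (hh : IsClassifier h) (x : X) :
    ∑ j, h x j = 1 := (hh.2 x).2

theorem IsClassifier.le_one {h : X → Fin n → ℝ} (hh : IsClassifier h) (x : X) (j : Fin n) :
    h x j ≤ 1 := by
  rw [← hh.sum_eq_one x]
  exact Finset.single_le_sum (fun i _ => hh.nonneg x i) (Finset.mem_univ j)

theorem IsClassifier.measurable_apply {h : X → Fin n → ℝ} (hh : IsClassifier h) (j : Fin n) :
    Measurable (fun x => h x j) := (measurable_pi_apply j).comp hh.1

theorem IsClassifier.convexComb {h u : X → Fin n → ℝ} (hh : IsClassifier h)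
    (hu : IsClassifier u) {a b : ℝ} (ha : 0 ≤ a) (hb : 0 ≤ b) (hab : a + b = 1) :
    IsClassifier (fun x i => a * h x i + b * u x i) :=
  ⟨(hh.1.const_smul a).add (hu.1.const_smul b),
    fun x => convex_stdSimplex ℝ (Fin n) (hh.2 x) (hu.2 x) ha hb hab⟩

theorem measurable_labelIndicator (i : Fin n) :
    Measurable (fun z : X × Fin n => if z.2 = i then (1 : ℝ) else 0) :=
  (measurable_of_finite (fun y : Fin n => if y = i then (1 : ℝ) else 0)).comp measurable_snd

theorem IsClassifier.measurable_confIntegrand {h : X → Fin n → ℝ} (hh : IsClassifier h)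
    (i j : Fin n) :
    Measurable (fun z : X × Fin n => h z.1 j * (if z.2 = i then (1 : ℝ) else 0)) :=
  ((hh.measurable_apply j).comp measurable_fst).mul (measurable_labelIndicator i)

theorem IsClassifier.confIntegrand_mem_Icc {h : X → Fin n → ℝ} (hh : IsClassifier h)
    (i j : Fin n) (z : X × Fin n) :
    h z.1 j * (if z.2 = i then (1 : ℝ) else 0) ∈ Set.Icc (0 : ℝ) 1 := by
  split_ifs <;> simp [hh.nonneg, hh.le_one]

theorem IsClassifier.integrable_confIntegrand {h : X → Fin n → ℝ} (hh : IsClassifier h)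
    (D : Measure (X × Fin n)) [IsFiniteMeasure D] (i j : Fin n) :
    Integrable (fun z : X × Fin n => h z.1 j * (if z.2 = i then (1 : ℝ) else 0)) D :=
  .of_mem_Icc 0 1 (hh.measurable_confIntegrand i j).aemeasurable
    (.of_forall (hh.confIntegrand_mem_Icc i j))

theorem conf_nonneg {h : X → Fin n → ℝ} (hh : IsClassifier h) (D : Measure (X × Fin n))
    (i j : Fin n) : 0 ≤ conf D h i j :=
  integral_nonneg fun z => (hh.confIntegrand_mem_Icc i j z).1

theorem conf_rowSum {h : X → Fin n → ℝ} (hh : IsClassifier h) (D : Measure (X × Fin n))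
    [IsFiniteMeasure D] (i : Fin n) : ∑ j, conf D h i j = prior D i := by
  unfold conf prior
  rw [← integral_finsetSum _ fun j _ => hh.integrable_confIntegrand D i j]
  simp_rw [← Finset.sum_mul, hh.sum_eq_one, one_mul]
  rw [Measure.snd, map_measureReal_apply measurable_snd (measurableSet_singleton i),
    ← integral_indicator_one (measurable_snd (measurableSet_singleton i))]
  exact integral_congr_ae (.of_forall fun z => by simp [Set.indicator])

theorem sum_prior (D : Measure (X × Fin n)) [IsProbabilityMeasure D] : ∑ y, prior D y = 1 := by
  simp [prior, sum_measureReal_singleton]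

theorem conf_le_prior {h : X → Fin n → ℝ} (hh : IsClassifier h) (D : Measure (X × Fin n))
    [IsFiniteMeasure D] (i j : Fin n) : conf D h i j ≤ prior D i := by
  rw [← conf_rowSum hh D i]
  exact Finset.single_le_sum (fun k _ => conf_nonneg hh D i k) (Finset.mem_univ j)

theorem conf_mem_cube {h : X → Fin n → ℝ} (hh : IsClassifier h) (D : Measure (X × Fin n))
    [IsProbabilityMeasure D] : conf D h ∈ cube n :=
  fun i j => ⟨conf_nonneg hh D i j, (conf_le_prior hh D i j).trans measureReal_le_one⟩

theorem conf_convexComb {h u : X → Fin n → ℝ} (hh : IsClassifier h) (hu : IsClassifier u)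
    (D : Measure (X × Fin n)) [IsFiniteMeasure D] (a b : ℝ) :
    conf D (fun x i => a * h x i + b * u x i) = a • conf D h + b • conf D u := by
  ext i j
  simp only [conf, Matrix.add_apply, Matrix.smul_apply, smul_eq_mul]
  rw [← integral_const_mul, ← integral_const_mul, ← integral_add
    ((hh.integrable_confIntegrand D i j).const_mul a)
    ((hu.integrable_confIntegrand D i j).const_mul b)]
  congr 1
  ext z
  ring

theorem l1Norm_conf {h : X → Fin n → ℝ} (hh : IsClassifier h) (D : Measure (X × Fin n))
    [IsProbabilityMeasure D] : l1Norm (conf D h) = 1 := by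
  unfold l1Norm
  simp_rw [abs_of_nonneg (conf_nonneg hh D _ _), conf_rowSum hh D, sum_prior]

theorem l1Norm_conf_sub_le_two {g h : X → Fin n → ℝ} (hg : IsClassifier g) (hh : IsClassifier h)
    (D : Measure (X × Fin n)) [IsProbabilityMeasure D] :
    l1Norm (conf D g - conf D h) ≤ 2 := by
  refine (l1Norm_sub_le _ _).trans ?_
  rw [l1Norm_conf hg, l1Norm_conf hh, one_add_one_eq_two]

theorem convex_feasible (D : Measure (X × Fin n)) [IsFiniteMeasure D] :
    Convex ℝ (feasible D) := by
  rintro _ ⟨h, hh, rfl⟩ _ ⟨u, hu, rfl⟩ a b ha hb hab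
  exact ⟨_, hh.convexComb hu ha hb hab, (conf_convexComb hh hu D a b).symm⟩

theorem feasible_subset_cube (D : Measure (X × Fin n)) [IsProbabilityMeasure D] :
    feasible D ⊆ cube n := by
  rintro _ ⟨h, hh, rfl⟩
  exact conf_mem_cube hh D

theorem rowSum_eq_prior_of_mem_feasible {D : Measure (X × Fin n)} [IsFiniteMeasure D]
    {C : Matrix (Fin n) (Fin n) ℝ} (hC : C ∈ feasible D) (y : Fin n) :
    ∑ z, C y z = prior D y := by
  obtain ⟨h, hh, rfl⟩ := hC
  exact conf_rowSum hh D y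

theorem diag_le_prior_of_mem_feasible {D : Measure (X × Fin n)} [IsFiniteMeasure D]
    {C : Matrix (Fin n) (Fin n) ℝ} (hC : C ∈ feasible D) (y : Fin n) : C y y ≤ prior D y := by
  obtain ⟨h, hh, rfl⟩ := hC
  exact conf_le_prior hh D y y

theorem priorMin_le (D : Measure (X × Fin n)) (y : Fin n) : priorMin D ≤ prior D y :=
  ciInf_le (Set.finite_range _).bddBelow y

theorem priorMin_pos [NeZero n] {D : Measure (X × Fin n)} (h : ∀ y, 0 < prior D y) :
    0 < priorMin D := by
  obtain ⟨y, hy⟩ := exists_eq_ciInf_of_finite (f := prior D)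
  rw [priorMin, ← hy]
  exact h y

end Conf

/-! ### Smoothed recalls and miss rates -/

section SmoothRates

theorem div_le_add_div_add {c p ρ : ℝ} (hc : 0 ≤ c) (hcp : c ≤ p) (hρ : 0 < ρ) :
    c / p ≤ (c + ρ) / (p + ρ) := by
  rcases (hc.trans hcp).eq_or_lt with rfl | hp
  · simp only [div_zero, zero_add]
    positivity
  · rw [div_le_div_iff₀ hp (by positivity)]
    nlinarith

theorem add_div_add_sub_div_le {c p q ρ : ℝ} (hc : 0 ≤ c) (hq : 0 < q) (hqp : q ≤ p)
    (hρ : 0 < ρ) : (c + ρ) / (p + ρ) - c / p ≤ ρ / q := by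
  have hp : 0 < p := hq.trans_le hqp
  calc (c + ρ) / (p + ρ) - c / p ≤ (c + ρ) / p - c / p := by gcongr; linarith
    _ = ρ / p := by ring
    _ ≤ ρ / q := by gcongr

theorem abs_div_add_sub_div_le {c p q ρ : ℝ} (hc : 0 ≤ c) (hcp : c ≤ p) (hq : 0 < q)
    (hqp : q ≤ p) (hρ : 0 < ρ) : |c / (p + ρ) - c / p| ≤ ρ / q := by
  have hp : 0 < p := hq.trans_le hqp
  have hle : c / (p + ρ) ≤ c / p := by gcongr; linarith
  rw [abs_sub_comm, abs_of_nonneg (sub_nonneg.2 hle)]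
  calc c / p - c / (p + ρ) = c / p * (ρ / (p + ρ)) := by field_simp; ring
    _ ≤ 1 * (ρ / q) := by
        gcongr
        · exact (div_le_one hp).2 hcp
        · linarith
    _ = ρ / q := one_mul _

variable {n : ℕ}

/-- The recall `C_yy / s_y` of the label `y`, with `ρ` added to the numerator and to the
denominator. -/
def smoothRecall (ρ : ℝ) (C : Matrix (Fin n) (Fin n) ℝ) (y : Fin n) : ℝ :=
  (C y y + ρ) / (∑ z, C y z + ρ)

/-- The miss rate `(s_y - C_yy) / s_y` of the label `y`, with `ρ` added to the numerator and to
the denominator. -/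
def smoothMiss (ρ : ℝ) (C : Matrix (Fin n) (Fin n) ℝ) (y : Fin n) : ℝ :=
  (∑ z ∈ Finset.univ.erase y, C y z + ρ) / (∑ z, C y z + ρ)

/-- The matrix whose row `y` is the gradient of `log (smoothRecall ρ · y)`, a function of row `y`
alone. -/
def logRecallGrad (ρ : ℝ) (C : Matrix (Fin n) (Fin n) ℝ) : Matrix (Fin n) (Fin n) ℝ :=
  fun y z => (if y = z then (C y y + ρ)⁻¹ else 0) - (∑ z, C y z + ρ)⁻¹

/-- The matrix whose row `y` is the gradient of `smoothMiss ρ · y`, a function of row `y`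
alone. -/
def missGrad (ρ : ℝ) (C : Matrix (Fin n) (Fin n) ℝ) : Matrix (Fin n) (Fin n) ℝ :=
  fun y z => (1 - smoothMiss ρ C y - if y = z then 1 else 0) * (∑ z, C y z + ρ)⁻¹

theorem sum_erase_eq_rowSum_sub (C : Matrix (Fin n) (Fin n) ℝ) (y : Fin n) :
    ∑ z ∈ Finset.univ.erase y, C y z = ∑ z, C y z - C y y :=
  Finset.sum_erase_eq_sub (Finset.mem_univ y)

theorem diag_le_rowSum {C : Matrix (Fin n) (Fin n) ℝ} (hC : C ∈ cube n) (y : Fin n) :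
    C y y ≤ ∑ z, C y z :=
  Finset.single_le_sum (fun z _ => (hC y z).1) (Finset.mem_univ y)

variable {ρ : ℝ} {C : Matrix (Fin n) (Fin n) ℝ}

theorem le_rowSum_add (hC : C ∈ cube n) (y : Fin n) : ρ ≤ ∑ z, C y z + ρ :=
  le_add_of_nonneg_left ((hC y y).1.trans (diag_le_rowSum hC y))

theorem smoothMiss_eq (hρ : 0 < ρ) (hC : C ∈ cube n) (y : Fin n) :
    smoothMiss ρ C y = 1 - C y y / (∑ z, C y z + ρ) := by
  have := (hρ.trans_le (le_rowSum_add hC y)).ne'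
  rw [smoothMiss, sum_erase_eq_rowSum_sub]
  field_simp
  ring

theorem smoothRecall_pos (hρ : 0 < ρ) (hC : C ∈ cube n) (y : Fin n) : 0 < smoothRecall ρ C y :=
  div_pos (add_pos_of_nonneg_of_pos (hC y y).1 hρ) (hρ.trans_le (le_rowSum_add hC y))

theorem smoothRecall_le_one (hρ : 0 < ρ) (hC : C ∈ cube n) (y : Fin n) :
    smoothRecall ρ C y ≤ 1 :=
  (div_le_one (hρ.trans_le (le_rowSum_add hC y))).2 (by linarith [diag_le_rowSum hC y])

theorem smoothMiss_mem_Icc (hρ : 0 < ρ) (hC : C ∈ cube n) (y : Fin n) :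
    smoothMiss ρ C y ∈ Set.Icc (ρ / (1 + ρ)) 1 := by
  have hσ : 0 < ∑ z, C y z + ρ := hρ.trans_le (le_rowSum_add hC y)
  have hrow := diag_le_rowSum hC y
  rw [smoothMiss, sum_erase_eq_rowSum_sub, Set.mem_Icc, div_le_div_iff₀ (by positivity) hσ,
    div_le_one hσ]
  exact ⟨by nlinarith [(hC y y).2], by linarith [(hC y y).1]⟩

theorem hasGradAt_smoothRecall (hρ : 0 < ρ) (hC : C ∈ cube n) (y : Fin n) :
    HasGradAt (fun C => smoothRecall ρ C y)
      (Matrix.updateRow 0 y (smoothRecall ρ C y • logRecallGrad ρ C y)) C := by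
  have hσ := (hρ.trans_le (le_rowSum_add hC y)).ne'
  have ha := (add_pos_of_nonneg_of_pos (hC y y).1 hρ).ne'
  simp only [smoothRecall, div_eq_mul_inv]
  convert ((hasGradAt_apply y y C).add_const ρ).mul
    (((hasGradAt_rowSum y C).add_const ρ).inv hσ) using 1
  ext i z
  rcases eq_or_ne i y with rfl | hi
  · rcases eq_or_ne i z with rfl | hz
    · simp only [logRecallGrad, Matrix.updateRow_self, Matrix.add_apply, Matrix.smul_apply,
        Pi.smul_apply, smul_eq_mul, Pi.one_apply, Pi.single_eq_same, if_true]
      field_simp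
      ring
    · simp only [logRecallGrad, Matrix.updateRow_self, Matrix.add_apply, Matrix.smul_apply,
        Pi.smul_apply, smul_eq_mul, Pi.one_apply, Pi.single_eq_of_ne' hz, if_neg hz]
      field_simp
      ring
  · simp [Matrix.updateRow_ne hi]

theorem hasGradAt_smoothMiss (hρ : 0 < ρ) (hC : C ∈ cube n) (y : Fin n) :
    HasGradAt (fun C => smoothMiss ρ C y) (Matrix.updateRow 0 y (missGrad ρ C y)) C := by
  have hσ := (hρ.trans_le (le_rowSum_add hC y)).ne'
  simp only [smoothMiss, sum_erase_eq_rowSum_sub, div_eq_mul_inv]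
  convert (((hasGradAt_rowSum y C).sub (hasGradAt_apply y y C)).add_const ρ).mul
    (((hasGradAt_rowSum y C).add_const ρ).inv hσ) using 1
  ext i z
  rcases eq_or_ne i y with rfl | hi
  · simp only [missGrad, smoothMiss, sum_erase_eq_rowSum_sub, Matrix.updateRow_self,
      Matrix.add_apply, Matrix.sub_apply, Matrix.smul_apply, smul_eq_mul, Pi.one_apply,
      Pi.single_apply, eq_comm (a := z)]
    field_simp
    ring
  · simp [Matrix.updateRow_ne hi]

theorem inv_rowSum_add_mem_Icc (hρ : 0 < ρ) (hC : C ∈ cube n) (y : Fin n) :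
    (∑ z, C y z + ρ)⁻¹ ∈ Set.Icc 0 (1 / ρ) := by
  have hσ := hρ.trans_le (le_rowSum_add hC y)
  exact ⟨inv_nonneg.2 hσ.le, by rw [one_div]; gcongr; exact le_rowSum_add hC y⟩

theorem inv_diag_add_mem_Icc (hρ : 0 < ρ) (hC : C ∈ cube n) (y : Fin n) :
    (C y y + ρ)⁻¹ ∈ Set.Icc 0 (1 / ρ) := by
  have hle : ρ ≤ C y y + ρ := le_add_of_nonneg_left (hC y y).1
  exact ⟨inv_nonneg.2 (hρ.le.trans hle), by rw [one_div]; gcongr⟩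

theorem abs_logRecallGrad_le (hρ : 0 < ρ) (hC : C ∈ cube n) (y z : Fin n) :
    |logRecallGrad ρ C y z| ≤ 1 / ρ := by
  have ha := inv_diag_add_mem_Icc hρ hC y
  have hσ := inv_rowSum_add_mem_Icc hρ hC y
  rw [logRecallGrad, abs_le]
  split_ifs <;> constructor <;> linarith [ha.1, ha.2, hσ.1, hσ.2]

theorem abs_one_sub_smoothMiss_sub_ite_le (hρ : 0 < ρ) (hC : C ∈ cube n) (y z : Fin n) :
    |1 - smoothMiss ρ C y - if y = z then 1 else 0| ≤ 1 := by
  have hmiss := smoothMiss_mem_Icc hρ hC y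
  have : 0 ≤ ρ / (1 + ρ) := by positivity
  rw [abs_le]
  split_ifs <;> constructor <;> linarith [hmiss.1, hmiss.2]

theorem abs_missGrad_le (hρ : 0 < ρ) (hC : C ∈ cube n) (y z : Fin n) :
    |missGrad ρ C y z| ≤ 1 / ρ := by
  have hσ := inv_rowSum_add_mem_Icc hρ hC y
  rw [missGrad, abs_mul, abs_of_nonneg hσ.1]
  exact (mul_le_mul (abs_one_sub_smoothMiss_sub_ite_le hρ hC y z) hσ.2 hσ.1 zero_le_one).trans_eq
    (one_mul _)

theorem lipschitzL1On_inv_rowSum_add (hρ : 0 < ρ) (y : Fin n) :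
    LipschitzL1On (1 / ρ ^ 2) (fun C => (∑ z, C y z + ρ)⁻¹) (cube n) := by
  refine lipschitzL1On_of_hasGradAt convex_cube (fun C hC =>
    ((hasGradAt_rowSum y C).add_const ρ).inv (hρ.trans_le (le_rowSum_add hC y)).ne') ?_
  intro C hC i z
  have hσ := inv_rowSum_add_mem_Icc hρ hC y
  rw [Matrix.smul_apply, smul_eq_mul, abs_mul, abs_neg, abs_of_nonneg (sq_nonneg _),
    ← one_div_pow]
  exact (mul_le_mul (pow_le_pow_left₀ hσ.1 hσ.2 2)
    (abs_updateRow_zero_le (fun _ => by simp) y i z) (abs_nonneg _) (sq_nonneg _)).trans_eq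
    (mul_one _)

theorem lipschitzL1On_logRecallGrad (hρ : 0 < ρ) (y z : Fin n) :
    LipschitzL1On (1 / ρ ^ 2) (fun C => logRecallGrad ρ C y z) (cube n) := by
  rcases eq_or_ne y z with rfl | hyz
  · simp only [logRecallGrad, if_true]
    refine lipschitzL1On_of_hasGradAt convex_cube (fun C hC =>
      (((hasGradAt_apply y y C).add_const ρ).inv
        (add_pos_of_nonneg_of_pos (hC y y).1 hρ).ne').sub
      (((hasGradAt_rowSum y C).add_const ρ).inv (hρ.trans_le (le_rowSum_add hC y)).ne')) ?_
    intro C hC i j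
    have ha := inv_diag_add_mem_Icc hρ hC y
    have hσ := inv_rowSum_add_mem_Icc hρ hC y
    have ha2 := pow_le_pow_left₀ ha.1 ha.2 2
    have hσ2 := pow_le_pow_left₀ hσ.1 hσ.2 2
    have := sq_nonneg (C y y + ρ)⁻¹
    have := sq_nonneg (∑ z, C y z + ρ)⁻¹
    have : 0 ≤ (1 / ρ) ^ 2 := sq_nonneg _
    rw [← one_div_pow, Matrix.sub_apply, Matrix.smul_apply, Matrix.smul_apply,
      Matrix.updateRow_apply, Matrix.updateRow_apply, Pi.single_apply, abs_le]
    split_ifs <;> constructor <;>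
      simp only [smul_eq_mul, mul_one, mul_zero, Pi.one_apply, Matrix.zero_apply] <;> linarith
  · simp only [logRecallGrad, if_neg hyz, zero_sub]
    simpa using (lipschitzL1On_inv_rowSum_add hρ y).const_mul (-1)

theorem lipschitzL1On_missGrad (hρ : 0 < ρ) (y z : Fin n) :
    LipschitzL1On (2 / ρ ^ 2) (fun C => missGrad ρ C y z) (cube n) := by
  have hmiss : LipschitzL1On (1 / ρ) (fun C => smoothMiss ρ C y) (cube n) :=
    lipschitzL1On_of_hasGradAt convex_cube (fun C hC => hasGradAt_smoothMiss hρ hC y)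
      fun C hC => abs_updateRow_zero_le (abs_missGrad_le hρ hC y) y
  have hfactor : LipschitzL1On (1 / ρ)
      (fun C => 1 - smoothMiss ρ C y - if y = z then 1 else 0) (cube n) := fun M hM N hN => by
    simpa [abs_sub_comm] using hmiss M hM N hN
  refine (hfactor.mul (lipschitzL1On_inv_rowSum_add hρ y)
    (fun C hC => abs_one_sub_smoothMiss_sub_ite_le hρ hC y z) fun C hC =>
      abs_le.2 ⟨?_, (inv_rowSum_add_mem_Icc hρ hC y).2⟩).mono (le_of_eq (by ring))
  have : 0 ≤ 1 / ρ := by positivity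
  linarith [(inv_rowSum_add_mem_Icc hρ hC y).1]

end SmoothRates

/-! ### The smoothed H-mean, Q-mean and G-mean -/

section Metrics

theorem concaveOn_comp_of_map_convexComb {E F : Type*} [AddCommGroup E] [Module ℝ E]
    [AddCommGroup F] [Module ℝ F] {s : Set E} {t : Set F} {g : F → ℝ} {r : E → F}
    (hg : ConcaveOn ℝ t g) (hs : Convex ℝ s) (hst : Set.MapsTo r s t)
    (hr : ∀ x ∈ s, ∀ y ∈ s, ∀ a b : ℝ, a + b = 1 → r (a • x + b • y) = a • r x + b • r y) :
    ConcaveOn ℝ s fun x => g (r x) :=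
  ⟨hs, fun x hx y hy a b ha hb hab => by
    simp only [hr x hx y hy a b hab]
    exact hg.2 (hst hx) (hst hy) ha hb hab⟩

variable {X : Type*} [MeasurableSpace X] {n : ℕ} {ρ : ℝ} {C : Matrix (Fin n) (Fin n) ℝ}
  {D : Measure (X × Fin n)}

theorem smoothRecall_convexComb [IsFiniteMeasure D] {M N : Matrix (Fin n) (Fin n) ℝ}
    (hM : M ∈ feasible D) (hN : N ∈ feasible D) {a b : ℝ} (hab : a + b = 1) :
    smoothRecall ρ (a • M + b • N) = a • smoothRecall ρ M + b • smoothRecall ρ N := by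
  ext y
  obtain rfl : b = 1 - a := by linarith
  simp only [smoothRecall, Pi.add_apply, Pi.smul_apply, Matrix.add_apply, Matrix.smul_apply,
    smul_eq_mul, Finset.sum_add_distrib, ← Finset.mul_sum, rowSum_eq_prior_of_mem_feasible hM,
    rowSum_eq_prior_of_mem_feasible hN]
  ring

theorem smoothMiss_convexComb [IsFiniteMeasure D] {M N : Matrix (Fin n) (Fin n) ℝ}
    (hM : M ∈ feasible D) (hN : N ∈ feasible D) {a b : ℝ} (hab : a + b = 1) :
    smoothMiss ρ (a • M + b • N) = a • smoothMiss ρ M + b • smoothMiss ρ N := by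
  ext y
  obtain rfl : b = 1 - a := by linarith
  simp only [smoothMiss, sum_erase_eq_rowSum_sub, Pi.add_apply, Pi.smul_apply, Matrix.add_apply,
    Matrix.smul_apply, smul_eq_mul, Finset.sum_add_distrib, ← Finset.mul_sum,
    rowSum_eq_prior_of_mem_feasible hM, rowSum_eq_prior_of_mem_feasible hN]
  ring

theorem div_rowSum_le_smoothRecall (hρ : 0 < ρ) (hC : C ∈ cube n) (y : Fin n) :
    C y y / ∑ z, C y z ≤ smoothRecall ρ C y :=
  div_le_add_div_add (hC y y).1 (diag_le_rowSum hC y) hρ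

theorem smoothRecall_sub_div_rowSum_le [NeZero n] [IsProbabilityMeasure D]
    (hprior : ∀ y, 0 < prior D y) (hρ : 0 < ρ) (hC : C ∈ feasible D) (y : Fin n) :
    smoothRecall ρ C y - C y y / ∑ z, C y z ≤ ρ / priorMin D := by
  rw [smoothRecall, rowSum_eq_prior_of_mem_feasible hC]
  exact add_div_add_sub_div_le (feasible_subset_cube D hC y y).1 (priorMin_pos hprior)
    (priorMin_le D y) hρ

theorem abs_one_sub_div_rowSum_sub_smoothMiss_le [NeZero n] [IsProbabilityMeasure D]
    (hprior : ∀ y, 0 < prior D y) (hρ : 0 < ρ) (hC : C ∈ feasible D) (y : Fin n) :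
    |1 - C y y / ∑ z, C y z - smoothMiss ρ C y| ≤ ρ / priorMin D := by
  rw [smoothMiss_eq hρ (feasible_subset_cube D hC), rowSum_eq_prior_of_mem_feasible hC,
    sub_sub_sub_cancel_left]
  exact abs_div_add_sub_div_le (feasible_subset_cube D hC y y).1
    (diag_le_prior_of_mem_feasible hC y) (priorMin_pos hprior) (priorMin_le D y) hρ

/-! ### H-mean -/

theorem hMeanSmooth_eq (ρ : ℝ) (C : Matrix (Fin n) (Fin n) ℝ) :
    hMeanSmooth ρ C = n * parallelSum (smoothRecall ρ C) := by
  simp [hMeanSmooth, parallelSum, smoothRecall]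

theorem hMean_eq {C : Matrix (Fin n) (Fin n) ℝ} (hC : ∀ y, C y y ≠ 0) :
    hMean C = n * parallelSum (fun y => C y y / ∑ z, C y z) := by
  simp [hMean, parallelSum, hC]

theorem concaveOn_hMeanSmooth [IsProbabilityMeasure D] (hρ : 0 < ρ) :
    ConcaveOn ℝ (feasible D) (hMeanSmooth ρ) := by
  simp only [funext (hMeanSmooth_eq (n := n) ρ)]
  exact (concaveOn_comp_of_map_convexComb concaveOn_parallelSum (convex_feasible D)
    (fun _ hC => smoothRecall_pos hρ (feasible_subset_cube D hC))
    fun _ hM _ hN _ _ => smoothRecall_convexComb hM hN).smul (Nat.cast_nonneg n)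

theorem abs_hMean_sub_hMeanSmooth_le [NeZero n] [IsProbabilityMeasure D]
    (hprior : ∀ y, 0 < prior D y) (hρ : 0 < ρ) (hC : C ∈ feasible D) :
    |hMean C - hMeanSmooth ρ C| ≤ n / priorMin D * ρ := by
  have hcube := feasible_subset_cube D hC
  have hpos := smoothRecall_pos hρ hcube
  have hδ : 0 ≤ ρ / priorMin D := div_nonneg hρ.le (priorMin_pos hprior).le
  have hclose := smoothRecall_sub_div_rowSum_le hprior hρ hC
  rw [hMeanSmooth_eq, div_mul_eq_mul_div, mul_div_assoc]
  by_cases hzero : ∃ y, C y y = 0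
  · obtain ⟨y, hy⟩ := hzero
    rw [hMean, if_pos ⟨y, hy⟩, zero_sub, abs_neg, abs_of_nonneg (mul_nonneg (Nat.cast_nonneg n)
      (parallelSum_nonneg fun y => (hpos y).le))]
    gcongr
    exact (parallelSum_le_apply hpos y).trans (by simpa [hy] using hclose y)
  · push Not at hzero
    have hrecall : ∀ y, 0 < C y y / ∑ z, C y z := fun y => by
      rw [rowSum_eq_prior_of_mem_feasible hC]
      exact div_pos ((hcube y y).1.lt_of_ne' (hzero y)) (hprior y)
    have hle : parallelSum (fun y => C y y / ∑ z, C y z) ≤ parallelSum (smoothRecall ρ C) := by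
      simpa using parallelSum_le_add hpos hrecall le_rfl fun y => by
        simpa using div_rowSum_le_smoothRecall hρ hcube y
    have hge := parallelSum_le_add hrecall hpos hδ fun y => by linarith [hclose y]
    rw [hMean_eq hzero, ← mul_sub, abs_mul, Nat.abs_cast]
    gcongr
    exact abs_le.2 ⟨by linarith, by linarith⟩

theorem hasGradAt_parallelSum [NeZero n] {f : Fin n → Matrix (Fin n) (Fin n) ℝ → ℝ}
    {G M : Matrix (Fin n) (Fin n) ℝ} (hf : ∀ i, HasGradAt (f i) (Matrix.updateRow 0 i (G i)) M)
    (hpos : ∀ i, 0 < f i M) :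
    HasGradAt (fun M => parallelSum fun i => f i M)
      (.of fun i j => (parallelSum (fun k => f k M) / f i M) ^ 2 * G i j) M := by
  have hinv : ∀ i, HasGradAt (fun M => (f i M)⁻¹)
      (Matrix.updateRow 0 i ((-((f i M)⁻¹ ^ 2)) • G i)) M := fun i => by
    refine ((hf i).inv (hpos i).ne').congr_grad fun k j => ?_
    rcases eq_or_ne k i with rfl | hk <;> simp [*]
  have hsum : 0 < ∑ i, (f i M)⁻¹ :=
    Finset.sum_pos (fun i _ => inv_pos.2 (hpos i)) Finset.univ_nonempty
  have hgrad := hasGradAt_sum_of_updateRow (G := .of fun i => -((f i M)⁻¹ ^ 2) • G i) hinv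
  refine (hgrad.inv hsum.ne').congr_grad fun i j => ?_
  simp only [parallelSum, Matrix.of_apply, Matrix.smul_apply, smul_eq_mul, Pi.smul_apply]
  ring

/-- The factor of row `i` of the gradient of `hMeanSmooth ρ` relative to `logRecallGrad`. -/
def hMeanWeight (ρ : ℝ) (C : Matrix (Fin n) (Fin n) ℝ) (i : Fin n) : ℝ :=
  n * (parallelSum (smoothRecall ρ C) ^ 2 * (smoothRecall ρ C i)⁻¹)

theorem hasGradAt_parallelSum_smoothRecall [NeZero n] (hρ : 0 < ρ) (hC : C ∈ cube n) :
    HasGradAt (fun C => parallelSum (smoothRecall ρ C))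
      (.of fun i j => parallelSum (smoothRecall ρ C) ^ 2 * (smoothRecall ρ C i)⁻¹ *
        logRecallGrad ρ C i j) C := by
  refine (hasGradAt_parallelSum (G := .of fun i => smoothRecall ρ C i • logRecallGrad ρ C i)
    (hasGradAt_smoothRecall hρ hC) (smoothRecall_pos hρ hC)).congr_grad fun i j => ?_
  have := (smoothRecall_pos hρ hC i).ne'
  simp only [Matrix.of_apply, Pi.smul_apply, smul_eq_mul]
  field_simp

theorem hasGradAt_hMeanSmooth [NeZero n] (hρ : 0 < ρ) (hC : C ∈ cube n) :
    HasGradAt (hMeanSmooth ρ) (.of fun i j => hMeanWeight ρ C i * logRecallGrad ρ C i j) C := by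
  rw [funext (hMeanSmooth_eq (n := n) ρ)]
  refine ((hasGradAt_parallelSum_smoothRecall hρ hC).const_mul n).congr_grad fun i j => ?_
  simp only [hMeanWeight, Matrix.of_apply, Matrix.smul_apply, smul_eq_mul, mul_assoc]

theorem hMeanWeight_nonneg (hρ : 0 < ρ) (hC : C ∈ cube n) (i : Fin n) :
    0 ≤ hMeanWeight ρ C i :=
  mul_nonneg (Nat.cast_nonneg n)
    (mul_nonneg (sq_nonneg _) (inv_nonneg.2 (smoothRecall_pos hρ hC i).le))

theorem hMeanWeight_le (hρ : 0 < ρ) (hC : C ∈ cube n) (i : Fin n) :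
    hMeanWeight ρ C i ≤ parallelSum (smoothRecall ρ C) / smoothRecall ρ C i := by
  have hpos := smoothRecall_pos hρ hC
  calc hMeanWeight ρ C i = n * parallelSum (smoothRecall ρ C) *
        (parallelSum (smoothRecall ρ C) / smoothRecall ρ C i) := by rw [hMeanWeight]; ring
    _ ≤ _ := mul_le_of_le_one_left (parallelSum_div_nonneg hpos i) (by
        simpa using card_mul_parallelSum_le hpos zero_le_one (smoothRecall_le_one hρ hC))

theorem hMeanWeight_le_one (hρ : 0 < ρ) (hC : C ∈ cube n) (i : Fin n) : hMeanWeight ρ C i ≤ 1 :=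
  have hpos := smoothRecall_pos hρ hC
  (hMeanWeight_le hρ hC i).trans ((div_le_one (hpos i)).2 (parallelSum_le_apply hpos i))

theorem hasGradAt_hMeanWeight [NeZero n] (hρ : 0 < ρ) (hC : C ∈ cube n) (i : Fin n) :
    HasGradAt (fun C => hMeanWeight ρ C i)
      (.of fun j z => hMeanWeight ρ C i *
        (2 * (parallelSum (smoothRecall ρ C) / smoothRecall ρ C j) - if i = j then 1 else 0) *
          logRecallGrad ρ C j z) C := by
  have hP := hasGradAt_parallelSum_smoothRecall hρ hC
  simp only [hMeanWeight, sq]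
  refine (((hP.mul hP).mul ((hasGradAt_smoothRecall hρ hC i).inv
    (smoothRecall_pos hρ hC i).ne')).const_mul n).congr_grad fun j z => ?_
  have := (smoothRecall_pos hρ hC i).ne'
  have := (smoothRecall_pos hρ hC j).ne'
  rcases eq_or_ne i j with rfl | hij
  · simp only [if_true, Matrix.of_apply, Matrix.smul_apply, Matrix.add_apply, smul_eq_mul,
      Matrix.updateRow_self, Pi.smul_apply]
    field_simp
    ring
  · simp only [if_neg hij, Matrix.of_apply, Matrix.smul_apply, Matrix.add_apply, smul_eq_mul,
      Matrix.updateRow_ne hij.symm, Matrix.zero_apply]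
    field_simp
    ring

theorem parallelSum_div_mul_abs_le_one {ι : Type*} [Fintype ι] [DecidableEq ι] {x : ι → ℝ}
    (hx : ∀ i, 0 < x i) (i j : ι) :
    parallelSum x / x i * |2 * (parallelSum x / x j) - if i = j then 1 else 0| ≤ 1 := by
  have hnonneg := parallelSum_div_nonneg hx
  rcases eq_or_ne i j with rfl | hij
  · have hle : parallelSum x / x i ≤ 1 := (div_le_one (hx i)).2 (parallelSum_le_apply hx i)
    rw [if_pos rfl]
    exact mul_le_one₀ hle (abs_nonneg _) (abs_le.2 ⟨by linarith [hnonneg i], by linarith⟩)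
  · have hadd : parallelSum x / x i + parallelSum x / x j ≤ 1 :=
      (Finset.add_le_sum (fun k _ => hnonneg k) (Finset.mem_univ i) (Finset.mem_univ j) hij).trans
        (sum_parallelSum_div_le_one x)
    rw [if_neg hij, sub_zero, abs_of_nonneg (mul_nonneg zero_le_two (hnonneg j))]
    nlinarith [hnonneg i, hnonneg j]

theorem lipschitzL1On_hMeanWeight [NeZero n] (hρ : 0 < ρ) (i : Fin n) :
    LipschitzL1On (1 / ρ) (fun C => hMeanWeight ρ C i) (cube n) := by
  refine lipschitzL1On_of_hasGradAt convex_cube (fun C hC => hasGradAt_hMeanWeight hρ hC i) ?_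
  intro C hC j z
  have hpos := smoothRecall_pos hρ hC
  have hτ := parallelSum_div_mul_abs_le_one hpos i j
  rw [Matrix.of_apply, abs_mul, abs_mul, abs_of_nonneg (hMeanWeight_nonneg hρ hC i)]
  refine (mul_le_mul (le_trans ?_ hτ) (abs_logRecallGrad_le hρ hC j z) (abs_nonneg _)
    zero_le_one).trans_eq (one_mul _)
  gcongr
  exact hMeanWeight_le hρ hC i

theorem lipschitzL1On_hMeanSmooth [NeZero n] (hρ : 0 < ρ) :
    LipschitzL1On (n / ρ) (hMeanSmooth ρ) (cube n) := by
  refine (lipschitzL1On_of_hasGradAt (K := 1 / ρ) convex_cube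
    (fun C hC => hasGradAt_hMeanSmooth hρ hC) fun C hC i j => ?_).mono ?_
  · rw [Matrix.of_apply, abs_mul, abs_of_nonneg (hMeanWeight_nonneg hρ hC i)]
    exact (mul_le_of_le_one_left (abs_nonneg _) (hMeanWeight_le_one hρ hC i)).trans
      (abs_logRecallGrad_le hρ hC i j)
  · gcongr
    exact_mod_cast NeZero.one_le (n := n)

theorem smoothL1On_hMeanSmooth [NeZero n] (hρ : 0 < ρ) :
    SmoothL1On (2 * n / ρ ^ 2) (hMeanSmooth ρ) (cube n) := by
  refine smoothL1On_of_hasGradAt (fun C hC => hasGradAt_hMeanSmooth hρ hC) fun i j =>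
    ((lipschitzL1On_hMeanWeight hρ i).mul (A := 1) (lipschitzL1On_logRecallGrad hρ i j)
      (fun C hC => ?_) fun C hC => abs_logRecallGrad_le hρ hC i j).mono ?_
  · rw [abs_of_nonneg (hMeanWeight_nonneg hρ hC i)]
    exact hMeanWeight_le_one hρ hC i
  · have hn : (1 : ℝ) ≤ n := by exact_mod_cast NeZero.one_le (n := n)
    calc 1 * (1 / ρ ^ 2) + 1 / ρ * (1 / ρ) = 2 * 1 / ρ ^ 2 := by ring
      _ ≤ 2 * n / ρ ^ 2 := by gcongr

theorem isSmoothing_hMean [NeZero n] (D : Measure (X × Fin n)) [IsProbabilityMeasure D]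
    (hprior : ∀ y, 0 < prior D y) :
    IsSmoothing D hMean hMeanSmooth (fun ρ => n / priorMin D * ρ) (fun ρ => n / ρ)
      (fun ρ => 2 * n / ρ ^ 2) := fun _ hρ =>
  ⟨concaveOn_hMeanSmooth hρ.1, lipschitzL1On_hMeanSmooth hρ.1, smoothL1On_hMeanSmooth hρ.1,
    fun _ hC => abs_hMean_sub_hMeanSmooth_le hprior hρ.1 hC⟩

end Metrics

/-! ### Q-mean -/

section QMean

variable {X : Type*} [MeasurableSpace X] {n : ℕ} {ρ : ℝ} {C : Matrix (Fin n) (Fin n) ℝ}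
  {D : Measure (X × Fin n)}

theorem qMean_eq (C : Matrix (Fin n) (Fin n) ℝ) :
    qMean C = 1 - quadMean fun y => 1 - C y y / ∑ z, C y z := by
  rw [qMean, quadMean, Fintype.card_fin]

theorem qMeanSmooth_eq (ρ : ℝ) (C : Matrix (Fin n) (Fin n) ℝ) :
    qMeanSmooth ρ C = 1 - quadMean (smoothMiss ρ C) := by
  rw [qMeanSmooth, quadMean, Fintype.card_fin]
  rfl

theorem concaveOn_qMeanSmooth [IsFiniteMeasure D] :
    ConcaveOn ℝ (feasible D) (qMeanSmooth ρ) := by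
  rw [funext (qMeanSmooth_eq (n := n) ρ)]
  refine concaveOn_comp_of_map_convexComb (g := fun x => 1 - quadMean x)
    ((concaveOn_const 1 convex_univ).sub convexOn_quadMean) (convex_feasible D)
    (Set.mapsTo_univ _ _) fun _ hM _ hN _ _ => smoothMiss_convexComb hM hN

theorem abs_qMean_sub_qMeanSmooth_le [NeZero n] [IsProbabilityMeasure D]
    (hprior : ∀ y, 0 < prior D y) (hρ : 0 < ρ) (hC : C ∈ feasible D) :
    |qMean C - qMeanSmooth ρ C| ≤ 1 / priorMin D * ρ := by
  rw [qMean_eq, qMeanSmooth_eq, sub_sub_sub_cancel_left, abs_sub_comm, one_div_mul_eq_div]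
  exact abs_quadMean_sub_le (div_nonneg hρ.le (priorMin_pos hprior).le)
    (abs_one_sub_div_rowSum_sub_smoothMiss_le hprior hρ hC)

theorem hasGradAt_quadMean {f : Fin n → Matrix (Fin n) (Fin n) ℝ → ℝ}
    {G M : Matrix (Fin n) (Fin n) ℝ} (hf : ∀ i, HasGradAt (f i) (Matrix.updateRow 0 i (G i)) M)
    (hne : quadMean (fun i => f i M) ≠ 0) :
    HasGradAt (fun M => quadMean fun i => f i M)
      (.of fun i j => f i M / (n * quadMean fun k => f k M) * G i j) M := by
  have hsq : ∀ i, HasGradAt (fun M => f i M ^ 2) (Matrix.updateRow 0 i ((2 * f i M) • G i)) M :=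
    fun i => (HasGradAt.comp (hasDerivAt_pow 2 (f i M)) (hf i)).congr_grad fun k j => by
      rcases eq_or_ne k i with rfl | hk <;> simp [*]
  have hgrad := (hasGradAt_sum_of_updateRow (G := .of fun i => (2 * f i M) • G i) hsq).const_mul
    (1 / (n : ℝ))
  have hsqrt : HasDerivAt Real.sqrt (1 / (2 * quadMean fun i => f i M))
      (1 / (n : ℝ) * ∑ i, f i M ^ 2) := by
    have := Real.hasDerivAt_sqrt (Real.sqrt_ne_zero'.1 hne).ne'
    simpa only [quadMean, Fintype.card_fin] using this
  have hfun : (fun M => quadMean fun i => f i M) = fun M => √(1 / (n : ℝ) * ∑ i, f i M ^ 2) := by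
    simp only [quadMean, Fintype.card_fin]
  rw [hfun]
  refine (HasGradAt.comp hsqrt hgrad).congr_grad fun i j => ?_
  simp only [Matrix.of_apply, Matrix.smul_apply, Pi.smul_apply, smul_eq_mul]
  field_simp

/-- The factor of row `i` of the gradient of `qMeanSmooth ρ` relative to `-missGrad`. -/
def qMeanWeight (ρ : ℝ) (C : Matrix (Fin n) (Fin n) ℝ) (i : Fin n) : ℝ :=
  smoothMiss ρ C i / (n * quadMean (smoothMiss ρ C))

theorem le_quadMean_smoothMiss [NeZero n] (hρ : 0 < ρ) (hC : C ∈ cube n) :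
    ρ / (1 + ρ) ≤ quadMean (smoothMiss ρ C) :=
  le_quadMean (by positivity) fun y => (smoothMiss_mem_Icc hρ hC y).1

theorem hasGradAt_quadMean_smoothMiss [NeZero n] (hρ : 0 < ρ) (hC : C ∈ cube n) :
    HasGradAt (fun C => quadMean (smoothMiss ρ C))
      (.of fun i j => qMeanWeight ρ C i * missGrad ρ C i j) C :=
  hasGradAt_quadMean (hasGradAt_smoothMiss hρ hC)
    ((by positivity : 0 < ρ / (1 + ρ)).trans_le (le_quadMean_smoothMiss hρ hC)).ne'

theorem hasGradAt_qMeanSmooth [NeZero n] (hρ : 0 < ρ) (hC : C ∈ cube n) :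
    HasGradAt (qMeanSmooth ρ) (.of fun i j => -(qMeanWeight ρ C i * missGrad ρ C i j)) C := by
  rw [funext (qMeanSmooth_eq (n := n) ρ)]
  exact (HasGradAt.comp (φ := fun x => 1 - x) ((hasDerivAt_id _).const_sub 1)
    (hasGradAt_quadMean_smoothMiss hρ hC)).congr_grad fun i j => by simp

theorem sqrt_mul_abs_qMeanWeight_le_one (ρ : ℝ) (C : Matrix (Fin n) (Fin n) ℝ) (i : Fin n) :
    √n * |qMeanWeight ρ C i| ≤ 1 := by
  have hq : 0 ≤ quadMean (smoothMiss ρ C) := Real.sqrt_nonneg _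
  have hle : |smoothMiss ρ C i| ≤ √n * quadMean (smoothMiss ρ C) := by
    simpa using abs_apply_le_sqrt_card_mul_quadMean (smoothMiss ρ C) i
  rw [qMeanWeight, abs_div, abs_of_nonneg (mul_nonneg (Nat.cast_nonneg n) hq), ← mul_div_assoc]
  refine div_le_one_of_le₀ ?_ (by positivity)
  calc √n * |smoothMiss ρ C i| ≤ √n * (√n * quadMean (smoothMiss ρ C)) := by gcongr
    _ = n * quadMean (smoothMiss ρ C) := by
        rw [← mul_assoc, Real.mul_self_sqrt (Nat.cast_nonneg n)]

theorem abs_qMeanWeight_le (ρ : ℝ) (C : Matrix (Fin n) (Fin n) ℝ) (i : Fin n) :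
    |qMeanWeight ρ C i| ≤ 1 / √n := by
  have hn : (0 : ℝ) < √n := Real.sqrt_pos.2 (by exact_mod_cast i.pos)
  exact (le_div_iff₀' hn).2 (sqrt_mul_abs_qMeanWeight_le_one ρ C i)

theorem hasGradAt_qMeanWeight [NeZero n] (hρ : 0 < ρ) (hC : C ∈ cube n) (i : Fin n) :
    HasGradAt (fun C => qMeanWeight ρ C i)
      (.of fun j z => (n * quadMean (smoothMiss ρ C))⁻¹ *
        ((if i = j then 1 else 0) - n * (qMeanWeight ρ C i * qMeanWeight ρ C j)) *
          missGrad ρ C j z) C := by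
  have hq : quadMean (smoothMiss ρ C) ≠ 0 :=
    ((by positivity : 0 < ρ / (1 + ρ)).trans_le (le_quadMean_smoothMiss hρ hC)).ne'
  have hn : (n : ℝ) ≠ 0 := NeZero.ne _
  have hnq : n * quadMean (smoothMiss ρ C) ≠ 0 := mul_ne_zero hn hq
  simp only [qMeanWeight, div_eq_mul_inv]
  refine ((hasGradAt_smoothMiss hρ hC i).mul
    (((hasGradAt_quadMean_smoothMiss hρ hC).const_mul n).inv hnq)).congr_grad fun j z => ?_
  rcases eq_or_ne i j with rfl | hij
  · simp only [if_true, qMeanWeight, Matrix.of_apply, Matrix.smul_apply, Matrix.add_apply,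
      smul_eq_mul, Matrix.updateRow_self]
    field_simp
    ring
  · simp only [if_neg hij, qMeanWeight, Matrix.of_apply, Matrix.smul_apply, Matrix.add_apply,
      smul_eq_mul, Matrix.updateRow_ne hij.symm, Matrix.zero_apply]
    field_simp
    ring

theorem abs_ite_sub_mul_qMeanWeight_le_one (ρ : ℝ) (C : Matrix (Fin n) (Fin n) ℝ) (i j : Fin n) :
    |(if i = j then 1 else 0) - n * (qMeanWeight ρ C i * qMeanWeight ρ C j)| ≤ 1 := by
  have habs : |n * (qMeanWeight ρ C i * qMeanWeight ρ C j)| ≤ 1 :=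
    calc |n * (qMeanWeight ρ C i * qMeanWeight ρ C j)|
        = √n * |qMeanWeight ρ C i| * (√n * |qMeanWeight ρ C j|) := by
          rw [mul_mul_mul_comm, Real.mul_self_sqrt (Nat.cast_nonneg n), abs_mul, abs_mul,
            Nat.abs_cast]
      _ ≤ 1 := mul_le_one₀ (sqrt_mul_abs_qMeanWeight_le_one ρ C i) (by positivity)
          (sqrt_mul_abs_qMeanWeight_le_one ρ C j)
  rcases eq_or_ne i j with rfl | hij
  · have := mul_nonneg (Nat.cast_nonneg (α := ℝ) n) (mul_self_nonneg (qMeanWeight ρ C i))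
    rw [if_pos rfl]
    exact abs_le.2 ⟨by linarith [(abs_le.1 habs).2], by linarith⟩
  · rwa [if_neg hij, zero_sub, abs_neg]

theorem lipschitzL1On_qMeanWeight [NeZero n] (hρ : ρ ∈ Set.Ioo (0 : ℝ) 1) (i : Fin n) :
    LipschitzL1On (2 / (√n * ρ ^ 2)) (fun C => qMeanWeight ρ C i) (cube n) := by
  refine lipschitzL1On_of_hasGradAt convex_cube (fun C hC => hasGradAt_qMeanWeight hρ.1 hC i) ?_
  intro C hC j z
  have hρ0 := hρ.1
  have hn : (0 : ℝ) < n := Nat.cast_pos.2 i.pos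
  have hinv : (n * quadMean (smoothMiss ρ C))⁻¹ ≤ 2 / (√n * ρ) := by
    have hsqrt : √(n : ℝ) ≤ n := Real.sqrt_le_self_iff.2 (.inr (by exact_mod_cast NeZero.one_le))
    have hq : ρ / 2 ≤ quadMean (smoothMiss ρ C) := le_trans
      (by gcongr; linarith [hρ.2]) (le_quadMean_smoothMiss hρ.1 hC)
    calc (n * quadMean (smoothMiss ρ C))⁻¹ ≤ (√n * (ρ / 2))⁻¹ := by gcongr
      _ = 2 / (√n * ρ) := by field_simp
  have hq : 0 ≤ quadMean (smoothMiss ρ C) := Real.sqrt_nonneg _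
  rw [Matrix.of_apply, abs_mul, abs_mul, abs_of_nonneg (by positivity)]
  calc _ ≤ 2 / (√n * ρ) * 1 * (1 / ρ) := by
        gcongr
        · exact abs_ite_sub_mul_qMeanWeight_le_one ρ C i j
        · exact abs_missGrad_le hρ.1 hC j z
    _ = 2 / (√n * ρ ^ 2) := by field_simp

theorem lipschitzL1On_qMeanSmooth [NeZero n] (hρ : 0 < ρ) :
    LipschitzL1On (1 / √n * (1 / ρ)) (qMeanSmooth ρ) (cube n) := by
  refine lipschitzL1On_of_hasGradAt convex_cube (fun C hC => hasGradAt_qMeanSmooth hρ hC) ?_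
  intro C hC i j
  rw [Matrix.of_apply, abs_neg, abs_mul]
  gcongr
  exacts [abs_qMeanWeight_le ρ C i, abs_missGrad_le hρ hC i j]

theorem smoothL1On_qMeanSmooth [NeZero n] (hρ : ρ ∈ Set.Ioo (0 : ℝ) 1) :
    SmoothL1On (2 / √n * (1 / ρ ^ 2) * (1 + 1 / ρ)) (qMeanSmooth ρ) (cube n) := by
  refine smoothL1On_of_hasGradAt (fun C hC => hasGradAt_qMeanSmooth hρ.1 hC) fun i j => ?_
  have hmul := (lipschitzL1On_qMeanWeight hρ i).mul (lipschitzL1On_missGrad hρ.1 i j)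
    (fun C _ => abs_qMeanWeight_le ρ C i) fun C hC => abs_missGrad_le hρ.1 hC i j
  have hneg := hmul.const_mul (-1)
  simp only [neg_one_mul, abs_neg, abs_one, one_mul] at hneg
  exact hneg.mono (le_of_eq (by have := hρ.1.ne'; field_simp))

theorem isSmoothing_qMean [NeZero n] (D : Measure (X × Fin n)) [IsProbabilityMeasure D]
    (hprior : ∀ y, 0 < prior D y) :
    IsSmoothing D qMean qMeanSmooth (fun ρ => 1 / priorMin D * ρ)
      (fun ρ => 1 / √(n : ℝ) * (1 / ρ))
      (fun ρ => 2 / √(n : ℝ) * (1 / ρ ^ 2) * (1 + 1 / ρ)) := fun _ hρ =>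
  ⟨concaveOn_qMeanSmooth, lipschitzL1On_qMeanSmooth hρ.1, smoothL1On_qMeanSmooth hρ,
    fun _ hC => abs_qMean_sub_qMeanSmooth_le hprior hρ.1 hC⟩

end QMean

/-! ### G-mean -/

section GMean

variable {X : Type*} [MeasurableSpace X] {n : ℕ} {ρ : ℝ} {C : Matrix (Fin n) (Fin n) ℝ}
  {D : Measure (X × Fin n)}

theorem concaveOn_gMeanSmooth [IsProbabilityMeasure D] (hρ : 0 < ρ) :
    ConcaveOn ℝ (feasible D) (gMeanSmooth ρ) := by
  have hconc := concaveOn_prod_rpow_inv_card (ι := Fin n)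
  rw [Fintype.card_fin] at hconc
  refine concaveOn_comp_of_map_convexComb (r := smoothRecall ρ) hconc (convex_feasible D)
    (fun _ hC => smoothRecall_pos hρ (feasible_subset_cube D hC))
    fun _ hM _ hN _ _ => smoothRecall_convexComb hM hN

theorem abs_gMean_sub_gMeanSmooth_le [NeZero n] [IsProbabilityMeasure D]
    (hprior : ∀ y, 0 < prior D y) (hρ : 0 < ρ) (hC : C ∈ feasible D) :
    |gMean C - gMeanSmooth ρ C| ≤ 2 * (ρ / priorMin D) ^ (1 / (n : ℝ)) := by
  have hcube := feasible_subset_cube D hC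
  have hratio : ∀ y, C y y / ∑ z, C y z ∈ Set.Icc (0 : ℝ) 1 := fun y =>
    ⟨div_nonneg (hcube y y).1 ((hcube y y).1.trans (diag_le_rowSum hcube y)),
      div_le_one_of_le₀ (diag_le_rowSum hcube y)
        ((hcube y y).1.trans (diag_le_rowSum hcube y))⟩
  have h := abs_prod_rpow_inv_card_sub_le hratio
    (fun y => ⟨(smoothRecall_pos hρ hcube y).le, smoothRecall_le_one hρ hcube y⟩)
    (div_nonneg hρ.le (priorMin_pos hprior).le) fun y => by
      rw [abs_sub_comm, abs_of_nonneg (sub_nonneg.2 (div_rowSum_le_smoothRecall hρ hcube y))]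
      exact smoothRecall_sub_div_rowSum_le hprior hρ hC y
  rwa [Fintype.card_fin] at h

theorem gMeanSmooth_mem_Icc (hρ : 0 < ρ) (hC : C ∈ cube n) :
    gMeanSmooth ρ C ∈ Set.Icc (0 : ℝ) 1 := by
  have hpos := fun y => (smoothRecall_pos hρ hC y).le
  have hprod : 0 ≤ ∏ y, smoothRecall ρ C y := Finset.prod_nonneg fun y _ => hpos y
  exact ⟨Real.rpow_nonneg hprod _, Real.rpow_le_one hprod (Finset.prod_le_one (fun y _ => hpos y)
    fun y _ => smoothRecall_le_one hρ hC y) (by positivity)⟩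

theorem hasGradAt_gMeanSmooth (hρ : 0 < ρ) (hC : C ∈ cube n) :
    HasGradAt (gMeanSmooth ρ)
      (.of fun i j => 1 / (n : ℝ) * (gMeanSmooth ρ C * logRecallGrad ρ C i j)) C := by
  have hprod : 0 < ∏ y, smoothRecall ρ C y :=
    Finset.prod_pos fun y _ => smoothRecall_pos hρ hC y
  refine (HasGradAt.comp (Real.hasDerivAt_rpow_const (p := 1 / (n : ℝ)) (.inl hprod.ne'))
    (hasGradAt_prod_of_updateRow (hasGradAt_smoothRecall hρ hC))).congr_grad fun i j => ?_
  have hpow : gMeanSmooth ρ C =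
      (∏ y, smoothRecall ρ C y) ^ (1 / (n : ℝ) - 1) * ∏ y, smoothRecall ρ C y := by
    rw [Real.rpow_sub_one hprod.ne', div_mul_cancel₀ _ hprod.ne']
    rfl
  simp only [hpow, Matrix.smul_apply, Matrix.of_apply, smul_eq_mul]
  ring

theorem lipschitzL1On_gMeanSmooth (hρ : 0 < ρ) :
    LipschitzL1On (1 / (n : ℝ) * (1 / ρ)) (gMeanSmooth ρ) (cube n) := by
  refine lipschitzL1On_of_hasGradAt convex_cube (fun C hC => hasGradAt_gMeanSmooth hρ hC) ?_
  intro C hC i j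
  have hψ := gMeanSmooth_mem_Icc hρ hC
  rw [Matrix.of_apply, abs_mul, abs_mul, abs_of_nonneg hψ.1, abs_of_nonneg (by positivity)]
  gcongr
  exact (mul_le_of_le_one_left (abs_nonneg _) hψ.2).trans (abs_logRecallGrad_le hρ hC i j)

theorem smoothL1On_gMeanSmooth (hρ : 0 < ρ) :
    SmoothL1On (2 / (n * ρ ^ 2)) (gMeanSmooth ρ) (cube n) := by
  refine smoothL1On_of_hasGradAt (fun C hC => hasGradAt_gMeanSmooth hρ hC) fun i j => ?_
  have hmul := (lipschitzL1On_gMeanSmooth hρ).mul (A := 1) (lipschitzL1On_logRecallGrad hρ i j)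
    (fun C hC => (abs_of_nonneg (gMeanSmooth_mem_Icc hρ hC).1).trans_le
      (gMeanSmooth_mem_Icc hρ hC).2)
    fun C hC => abs_logRecallGrad_le hρ hC i j
  have hn : 1 / (n : ℝ) ≤ 1 := by rw [one_div]; exact Nat.cast_inv_le_one n
  refine (hmul.const_mul (1 / (n : ℝ))).mono ?_
  rw [abs_of_nonneg (by positivity)]
  calc 1 / (n : ℝ) * (1 * (1 / ρ ^ 2) + 1 / (n : ℝ) * (1 / ρ) * (1 / ρ))
      ≤ 1 / (n : ℝ) * (1 * (1 / ρ ^ 2) + 1 * (1 / ρ) * (1 / ρ)) := by gcongr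
    _ = 2 / (n * ρ ^ 2) := by ring

theorem isSmoothing_gMean [NeZero n] (D : Measure (X × Fin n)) [IsProbabilityMeasure D]
    (hprior : ∀ y, 0 < prior D y) :
    IsSmoothing D gMean gMeanSmooth (fun ρ => 2 * (ρ / priorMin D) ^ (1 / (n : ℝ)))
      (fun ρ => 1 / (n : ℝ) * (1 / ρ) * (1 + 1 / ρ) ^ (1 - 1 / (n : ℝ)))
      (fun ρ => 2 / (n * ρ ^ 2)) := fun ρ hρ => by
  have hρ0 := hρ.1
  have hn : 1 / (n : ℝ) ≤ 1 := by rw [one_div]; exact Nat.cast_inv_le_one n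
  refine ⟨concaveOn_gMeanSmooth hρ.1, (lipschitzL1On_gMeanSmooth hρ.1).mono ?_,
    smoothL1On_gMeanSmooth hρ.1, fun _ hC => abs_gMean_sub_gMeanSmooth_le hprior hρ.1 hC⟩
  exact le_mul_of_one_le_right (by positivity)
    (Real.one_le_rpow (le_add_of_nonneg_right (by positivity)) (sub_nonneg.2 hn))

end GMean

/-! ### Plug-in classifiers -/

section PlugIn

variable {n : ℕ}

theorem exists_isLastArgmax [NeZero n] (v : Fin n → ℝ) : ∃ i, IsLastArgmax v i := by
  obtain ⟨k, hk⟩ := Finite.exists_max v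
  obtain ⟨i, hi, hlast⟩ :=
    (Set.toFinite {i | v i = v k}).exists_maximalFor id _ ⟨k, rfl⟩
  refine ⟨i, fun y => (hk y).trans_eq hi.symm, fun y hy => ?_⟩
  refine ((hk y).lt_of_ne fun h => ?_).trans_eq hi.symm
  exact (hlast h hy.le).not_gt hy

theorem IsLastArgmax.eq {v : Fin n → ℝ} {i k : Fin n} (hi : IsLastArgmax v i)
    (hk : IsLastArgmax v k) : i = k := by
  rcases lt_trichotomy i k with h | h | h
  · exact absurd (hi.2 k h) (hk.1 i).not_gt
  · exact h
  · exact absurd (hk.2 i h) (hi.1 k).not_gt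

theorem plugIn_eq_single {X : Type*} {G : Matrix (Fin n) (Fin n) ℝ} {η : X → Fin n → ℝ} {x : X}
    {i : Fin n} (hi : IsLastArgmax (fun y => ∑ k, G k y * η x k) i) :
    plugIn G η x = Pi.single i 1 := by
  classical
  funext j
  rw [Pi.single_apply]
  exact if_congr ⟨fun hj => hj.eq hi, fun h => h ▸ hi⟩ rfl rfl

theorem measurableSet_isLastArgmax {X : Type*} [MeasurableSpace X] {v : X → Fin n → ℝ}
    (hv : Measurable v) (i : Fin n) : MeasurableSet {x | IsLastArgmax (v x) i} := by
  have hv' := fun y => (measurable_pi_apply y).comp hv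
  simp only [IsLastArgmax, Set.ofPred_and, Set.ofPred_forall]
  exact (MeasurableSet.iInter fun y => measurableSet_le (hv' y) (hv' i)).inter
    (MeasurableSet.iInter fun y => MeasurableSet.iInter fun _ => measurableSet_lt (hv' y) (hv' i))

theorem measurable_plugIn {X : Type*} [MeasurableSpace X] (G : Matrix (Fin n) (Fin n) ℝ)
    {η : X → Fin n → ℝ} (hη : Measurable η) : Measurable (plugIn G η) :=
  measurable_pi_iff.2 fun i => Measurable.ite
    (measurableSet_isLastArgmax (measurable_pi_iff.2 fun _ => Finset.measurable_sum _ fun k _ =>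
      ((measurable_pi_apply k).comp hη).const_mul _) i) measurable_const measurable_const

theorem plugIn_mem_stdSimplex [NeZero n] {X : Type*} (G : Matrix (Fin n) (Fin n) ℝ)
    (η : X → Fin n → ℝ) (x : X) : plugIn G η x ∈ stdSimplex ℝ (Fin n) := by
  obtain ⟨i, hi⟩ := exists_isLastArgmax fun y => ∑ k, G k y * η x k
  rw [plugIn_eq_single hi]
  exact single_mem_stdSimplex ℝ i

theorem isClassifier_plugIn [NeZero n] {X : Type*} [MeasurableSpace X]
    (G : Matrix (Fin n) (Fin n) ℝ) {η : X → Fin n → ℝ} (hη : Measurable η) :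
    IsClassifier (plugIn G η) := ⟨measurable_plugIn G hη, plugIn_mem_stdSimplex G η⟩

/-- The expected gain `G i j` when the true label `i` is drawn from `w` and the predicted label
`j` from `p`. It is used with signed weights `w` as well. -/
def gain (G : Matrix (Fin n) (Fin n) ℝ) (w p : Fin n → ℝ) : ℝ := ∑ j, p j * ∑ i, G i j * w i

theorem gain_sub (G : Matrix (Fin n) (Fin n) ℝ) (v w p : Fin n → ℝ) :
    gain G (v - w) p = gain G v p - gain G w p := by
  simp only [gain, Pi.sub_apply, mul_sub, Finset.sum_sub_distrib]

theorem gain_eq_sum_sum (G : Matrix (Fin n) (Fin n) ℝ) (w p : Fin n → ℝ) :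
    gain G w p = ∑ j, ∑ i, G i j * (p j * w i) := by
  simp only [gain, Finset.mul_sum]
  exact Finset.sum_congr rfl fun j _ => Finset.sum_congr rfl fun i _ => mul_left_comm _ _ _

theorem abs_gain_le {p : Fin n → ℝ} (hp : p ∈ stdSimplex ℝ (Fin n))
    {G : Matrix (Fin n) (Fin n) ℝ} {B : ℝ} (hG : ∀ i j, |G i j| ≤ B) (w : Fin n → ℝ) :
    |gain G w p| ≤ B * ∑ i, |w i| := by
  have hcolumn : ∀ j, |∑ i, G i j * w i| ≤ B * ∑ i, |w i| := fun j => by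
    rw [Finset.mul_sum]
    refine (Finset.abs_sum_le_sum_abs _ _).trans (Finset.sum_le_sum fun i _ => ?_)
    rw [abs_mul]
    exact mul_le_mul_of_nonneg_right (hG i j) (abs_nonneg _)
  calc |gain G w p| ≤ ∑ j, p j * (B * ∑ i, |w i|) := by
        refine (Finset.abs_sum_le_sum_abs _ _).trans (Finset.sum_le_sum fun j _ => ?_)
        rw [abs_mul, abs_of_nonneg (hp.1 j)]
        exact mul_le_mul_of_nonneg_left (hcolumn j) (hp.1 j)
    _ = B * ∑ i, |w i| := by rw [← Finset.sum_mul, hp.2, one_mul]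

theorem gain_le_gain_plugIn [NeZero n] {X : Type*} (G : Matrix (Fin n) (Fin n) ℝ)
    (η : X → Fin n → ℝ) (x : X) {p : Fin n → ℝ} (hp : p ∈ stdSimplex ℝ (Fin n)) :
    gain G (η x) p ≤ gain G (η x) (plugIn G η x) := by
  obtain ⟨k, hk⟩ := exists_isLastArgmax fun y => ∑ i, G i y * η x i
  calc gain G (η x) p ≤ ∑ j, p j * ∑ i, G i k * η x i :=
        Finset.sum_le_sum fun j _ => mul_le_mul_of_nonneg_left (hk.1 j) (hp.1 j)
    _ = ∑ i, G i k * η x i := by rw [← Finset.sum_mul, hp.2, one_mul]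
    _ = gain G (η x) (plugIn G η x) := by
        rw [plugIn_eq_single hk]
        simp [gain, Pi.single_apply]

section CondProb

variable {X : Type*} [MeasurableSpace X] {h η : X → Fin n → ℝ}

theorem IsClassifier.integrable_mul {u : X → Fin n → ℝ} (hh : IsClassifier h)
    (hu : IsClassifier u) (μ : Measure X) [IsFiniteMeasure μ] (i j : Fin n) :
    Integrable (fun x => h x j * u x i) μ :=
  .of_mem_Icc 0 1 ((hh.measurable_apply j).mul (hu.measurable_apply i)).aemeasurable
    (.of_forall fun x => ⟨mul_nonneg (hh.nonneg x j) (hu.nonneg x i),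
      mul_le_one₀ (hh.le_one x j) (hu.nonneg x i) (hu.le_one x i)⟩)

variable [NeZero n] (D : Measure (X × Fin n)) [IsFiniteMeasure D]

theorem isClassifier_condProb : IsClassifier (condProb D) := by
  refine ⟨measurable_pi_iff.2 fun y =>
    (D.condKernel.measurable_coe (measurableSet_singleton y)).ennreal_toReal, fun x =>
    ⟨fun y => measureReal_nonneg, ?_⟩⟩
  simp [condProb, sum_measureReal_singleton]

theorem conf_eq_integral_condProb (hh : IsClassifier h) (i j : Fin n) :
    conf D h i j = ∫ x, h x j * condProb D x i ∂D.fst := by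
  rw [conf, ← Measure.integral_condKernel (hh.integrable_confIntegrand D i j)]
  refine integral_congr_ae (.of_forall fun x => ?_)
  simp only [integral_const_mul]
  rw [condProb, ← integral_indicator_one (measurableSet_singleton i)]
  exact congrArg _ (integral_congr_ae (.of_forall fun y => by simp [Set.indicator]))

theorem integrable_gain (hh : IsClassifier h) (G : Matrix (Fin n) (Fin n) ℝ) :
    Integrable (fun x => gain G (condProb D x) (h x)) D.fst := by
  simp_rw [gain_eq_sum_sum]
  exact integrable_finsetSum _ fun j _ => integrable_finsetSum _ fun i _ =>
    (hh.integrable_mul (isClassifier_condProb D) D.fst i j).const_mul (G i j)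

theorem frob_conf_eq_integral_gain (hh : IsClassifier h) (G : Matrix (Fin n) (Fin n) ℝ) :
    frob G (conf D h) = ∫ x, gain G (condProb D x) (h x) ∂D.fst := by
  have hint := fun i j =>
    (hh.integrable_mul (isClassifier_condProb D) D.fst i j).const_mul (G i j)
  simp_rw [gain_eq_sum_sum]
  rw [integral_finsetSum _ fun j _ => integrable_finsetSum _ fun i _ => hint i j, frob,
    Finset.sum_comm]
  refine Finset.sum_congr rfl fun j _ => ?_
  rw [integral_finsetSum _ fun i _ => hint i j]
  simp only [conf_eq_integral_condProb D hh, integral_const_mul]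

theorem integrable_cpeError (hη : IsClassifier η) :
    Integrable (fun x => ∑ y, |η x y - condProb D x y|) D.fst := by
  have hcond := isClassifier_condProb D
  refine integrable_finsetSum _ fun y _ => .of_mem_Icc 0 1
    ((hη.measurable_apply y).sub (hcond.measurable_apply y)).abs.aemeasurable
    (.of_forall fun x => ⟨abs_nonneg _, ?_⟩)
  exact abs_sub_le_of_nonneg_of_le (hη.nonneg x y) (hη.le_one x y) (hcond.nonneg x y)
    (hcond.le_one x y)

theorem cpeError_nonneg (η : X → Fin n → ℝ) : 0 ≤ cpeError D η :=
  integral_nonneg fun _ => Finset.sum_nonneg fun _ _ => abs_nonneg _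

theorem frob_conf_le_plugIn {g : X → Fin n → ℝ} (hη : IsClassifier η) (hg : IsClassifier g)
    {G : Matrix (Fin n) (Fin n) ℝ} {B : ℝ} (hG : ∀ i j, |G i j| ≤ B) :
    frob G (conf D g) ≤ frob G (conf D (plugIn G η)) + 2 * B * cpeError D η := by
  have hu := isClassifier_plugIn G hη.1
  have herror := (integrable_cpeError D hη).const_mul (2 * B)
  rw [frob_conf_eq_integral_gain D hg, frob_conf_eq_integral_gain D hu, cpeError,
    ← integral_const_mul, ← integral_add (integrable_gain D hu G) herror]
  refine integral_mono (integrable_gain D hg G) ((integrable_gain D hu G).add herror) fun x => ?_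
  have hmax := gain_le_gain_plugIn G η x (hg.2 x)
  have hg_error := (abs_le.1 (abs_gain_le (hg.2 x) hG (η x - condProb D x))).1
  have hu_error := (abs_le.1 (abs_gain_le (hu.2 x) hG (η x - condProb D x))).2
  simp only [gain_sub, Pi.sub_apply] at hg_error hu_error ⊢
  linarith

end CondProb

end PlugIn

/-! ### The conditional gradient method -/

section FirstOrder

variable {n : ℕ} {f : Matrix (Fin n) (Fin n) ℝ → ℝ} {s : Set (Matrix (Fin n) (Fin n) ℝ)}
  {L β : ℝ} {M N : Matrix (Fin n) (Fin n) ℝ}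

theorem LipschitzL1On.nonneg [NeZero n] (hf : LipschitzL1On L f (cube n)) : 0 ≤ L := by
  have hzero : (0 : Matrix (Fin n) (Fin n) ℝ) ∈ cube n := fun _ _ => ⟨le_rfl, zero_le_one⟩
  have hone : Matrix.of (fun _ _ => 1) ∈ cube n := fun _ _ => ⟨zero_le_one, le_rfl⟩
  have hdist : 0 < l1Norm (Matrix.of (fun _ _ : Fin n => (1 : ℝ)) - 0) := by
    simp [l1Norm, NeZero.pos n]
  exact nonneg_of_mul_nonneg_left ((abs_nonneg _).trans (hf _ hone _ hzero)) hdist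

theorem SmoothL1On.nonneg [NeZero n] (hf : SmoothL1On β f (cube n)) : 0 ≤ β :=
  LipschitzL1On.nonneg fun M hM N hN => hf.2 M hM N hN 0 0

theorem l1Norm_smul_single (c : ℝ) (i j : Fin n) :
    l1Norm (c • Matrix.single i j (1 : ℝ)) = |c| := by
  simp [l1Norm, Matrix.single_apply, apply_ite abs, ite_and]

theorem SmoothL1On.hasDerivAt_coordinate (hf : SmoothL1On β f s) {i j : Fin n} {c t : ℝ}
    (ht : M + (t * c) • Matrix.single i j (1 : ℝ) ∈ s) :
    HasDerivAt (fun r : ℝ => f (M + (r * c) • Matrix.single i j (1 : ℝ)))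
      (grad f (M + (t * c) • Matrix.single i j (1 : ℝ)) i j * c) t :=
  HasDerivAt.comp (h := fun r : ℝ => r * c) t
    (hasDerivAt_line_of_hasDerivAt_zero (hf.1 _ ht i j).hasDerivAt) (hasDerivAt_mul_const c)

theorem SmoothL1On.abs_coordinate_sub_le (hf : SmoothL1On β f s) (hs : Convex ℝ s) {i j : Fin n}
    {c g K : ℝ} (hM : M ∈ s) (hMc : M + c • Matrix.single i j (1 : ℝ) ∈ s)
    (hg : ∀ t ∈ Set.Icc (0 : ℝ) 1, M + (t * c) • Matrix.single i j (1 : ℝ) ∈ s →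
      |grad f (M + (t * c) • Matrix.single i j (1 : ℝ)) i j - g| ≤ K) :
    |f (M + c • Matrix.single i j (1 : ℝ)) - f M - g * c| ≤ K * |c| := by
  have mem_line : ∀ t ∈ Set.Icc (0 : ℝ) 1, M + (t * c) • Matrix.single i j (1 : ℝ) ∈ s :=
    fun t ht => mul_smul t c (Matrix.single i j (1 : ℝ)) ▸ hs.add_smul_mem hM hMc ht
  have mvt := (convex_Icc (0 : ℝ) 1).norm_image_sub_le_of_norm_hasDerivWithin_le
    (C := K * |c|)
    (fun t ht => ((hf.hasDerivAt_coordinate (mem_line t ht)).fun_sub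
      ((hasDerivAt_mul_const c).const_mul g)).hasDerivWithinAt)
    (fun t ht => by
      rw [← sub_mul, Real.norm_eq_abs, abs_mul]
      exact mul_le_mul_of_nonneg_right (hg t ht (mem_line t ht)) (abs_nonneg c))
    (Set.left_mem_Icc.2 zero_le_one) (Set.right_mem_Icc.2 zero_le_one)
  simpa [sub_right_comm, -Matrix.smul_single] using mvt

theorem SmoothL1On.abs_grad_apply_le_of_mem (hf : SmoothL1On β f s) (hL : LipschitzL1On L f s)
    (hs : Convex ℝ s) {i j : Fin n} {c : ℝ} (hc : c ≠ 0) (hM : M ∈ s)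
    (hMc : M + c • Matrix.single i j (1 : ℝ) ∈ s) : |grad f M i j| ≤ L := by
  have hderiv : HasDerivAt (fun r : ℝ => f (M + (r * c) • Matrix.single i j (1 : ℝ)))
      (grad f M i j * c) 0 := by
    simpa [-Matrix.smul_single] using
      hf.hasDerivAt_coordinate (M := M) (i := i) (j := j) (c := c) (t := 0) (by simpa using hM)
  have hslope := (hderiv.tendsto_slope_zero_right).abs
  refine le_of_mul_le_mul_right (a := |c|) ?_ (abs_pos.2 hc)
  rw [← abs_mul]
  refine le_of_tendsto hslope (eventually_of_mem (Ioo_mem_nhdsGT zero_lt_one) fun t ht => ?_)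
  have hline : M + (t * c) • Matrix.single i j (1 : ℝ) ∈ s :=
    mul_smul t c (Matrix.single i j (1 : ℝ)) ▸ hs.add_smul_mem hM hMc ⟨ht.1.le, ht.2.le⟩
  have h := hL _ hline _ hM
  rw [add_sub_cancel_left, l1Norm_smul_single, abs_mul, abs_of_pos ht.1] at h
  simp only [zero_add, zero_mul, zero_smul, add_zero, smul_eq_mul, abs_mul, abs_inv]
  rw [abs_of_pos ht.1, inv_mul_le_iff₀ ht.1]
  linarith

theorem SmoothL1On.abs_grad_apply_le (hf : SmoothL1On β f (cube n))
    (hL : LipschitzL1On L f (cube n)) (hM : M ∈ cube n) (i j : Fin n) :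
    |grad f M i j| ≤ L := by
  obtain ⟨c, hc, hcube⟩ : ∃ c : ℝ, c ≠ 0 ∧ M i j + c ∈ Set.Icc (0 : ℝ) 1 := by
    rcases (hM i j).1.eq_or_lt with hzero | hpos
    · exact ⟨1, one_ne_zero, by simp [← hzero]⟩
    · exact ⟨-M i j, neg_ne_zero.2 hpos.ne', by simp⟩
  refine hf.abs_grad_apply_le_of_mem hL convex_cube hc hM fun k l => ?_
  by_cases hkl : i = k ∧ j = l
  · obtain ⟨rfl, rfl⟩ := hkl
    simpa using hcube
  · simpa [hkl] using hM k l

/-- The matrix that agrees with `N` on the index pairs in `S` and with `M` elsewhere. Letting `S`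
grow one pair at a time gives a path from `M` to `N` parallel to the axes. -/
def overwrite (S : Finset (Fin n × Fin n)) (M N : Matrix (Fin n) (Fin n) ℝ) :
    Matrix (Fin n) (Fin n) ℝ :=
  Matrix.of fun i j => if (i, j) ∈ S then N i j else M i j

theorem overwrite_mem_cube (S : Finset (Fin n × Fin n)) (hM : M ∈ cube n) (hN : N ∈ cube n) :
    overwrite S M N ∈ cube n := fun i j => by
  rw [overwrite, Matrix.of_apply]
  split_ifs
  exacts [hN i j, hM i j]

theorem overwrite_insert {S : Finset (Fin n × Fin n)} {i j : Fin n} (h : (i, j) ∉ S) :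
    overwrite (insert (i, j) S) M N =
      overwrite S M N + (N i j - M i j) • Matrix.single i j (1 : ℝ) := by
  ext k l
  by_cases hkl : k = i ∧ l = j
  · obtain ⟨rfl, rfl⟩ := hkl
    simp [overwrite, h]
  · have hne : ¬(i = k ∧ j = l) := fun h => hkl ⟨h.1.symm, h.2.symm⟩
    simp [overwrite, hkl, hne]

theorem l1Norm_overwrite_add_sub_le {S : Finset (Fin n × Fin n)} {i j : Fin n} (h : (i, j) ∉ S)
    {t : ℝ} (ht : t ∈ Set.Icc (0 : ℝ) 1) :
    l1Norm (overwrite S M N + (t * (N i j - M i j)) • Matrix.single i j (1 : ℝ) - M) ≤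
      l1Norm (N - M) := by
  refine Finset.sum_le_sum fun k _ => Finset.sum_le_sum fun l _ => ?_
  by_cases hkl : k = i ∧ l = j
  · obtain ⟨rfl, rfl⟩ := hkl
    simpa [overwrite, h, abs_mul, abs_of_nonneg ht.1] using
      mul_le_of_le_one_left (abs_nonneg (N k l - M k l)) ht.2
  · have hne : ¬(i = k ∧ j = l) := fun h => hkl ⟨h.1.symm, h.2.symm⟩
    by_cases hS : (k, l) ∈ S <;> simp [overwrite, hne, hS]

theorem SmoothL1On.abs_overwrite_sub_le (hf : SmoothL1On β f (cube n)) (hβ : 0 ≤ β)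
    (hM : M ∈ cube n) (hN : N ∈ cube n) (S : Finset (Fin n × Fin n)) :
    |f (overwrite S M N) - f M - ∑ p ∈ S, grad f M p.1 p.2 * (N p.1 p.2 - M p.1 p.2)| ≤
      β * l1Norm (N - M) * ∑ p ∈ S, |N p.1 p.2 - M p.1 p.2| := by
  induction S using Finset.induction_on with
  | empty => simp [overwrite, show Matrix.of M = M from rfl]
  | insert p S hp ih =>
    obtain ⟨i, j⟩ := p
    have hS := overwrite_mem_cube S hM hN
    have hSp := overwrite_mem_cube (insert (i, j) S) hM hN
    rw [overwrite_insert hp] at hSp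
    have hcoordinate := hf.abs_coordinate_sub_le convex_cube hS hSp (g := grad f M i j)
      (K := β * l1Norm (N - M)) fun t ht hline => (hf.2 _ hline _ hM i j).trans
        (mul_le_mul_of_nonneg_left (l1Norm_overwrite_add_sub_le hp ht) hβ)
    rw [overwrite_insert hp, Finset.sum_insert hp, Finset.sum_insert hp]
    rw [abs_le] at ih hcoordinate ⊢
    constructor <;> linarith

theorem SmoothL1On.abs_sub_sub_frob_le (hf : SmoothL1On β f (cube n)) (hβ : 0 ≤ β)
    (hM : M ∈ cube n) (hN : N ∈ cube n) :
    |f N - f M - frob (grad f M) (N - M)| ≤ β * l1Norm (N - M) ^ 2 := by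
  have h := hf.abs_overwrite_sub_le hβ hM hN Finset.univ
  have huniv : overwrite Finset.univ M N = N := by ext; simp [overwrite]
  rw [huniv, Fintype.sum_prod_type, Fintype.sum_prod_type] at h
  rw [sq, ← mul_assoc]
  exact h

theorem SmoothL1On.sub_le_frob (hf : SmoothL1On β f (cube n)) (hβ : 0 ≤ β) (hs : s ⊆ cube n)
    (hconc : ConcaveOn ℝ s f) (hM : M ∈ s) (hN : N ∈ s) :
    f N - f M ≤ frob (grad f M) (N - M) := by
  have hstep : ∀ t ∈ Set.Ioo (0 : ℝ) 1,
      f N - f M ≤ frob (grad f M) (N - M) + β * l1Norm (N - M) ^ 2 * t := fun t ht => by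
    have hline : M + t • (N - M) ∈ cube n :=
      hs (hconc.1.add_smul_sub_mem hM hN ⟨ht.1.le, ht.2.le⟩)
    have hbelow := hconc.2 hM hN (sub_nonneg.2 ht.2.le) ht.1.le (sub_add_cancel _ _)
    have habove := (abs_le.1 (hf.abs_sub_sub_frob_le hβ (hs hM) hline)).2
    rw [show (1 - t) • M + t • N = M + t • (N - M) by module] at hbelow
    rw [add_sub_cancel_left, frob_smul_right, l1Norm_smul, abs_of_pos ht.1] at habove
    simp only [smul_eq_mul] at hbelow
    refine le_of_mul_le_mul_left ?_ ht.1
    linarith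
  refine ge_of_tendsto (x := 𝓝[>] (0 : ℝ)) ?_
    (eventually_of_mem (Ioo_mem_nhdsGT zero_lt_one) hstep)
  refine tendsto_nhdsWithin_of_tendsto_nhds (Continuous.tendsto' (by fun_prop) _ _ (by simp))

theorem SmoothL1On.sub_conditionalGradient_step_le (hf : SmoothL1On β f (cube n)) (hβ : 0 ≤ β)
    (hs : s ⊆ cube n) (hconc : ConcaveOn ℝ s f) {U : Matrix (Fin n) (Fin n) ℝ} (hM : M ∈ s)
    (hN : N ∈ s) (hU : U ∈ s) {γ δ r : ℝ} (hγ : γ ∈ Set.Icc (0 : ℝ) 1)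
    (hδ : frob (grad f M) (N - U) ≤ δ) (hr : l1Norm (U - M) ≤ r) :
    f N - f (M + γ • (U - M)) ≤ (1 - γ) * (f N - f M) + γ * δ + β * r ^ 2 * γ ^ 2 := by
  have habove := hf.sub_le_frob hβ hs hconc hM hN
  have hbelow := (abs_le.1 (hf.abs_sub_sub_frob_le hβ (hs hM)
    (hs (hconc.1.add_smul_sub_mem hM hU hγ)))).1
  rw [add_sub_cancel_left, frob_smul_right, l1Norm_smul, abs_of_nonneg hγ.1] at hbelow
  have hcurvature : β * (γ * l1Norm (U - M)) ^ 2 ≤ β * r ^ 2 * γ ^ 2 := by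
    have := l1Norm_nonneg (U - M)
    calc β * (γ * l1Norm (U - M)) ^ 2 = β * l1Norm (U - M) ^ 2 * γ ^ 2 := by ring
      _ ≤ β * r ^ 2 * γ ^ 2 := by gcongr
  have hgap : f N - f M - δ ≤ frob (grad f M) (U - M) := by
    have hsplit : frob (grad f M) (N - M) =
        frob (grad f M) (N - U) + frob (grad f M) (U - M) := by
      simp only [frob_sub_right]
      ring
    linarith
  linarith [mul_le_mul_of_nonneg_left hgap hγ.1]

end FirstOrder

theorem le_add_div_of_conditionalGradient_step {a : ℕ → ℝ} {T c : ℝ} {A : ℝ} (hA : 4 * c ≤ A)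
    (hA0 : 0 ≤ A) (hone : a 1 ≤ T + A / 2)
    (hstep : ∀ k : ℕ, 1 ≤ k →
      a (k + 1) ≤ (1 - 2 / (k + 2)) * a k + 2 / (k + 2) * T + c * (2 / (k + 2)) ^ 2)
    {k : ℕ} (hk : 1 ≤ k) : a k ≤ T + A / (k + 1) := by
  induction k, hk using Nat.le_induction with
  | base => norm_num [hone]
  | succ k hk ih =>
    have hγ : 2 / ((k : ℝ) + 2) ≤ 1 := by
      rw [div_le_one (by positivity)]
      exact le_add_of_nonneg_left k.cast_nonneg
    have hrate : (k : ℝ) / (k + 1) + 1 / (k + 2) ≤ 1 := by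
      rw [div_add_div _ _ (by positivity) (by positivity), div_le_one (by positivity)]
      linarith
    push_cast
    calc a (k + 1)
        ≤ (1 - 2 / (k + 2)) * (T + A / (k + 1)) + 2 / (k + 2) * T + c * (2 / (k + 2)) ^ 2 :=
          (hstep k hk).trans (by gcongr)
      _ = T + (k / ((k + 1) * (k + 2)) * A + 4 * c / (k + 2) ^ 2) := by
          field_simp
          ring
      _ ≤ T + (k / ((k + 1) * (k + 2)) * A + A / (k + 2) ^ 2) := by gcongr
      _ = T + A / (k + 2) * (k / (k + 1) + 1 / (k + 2)) := by field_simp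
      _ ≤ T + A / (k + 1 + 1) := by
          rw [show (k : ℝ) + 1 + 1 = k + 2 by ring]
          exact add_le_add_right (mul_le_of_le_one_right (by positivity) hrate) T

section Iterates

variable {X : Type*} [MeasurableSpace X] {n : ℕ} [NeZero n] {η h₀ : X → Fin n → ℝ}
  {E D : Measure (X × Fin n)} {ψ : Matrix (Fin n) (Fin n) ℝ → ℝ}

theorem two_div_natCast_succ_add_one_mem_Icc (k : ℕ) :
    2 / (((k + 1 : ℕ) : ℝ) + 1) ∈ Set.Icc (0 : ℝ) 1 := by
  refine ⟨by positivity, (div_le_one (by positivity)).2 ?_⟩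
  push_cast
  linarith [k.cast_nonneg (α := ℝ)]

theorem isClassifier_iterate (ψ : Matrix (Fin n) (Fin n) ℝ → ℝ) (hη : Measurable η)
    (hh₀ : IsClassifier h₀) (E : Measure (X × Fin n)) (k : ℕ) :
    IsClassifier (iterate ψ η E h₀ k) := by
  induction k with
  | zero => exact hh₀
  | succ k ih =>
    have hγ := two_div_natCast_succ_add_one_mem_Icc k
    exact ih.convexComb (isClassifier_plugIn _ hη) (sub_nonneg.2 hγ.2) hγ.1 (sub_add_cancel _ _)

theorem conf_iterate_succ (ψ : Matrix (Fin n) (Fin n) ℝ → ℝ) (hη : Measurable η)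
    (hh₀ : IsClassifier h₀) (E D : Measure (X × Fin n)) [IsFiniteMeasure D] (k : ℕ) :
    conf D (iterate ψ η E h₀ (k + 1)) =
      (1 - 2 / (((k + 1 : ℕ) : ℝ) + 1)) • conf D (iterate ψ η E h₀ k) +
      (2 / (((k + 1 : ℕ) : ℝ) + 1)) •
        conf D (plugIn (grad ψ (conf E (iterate ψ η E h₀ k))) η) :=
  conf_convexComb (isClassifier_iterate ψ hη hh₀ E k) (isClassifier_plugIn _ hη) D _ _

theorem abs_conf_iterate_sub_le (ψ : Matrix (Fin n) (Fin n) ℝ → ℝ) (hη : Measurable η)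
    (hh₀ : IsClassifier h₀) [IsFiniteMeasure D] [IsFiniteMeasure E] {ε : ℝ}
    (hε : ∀ G i j, |conf E (plugIn G η) i j - conf D (plugIn G η) i j| ≤ ε) {k : ℕ}
    (hk : 1 ≤ k) (i j : Fin n) :
    |conf E (iterate ψ η E h₀ k) i j - conf D (iterate ψ η E h₀ k) i j| ≤ ε := by
  induction k, hk using Nat.le_induction with
  | base =>
    -- the first step has size `1`, so the initial classifier drops out
    have hγ : 2 / (((0 + 1 : ℕ) : ℝ) + 1) = 1 := by norm_num
    rw [← zero_add 1, conf_iterate_succ ψ hη hh₀, conf_iterate_succ ψ hη hh₀, hγ]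
    simpa only [sub_self, zero_smul, one_smul, zero_add] using hε _ i j
  | succ k _ ih =>
    have hγ := two_div_natCast_succ_add_one_mem_Icc k
    have hcomb := convex_Icc (-ε) ε (abs_le.1 ih)
      (abs_le.1 (hε (grad ψ (conf E (iterate ψ η E h₀ k))) i j)) (sub_nonneg.2 hγ.2) hγ.1
      (sub_add_cancel _ _)
    rw [conf_iterate_succ ψ hη hh₀, conf_iterate_succ ψ hη hh₀, abs_le]
    simp only [Matrix.add_apply, Matrix.smul_apply, smul_eq_mul, Set.mem_Icc] at hcomb ⊢
    constructor <;> linarith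

variable [IsProbabilityMeasure E] [IsProbabilityMeasure D]

theorem SmoothL1On.frob_conf_sub_plugIn_le {β B ε : ℝ} (hβ : SmoothL1On β ψ (cube n))
    (hB : LipschitzL1On B ψ (cube n)) (hη : IsClassifier η) {g h : X → Fin n → ℝ}
    (hg : IsClassifier g) (hh : IsClassifier h)
    (hε : ∀ i j, |conf E h i j - conf D h i j| ≤ ε) :
    frob (grad ψ (conf D h)) (conf D g - conf D (plugIn (grad ψ (conf E h)) η)) ≤
      2 * (β * (n ^ 2 * ε)) + 2 * B * cpeError D η := by
  have hβ0 := hβ.nonneg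
  have hE := conf_mem_cube hh E
  set u := plugIn (grad ψ (conf E h)) η
  have hu : IsClassifier u := isClassifier_plugIn _ hη.1
  have hgrad : ∀ i j, |(grad ψ (conf D h) - grad ψ (conf E h)) i j| ≤ β * (n ^ 2 * ε) :=
    fun i j => by
      refine (hβ.2 _ (conf_mem_cube hh D) _ hE i j).trans
        (mul_le_mul_of_nonneg_left ?_ hβ0)
      rw [l1Norm_sub_comm]
      exact l1Norm_le_of_abs_apply_le hε
  have hgrad_error := (le_abs_self _).trans ((abs_frob_le hgrad (conf D g - conf D u)).trans
    (mul_le_mul_of_nonneg_left (l1Norm_conf_sub_le_two hg hu D)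
      ((abs_nonneg _).trans (hgrad 0 0))))
  have hplugIn := frob_conf_le_plugIn D hη hg (hβ.abs_grad_apply_le hB hE)
  rw [frob_sub_left, frob_sub_right (grad ψ (conf E h))] at hgrad_error
  linarith

theorem sub_conf_iterate_le {β B ε : ℝ} (hψ : ConcaveOn ℝ (feasible D) ψ)
    (hβ : SmoothL1On β ψ (cube n)) (hB : LipschitzL1On B ψ (cube n)) (hη : IsClassifier η)
    (hh₀ : IsClassifier h₀)
    (hε : ∀ G i j, |conf E (plugIn G η) i j - conf D (plugIn G η) i j| ≤ ε)
    {C : Matrix (Fin n) (Fin n) ℝ} (hC : C ∈ feasible D) {k : ℕ} (hk : 1 ≤ k) :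
    ψ C - ψ (conf D (iterate ψ η E h₀ k)) ≤
      2 * (β * (n ^ 2 * ε)) + 2 * B * cpeError D η + (16 * β + 4 * B) / (k + 1) := by
  obtain ⟨g, hg, rfl⟩ := hC
  have hβ0 := hβ.nonneg
  have hB0 := hB.nonneg
  have hε0 : 0 ≤ ε := (abs_nonneg _).trans (hε 0 0 0)
  have hcpe := cpeError_nonneg D η
  have hiter := isClassifier_iterate ψ hη.1 hh₀ E
  have hfeasible : ∀ {h : X → Fin n → ℝ}, IsClassifier h → conf D h ∈ feasible D :=
    fun hh => ⟨_, hh, rfl⟩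
  refine le_add_div_of_conditionalGradient_step
    (a := fun k => ψ (conf D g) - ψ (conf D (iterate ψ η E h₀ k))) (c := β * 2 ^ 2)
    (by linarith) (by positivity) ?_ (fun k hk => ?_) hk
  · have hone := (le_abs_self _).trans
      (hB _ (conf_mem_cube hg D) _ (conf_mem_cube (hiter 1) D))
    have hdist := mul_le_mul_of_nonneg_left (l1Norm_conf_sub_le_two hg (hiter 1) D) hB0
    have hrest : 0 ≤ 2 * (β * (n ^ 2 * ε)) + 2 * B * cpeError D η := by positivity
    linarith
  · have hu := isClassifier_plugIn (grad ψ (conf E (iterate ψ η E h₀ k))) hη.1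
    have hstep := hβ.sub_conditionalGradient_step_le hβ0 (feasible_subset_cube D) hψ
      (hfeasible (hiter k)) (hfeasible hg) (hfeasible hu)
      (two_div_natCast_succ_add_one_mem_Icc k)
      (hβ.frob_conf_sub_plugIn_le hB hη hg (hiter k)
        (abs_conf_iterate_sub_le ψ hη.1 hh₀ hε hk))
      (l1Norm_conf_sub_le_two hu (hiter k) D)
    have hsize : ((k + 1 : ℕ) : ℝ) + 1 = k + 2 := by push_cast; ring
    rw [conf_iterate_succ ψ hη.1 hh₀, ← hsize]
    convert hstep using 3
    module

end Iterates

/-! ### Growth function of the plug-in classifiers -/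

section Halfspaces

variable {ι V : Type*} [Fintype ι] [AddCommGroup V] [Module ℝ V]

open Classical in
/-- The subsets of a finite family of vectors that a closed half-space with the origin on its
boundary cuts out. -/
def halfspaceTraces (v : ι → V) : Finset (Finset ι) :=
  {s | ∃ w : Module.Dual ℝ V, ∀ k, k ∈ s ↔ 0 ≤ w (v k)}

theorem mem_halfspaceTraces {v : ι → V} {s : Finset ι} :
    s ∈ halfspaceTraces v ↔ ∃ w : Module.Dual ℝ V, ∀ k, k ∈ s ↔ 0 ≤ w (v k) := by
  simp [halfspaceTraces]

theorem nonpos_of_shatters_halfspaceTraces [DecidableEq ι] {v : ι → V} {s : Finset ι}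
    (hs : (halfspaceTraces v).Shatters s) {c : ι → ℝ} (hc : ∑ k ∈ s, c k • v k = 0) :
    ∀ k ∈ s, c k ≤ 0 := by
  obtain ⟨u, hu, hsu⟩ := hs (Finset.filter_subset (fun k => c k < 0) s)
  obtain ⟨w, hw⟩ := mem_halfspaceTraces.1 hu
  have hsign : ∀ k ∈ s, 0 ≤ w (v k) ↔ c k < 0 := fun k hk => by
    simpa [hk, hw] using Finset.ext_iff.1 hsu k
  have hterm : ∀ k ∈ s, c k * w (v k) ≤ 0 := fun k hk => by
    rcases lt_or_ge (c k) 0 with h | h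
    · exact mul_nonpos_of_nonpos_of_nonneg h.le ((hsign k hk).2 h)
    · exact mul_nonpos_of_nonneg_of_nonpos h (not_le.1 (mt (hsign k hk).1 h.not_gt)).le
  have hsum : ∑ k ∈ s, c k * w (v k) = 0 := by
    simpa only [map_sum, map_smul, smul_eq_mul, map_zero] using congrArg w hc
  intro k hk
  by_contra! hpos
  have hw_neg : w (v k) < 0 := not_le.1 (mt (hsign k hk).1 hpos.not_gt)
  exact (mul_neg_of_pos_of_neg hpos hw_neg).ne
    ((Finset.sum_eq_zero_iff_of_nonpos hterm).1 hsum k hk)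

theorem linearIndepOn_of_shatters_halfspaceTraces [DecidableEq ι] {v : ι → V} {s : Finset ι}
    (hs : (halfspaceTraces v).Shatters s) : LinearIndepOn ℝ v s := by
  refine linearIndepOn_finset_iff.2 fun c hc k hk =>
    (nonpos_of_shatters_halfspaceTraces hs hc k hk).antisymm ?_
  have hneg : ∑ k ∈ s, (-c k) • v k = 0 := by
    simp only [neg_smul, Finset.sum_neg_distrib, hc, neg_zero]
  exact neg_nonpos.1 (nonpos_of_shatters_halfspaceTraces hs hneg k hk)

theorem vcDim_halfspaceTraces_le [DecidableEq ι] [Module.Finite ℝ V] (v : ι → V) :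
    (halfspaceTraces v).vcDim ≤ Module.finrank ℝ V :=
  Finset.sup_le fun s hs => by
    simpa using (linearIndepOn_of_shatters_halfspaceTraces
      (Finset.mem_shatterer.1 hs)).fintype_card_le_finrank

theorem sum_choose_le_pow (N d : ℕ) : ∑ k ∈ Finset.Iic d, N.choose k ≤ (N + 1) ^ d := by
  rw [add_pow, ← Nat.range_succ_eq_Iic]
  refine Finset.sum_le_sum fun k hk => ?_
  have hkd : k ≤ d := Nat.lt_succ_iff.1 (Finset.mem_range.1 hk)
  rw [one_pow, mul_one]
  exact (Nat.choose_le_pow N k).trans (Nat.le_mul_of_pos_right _ (Nat.choose_pos hkd))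

theorem card_halfspaceTraces_le [Module.Finite ℝ V] (v : ι → V) :
    (halfspaceTraces v).card ≤ (Fintype.card ι + 1) ^ Module.finrank ℝ V := by
  classical
  calc (halfspaceTraces v).card
      ≤ ∑ k ∈ Finset.Iic (halfspaceTraces v).vcDim, (Fintype.card ι).choose k :=
        (Finset.card_le_card_shatterer _).trans Finset.card_shatterer_le_sum_vcDim
    _ ≤ ∑ k ∈ Finset.Iic (Module.finrank ℝ V), (Fintype.card ι).choose k :=
        Finset.sum_le_sum_of_subset (Finset.Iic_subset_Iic.2 (vcDim_halfspaceTraces_le v))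
    _ ≤ (Fintype.card ι + 1) ^ Module.finrank ℝ V := sum_choose_le_pow _ _

theorem isLastArgmax_iff_forall_ite {n : ℕ} {u : Fin n → ℝ} {i : Fin n} :
    IsLastArgmax u i ↔ ∀ y, if i < y then ¬0 ≤ u y - u i else 0 ≤ u i - u y := by
  constructor
  · intro h y
    split_ifs with hy
    · exact not_le.2 (sub_neg.2 (h.2 y hy))
    · exact sub_nonneg.2 (h.1 y)
  · intro h
    have hlast : ∀ y, i < y → u y < u i := fun y hy => by simpa [hy] using h y
    exact ⟨fun y => if hy : i < y then (hlast y hy).le else by simpa [hy] using h y, hlast⟩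

open Classical in
theorem exists_finset_filter_isLastArgmax_mem {n : ℕ} [Module.Finite ℝ V] (v : ι → V)
    (i : Fin n) :
    ∃ T : Finset (Finset ι), T.card ≤ (Fintype.card ι + 1) ^ (Module.finrank ℝ V * n) ∧
      ∀ w : Fin n → Module.Dual ℝ V,
        Finset.univ.filter (fun k => IsLastArgmax (fun y => w y (v k)) i) ∈ T := by
  let combine : (Fin n → halfspaceTraces v) → Finset ι := fun A =>
    {k | ∀ y, if i < y then k ∉ (A y).1 else k ∈ (A y).1}
  refine ⟨Finset.univ.image combine, ?_, fun w => ?_⟩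
  · refine Finset.card_image_le.trans ?_
    rw [Finset.card_univ, Fintype.card_fun, Fintype.card_coe, Fintype.card_fin, pow_mul]
    exact Nat.pow_le_pow_left (card_halfspaceTraces_le v) n
  · let difference : Fin n → Module.Dual ℝ V := fun y => if i < y then w y - w i else w i - w y
    have htrace : ∀ y, ({k | 0 ≤ difference y (v k)} : Finset ι) ∈ halfspaceTraces v := fun y =>
      mem_halfspaceTraces.2 ⟨difference y, fun k => by simp⟩
    refine Finset.mem_image.2 ⟨fun y => ⟨_, htrace y⟩, Finset.mem_univ _, ?_⟩
    ext k
    simp only [combine, difference, Finset.mem_filter_univ, isLastArgmax_iff_forall_ite]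
    refine forall_congr' fun y => ?_
    split_ifs <;> rfl

theorem exists_finset_plugIn_mem {n : ℕ} {X : Type*} (η : X → Fin n → ℝ) (x : ι → X)
    (j : Fin n) :
    ∃ T : Finset (ι → ℝ), T.card ≤ (Fintype.card ι + 1) ^ (n * n) ∧
      (∀ G, (fun k => plugIn G η (x k) j) ∈ T) ∧ ∀ f ∈ T, ∀ k, f k ∈ Set.Icc (0 : ℝ) 1 := by
  classical
  obtain ⟨T, hcard, hT⟩ := exists_finset_filter_isLastArgmax_mem (fun k => η (x k)) j
  refine ⟨T.image fun s k => if k ∈ s then 1 else 0, Finset.card_image_le.trans ?_,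
    fun G => ?_, fun f hf k => ?_⟩
  · simpa using hcard
  · refine Finset.mem_image.2
      ⟨_, hT fun y => dotProductEquiv ℝ (Fin n) fun k => G k y, funext fun k => ?_⟩
    simp [plugIn, dotProduct]
  · obtain ⟨s, -, rfl⟩ := Finset.mem_image.1 hf
    dsimp only
    split_ifs <;> simp

end Halfspaces

section Dense

variable {n : ℕ}

/-- A dense sequence of gain matrices, through which suprema over all plug-in classifiers become
measurable. -/
def denseGain (n k : ℕ) : Matrix (Fin n) (Fin n) ℝ :=
  TopologicalSpace.denseSeq (Fin n → Fin n → ℝ) k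

theorem exists_abs_sub_denseGain_le (G : Matrix (Fin n) (Fin n) ℝ) {δ : ℝ} (hδ : 0 < δ) :
    ∃ k, ∀ i j, |G i j - denseGain n k i j| ≤ δ := by
  obtain ⟨k, hk⟩ := (TopologicalSpace.denseRange_denseSeq (Fin n → Fin n → ℝ)).exists_dist_lt
    (G : Fin n → Fin n → ℝ) hδ
  exact ⟨k, fun i j => (dist_le_pi_dist (G i) (denseGain n k i) j).trans
    ((dist_le_pi_dist (G : Fin n → Fin n → ℝ) (denseGain n k) i).trans hk.le)⟩

-- the tilt `ε * y` turns ties into strict preferences for the larger label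
theorem IsLastArgmax.of_abs_tilt_sub_le {u v : Fin n → ℝ} {i : Fin n} (hi : IsLastArgmax v i)
    {ε : ℝ} (hε : 0 < ε) (hgap : ∀ y, i < y → ε * (n + 1) < v i - v y)
    (hu : ∀ y, |v y + ε * (y : ℕ) - u y| ≤ ε / 4) : IsLastArgmax u i := by
  have hlast : ∀ y, i < y → u y < u i := fun y hy => by
    have hlabel : ε * (y : ℕ) ≤ ε * n := by
      gcongr
      exact y.2.le
    have hlabel_nonneg : 0 ≤ ε * (i : ℕ) := by positivity
    linarith [hgap y hy, (abs_le.1 (hu y)).1, (abs_le.1 (hu i)).2]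
  refine ⟨fun y => ?_, hlast⟩
  rcases lt_trichotomy i y with hy | rfl | hy
  · exact (hlast y hy).le
  · exact le_rfl
  · have hlabel : ε * ((y : ℕ) + 1) ≤ ε * (i : ℕ) :=
      mul_le_mul_of_nonneg_left (by exact_mod_cast hy) hε.le
    linarith [hi.1 y, (abs_le.1 (hu y)).1, (abs_le.1 (hu i)).2]

theorem abs_sum_mul_le_of_mem_stdSimplex {ι : Type*} [Fintype ι] {v : ι → ℝ}
    (hv : v ∈ stdSimplex ℝ ι) {g : ι → ℝ} {δ : ℝ} (hg : ∀ k, |g k| ≤ δ) :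
    |∑ k, g k * v k| ≤ δ := by
  refine (Finset.abs_sum_le_sum_abs _ _).trans ?_
  calc ∑ k, |g k * v k| ≤ ∑ k, δ * v k := Finset.sum_le_sum fun k _ => by
        rw [abs_mul, abs_of_nonneg (hv.1 k)]
        exact mul_le_mul_of_nonneg_right (hg k) (hv.1 k)
    _ = δ := by rw [← Finset.mul_sum, hv.2, mul_one]

theorem exists_seq_isLastArgmax_denseGain (G : Matrix (Fin n) (Fin n) ℝ) :
    ∃ s : ℕ → ℕ, ∀ v ∈ stdSimplex ℝ (Fin n), ∀ i, IsLastArgmax (fun y => ∑ k, G k y * v k) i →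
      ∀ᶠ m in atTop, IsLastArgmax (fun y => ∑ k, denseGain n (s m) k y * v k) i := by
  let ε : ℕ → ℝ := fun m => 1 / ((m : ℝ) + 1)
  have hε : ∀ m, 0 < ε m := fun m => Nat.one_div_pos_of_nat
  choose s hs using fun m => exists_abs_sub_denseGain_le
    (Matrix.of fun k y => G k y + ε m * (y : ℕ)) (div_pos (hε m) (zero_lt_four' ℝ))
  refine ⟨s, fun v hv i hi => ?_⟩
  have hclose : ∀ m y, |∑ k, G k y * v k + ε m * (y : ℕ) - ∑ k, denseGain n (s m) k y * v k| ≤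
      ε m / 4 := fun m y => by
    have htilt : ε m * (y : ℕ) = ∑ k, ε m * (y : ℕ) * v k := by
      rw [← Finset.mul_sum, hv.2, mul_one]
    rw [htilt, ← Finset.sum_add_distrib, ← Finset.sum_sub_distrib]
    simp_rw [← add_mul, ← sub_mul]
    exact abs_sum_mul_le_of_mem_stdSimplex hv fun k => hs m k y
  have hlim : Tendsto (fun m => ε m * (n + 1)) atTop (𝓝 0) := by
    simpa only [zero_mul] using
      tendsto_one_div_add_atTop_nhds_zero_nat.mul_const ((n : ℝ) + 1)
  have hgap : ∀ᶠ m in atTop, ∀ y, i < y →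
      ε m * (n + 1) < ∑ k, G k i * v k - ∑ k, G k y * v k :=
    eventually_all.2 fun y => eventually_imp_distrib_left.2 fun hy =>
      hlim.eventually_lt_const (sub_pos.2 (hi.2 y hy))
  filter_upwards [hgap] with m hm using hi.of_abs_tilt_sub_le (hε m) hm (hclose m)

theorem exists_seq_plugIn_denseGain_eq [NeZero n] {X : Type*} (G : Matrix (Fin n) (Fin n) ℝ)
    {η : X → Fin n → ℝ} (hη : ∀ x, η x ∈ stdSimplex ℝ (Fin n)) :
    ∃ s : ℕ → ℕ, ∀ x, ∀ᶠ m in atTop, plugIn (denseGain n (s m)) η x = plugIn G η x := by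
  obtain ⟨s, hs⟩ := exists_seq_isLastArgmax_denseGain G
  refine ⟨s, fun x => ?_⟩
  obtain ⟨i, hi⟩ := exists_isLastArgmax fun y => ∑ k, G k y * η x k
  filter_upwards [hs (η x) (hη x) i hi] with m hm
  rw [plugIn_eq_single hi, plugIn_eq_single hm]

variable {X : Type*} [MeasurableSpace X]

theorem tendsto_conf_of_eventually_eq {h : ℕ → X → Fin n → ℝ} {u : X → Fin n → ℝ}
    (hh : ∀ m, IsClassifier (h m)) (hu : ∀ x, ∀ᶠ m in atTop, h m x = u x)
    (D : Measure (X × Fin n)) [IsFiniteMeasure D] (i j : Fin n) :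
    Tendsto (fun m => conf D (h m) i j) atTop (𝓝 (conf D u i j)) := by
  refine tendsto_integral_of_dominated_convergence (fun _ => 1)
    (fun m => ((hh m).measurable_confIntegrand i j).aestronglyMeasurable)
    (integrable_const _) (fun m => .of_forall fun z => ?_) (.of_forall fun z => ?_)
  · have hmem := (hh m).confIntegrand_mem_Icc i j z
    exact (Real.norm_of_nonneg hmem.1).trans_le hmem.2
  · refine tendsto_const_nhds.congr' ?_
    filter_upwards [hu z.1] with m hm
    rw [hm]

theorem abs_conf_plugIn_sub_le_of_denseGain [NeZero n] {η : X → Fin n → ℝ}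
    (hη : IsClassifier η) (E D : Measure (X × Fin n)) [IsFiniteMeasure E] [IsFiniteMeasure D]
    {ε : ℝ} {i j : Fin n}
    (h : ∀ k, |conf E (plugIn (denseGain n k) η) i j - conf D (plugIn (denseGain n k) η) i j| ≤ ε)
    (G : Matrix (Fin n) (Fin n) ℝ) :
    |conf E (plugIn G η) i j - conf D (plugIn G η) i j| ≤ ε := by
  obtain ⟨s, hs⟩ := exists_seq_plugIn_denseGain_eq G hη.2
  have hlim := fun (F : Measure (X × Fin n)) [IsFiniteMeasure F] =>
    tendsto_conf_of_eventually_eq (fun m => isClassifier_plugIn (denseGain n (s m)) hη.1) hs F i j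
  exact le_of_tendsto ((hlim E).sub (hlim D)).abs (.of_forall fun m => h (s m))

end Dense

/-! ### Symmetrization -/

section Rademacher

variable {ι : Type*} [Fintype ι] [DecidableEq ι]

/-- The sign of a Boolean; summing over all `σ : ι → Bool` enumerates the values of a family of
independent Rademacher signs. -/
def boolSign (b : Bool) : ℝ := if b then 1 else -1

theorem sum_exp_boolSign_le {d : ι → ℝ} (hd : ∀ k, |d k| ≤ 1) (l : ℝ) :
    ∑ σ : ι → Bool, Real.exp (l * ∑ k, boolSign (σ k) * d k) ≤
      2 ^ Fintype.card ι * Real.exp (l ^ 2 * Fintype.card ι / 2) := by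
  have hfactor : ∀ k, ∑ b, Real.exp (l * (boolSign b * d k)) ≤ 2 * Real.exp (l ^ 2 / 2) :=
    fun k => by
      have hcosh : ∑ b, Real.exp (l * (boolSign b * d k)) = 2 * Real.cosh (l * d k) := by
        simp [boolSign, Real.cosh_eq, mul_div_cancel₀]
      have hsq : d k ^ 2 ≤ 1 := (sq_le_one_iff_abs_le_one _).2 (hd k)
      rw [hcosh]
      refine mul_le_mul_of_nonneg_left ((Real.cosh_le_exp_half_sq _).trans ?_) zero_le_two
      refine Real.exp_le_exp.2 (div_le_div_of_nonneg_right ?_ zero_le_two)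
      rw [mul_pow]
      exact mul_le_of_le_one_right (sq_nonneg l) hsq
  calc ∑ σ : ι → Bool, Real.exp (l * ∑ k, boolSign (σ k) * d k)
      = ∏ k, ∑ b, Real.exp (l * (boolSign b * d k)) := by
        simp_rw [Finset.mul_sum, Real.exp_sum, Finset.prod_univ_sum, Fintype.piFinset_univ]
    _ ≤ ∏ _k : ι, (2 * Real.exp (l ^ 2 / 2)) :=
        Finset.prod_le_prod (fun k _ => by positivity) fun k _ => hfactor k
    _ = 2 ^ Fintype.card ι * Real.exp (l ^ 2 * Fintype.card ι / 2) := by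
        rw [Finset.prod_const, Finset.card_univ, mul_pow, ← Real.exp_nat_mul]
        ring_nf

theorem sum_exp_sup'_abs_boolSign_le {T : Finset (ι → ℝ)} (hT : T.Nonempty)
    (hTle : ∀ d ∈ T, ∀ k, |d k| ≤ 1) {l : ℝ} (hl : 0 ≤ l) :
    ∑ σ : ι → Bool, Real.exp (l * T.sup' hT fun d => |∑ k, boolSign (σ k) * d k|) ≤
      2 ^ Fintype.card ι * (2 * T.card * Real.exp (l ^ 2 * Fintype.card ι / 2)) := by
  have hexp_abs : ∀ x : ℝ, Real.exp (l * |x|) ≤ Real.exp (l * x) + Real.exp (-l * x) := fun x => by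
    rw [neg_mul, ← abs_of_nonneg hl, ← abs_mul, abs_of_nonneg hl]
    exact Real.exp_abs_le _
  have hunion : ∀ σ : ι → Bool,
      Real.exp (l * T.sup' hT fun d => |∑ k, boolSign (σ k) * d k|) ≤
        ∑ d ∈ T, (Real.exp (l * ∑ k, boolSign (σ k) * d k) +
          Real.exp (-l * ∑ k, boolSign (σ k) * d k)) := fun σ => by
    obtain ⟨d, hd, hsup⟩ :=
      Finset.exists_mem_eq_sup' hT fun d => |∑ k, boolSign (σ k) * d k|
    rw [hsup]
    exact (hexp_abs _).trans (Finset.single_le_sum (f := fun d : ι → ℝ =>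
      Real.exp (l * ∑ k, boolSign (σ k) * d k) + Real.exp (-l * ∑ k, boolSign (σ k) * d k))
      (fun _ _ => by positivity) hd)
  refine (Finset.sum_le_sum fun σ _ => hunion σ).trans ?_
  rw [Finset.sum_comm]
  calc ∑ d ∈ T, ∑ σ : ι → Bool, (Real.exp (l * ∑ k, boolSign (σ k) * d k) +
        Real.exp (-l * ∑ k, boolSign (σ k) * d k))
      ≤ ∑ _d ∈ T, 2 * (2 ^ Fintype.card ι * Real.exp (l ^ 2 * Fintype.card ι / 2)) :=
        Finset.sum_le_sum fun d hd => by
          rw [Finset.sum_add_distrib, two_mul]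
          exact add_le_add (sum_exp_boolSign_le (hTle d hd) l)
            (neg_sq l ▸ sum_exp_boolSign_le (hTle d hd) (-l))
    _ = 2 ^ Fintype.card ι * (2 * T.card * Real.exp (l ^ 2 * Fintype.card ι / 2)) := by
        rw [Finset.sum_const, nsmul_eq_mul]
        ring

theorem sum_sup'_abs_boolSign_le_log {T : Finset (ι → ℝ)} (hT : T.Nonempty)
    (hTle : ∀ d ∈ T, ∀ k, |d k| ≤ 1) {l : ℝ} (hl : 0 < l) :
    ∑ σ : ι → Bool, T.sup' hT (fun d => |∑ k, boolSign (σ k) * d k|) ≤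
      2 ^ Fintype.card ι * (Real.log (2 * T.card) / l + l * Fintype.card ι / 2) := by
  have : (0 : ℝ) < T.card := Nat.cast_pos.2 hT.card_pos
  set R : (ι → Bool) → ℝ := fun σ => T.sup' hT fun d => |∑ k, boolSign (σ k) * d k|
  have hjensen := convexOn_exp.map_sum_le (t := Finset.univ)
    (w := fun _ : ι → Bool => (2 ^ Fintype.card ι : ℝ)⁻¹) (p := fun σ => l * R σ)
    (fun _ _ => by positivity) (by simp) (fun _ _ => Set.mem_univ _)
  simp only [smul_eq_mul, ← Finset.mul_sum] at hjensen
  have hexp : Real.exp ((2 ^ Fintype.card ι)⁻¹ * (l * ∑ σ, R σ)) ≤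
      2 * T.card * Real.exp (l ^ 2 * Fintype.card ι / 2) :=
    hjensen.trans ((inv_mul_le_iff₀ (by positivity)).2 (sum_exp_sup'_abs_boolSign_le hT hTle hl.le))
  rw [← Real.le_log_iff_exp_le (by positivity), Real.log_mul (by positivity) (by positivity),
    Real.log_exp, inv_mul_le_iff₀ (by positivity), ← le_div_iff₀' hl] at hexp
  refine hexp.trans_eq ?_
  field_simp

theorem sum_sup'_abs_boolSign_le {T : Finset (ι → ℝ)} (hT : T.Nonempty)
    (hTle : ∀ d ∈ T, ∀ k, |d k| ≤ 1) :
    ∑ σ : ι → Bool, T.sup' hT (fun d => |∑ k, boolSign (σ k) * d k|) ≤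
      2 ^ Fintype.card ι * √(2 * Fintype.card ι * Real.log (2 * T.card)) := by
  rcases isEmpty_or_nonempty ι with hι | hι
  · simp
  have hcard : (1 : ℝ) ≤ T.card := Nat.one_le_cast.2 hT.card_pos
  have hlog : 0 < Real.log (2 * T.card) := Real.log_pos (by linarith)
  have hι : (0 : ℝ) < Fintype.card ι := Nat.cast_pos.2 Fintype.card_pos
  set r := √(2 * Fintype.card ι * Real.log (2 * T.card))
  have hr : r ^ 2 = 2 * Fintype.card ι * Real.log (2 * T.card) := Real.sq_sqrt (by positivity)
  have hr0 : 0 < r := Real.sqrt_pos.2 (by positivity)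
  -- `l = r / card ι` balances the two terms
  refine (sum_sup'_abs_boolSign_le_log hT hTle (div_pos hr0 hι)).trans_eq ?_
  congr 1
  field_simp
  linarith

theorem sum_iSup_enorm_boolSign_le {A : Type*} [Nonempty A] {d : A → ι → ℝ}
    {T : Finset (ι → ℝ)} (hdT : ∀ a, d a ∈ T) (hTle : ∀ d ∈ T, ∀ k, |d k| ≤ 1) :
    ∑ σ : ι → Bool, ⨆ a, ‖∑ k, boolSign (σ k) * d a k‖ₑ ≤
      2 ^ Fintype.card ι *
        ENNReal.ofReal √(2 * Fintype.card ι * Real.log (2 * T.card)) := by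
  have hT : T.Nonempty := ⟨_, hdT (Classical.arbitrary A)⟩
  have hsup : ∀ σ : ι → Bool, 0 ≤ T.sup' hT fun d => |∑ k, boolSign (σ k) * d k| := fun σ =>
    Finset.le_sup'_of_le _ (hdT (Classical.arbitrary A)) (abs_nonneg _)
  calc ∑ σ : ι → Bool, ⨆ a, ‖∑ k, boolSign (σ k) * d a k‖ₑ
      ≤ ∑ σ : ι → Bool, ENNReal.ofReal (T.sup' hT fun d => |∑ k, boolSign (σ k) * d k|) :=
        Finset.sum_le_sum fun σ _ => iSup_le fun a => by
          rw [Real.enorm_eq_ofReal_abs]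
          exact ENNReal.ofReal_le_ofReal
            (Finset.le_sup' (fun d => |∑ k, boolSign (σ k) * d k|) (hdT a))
    _ = ENNReal.ofReal (∑ σ : ι → Bool, T.sup' hT fun d => |∑ k, boolSign (σ k) * d k|) :=
        (ENNReal.ofReal_sum_of_nonneg fun σ _ => hsup σ).symm
    _ ≤ ENNReal.ofReal (2 ^ Fintype.card ι * √(2 * Fintype.card ι * Real.log (2 * T.card))) :=
        ENNReal.ofReal_le_ofReal (sum_sup'_abs_boolSign_le hT hTle)
    _ = 2 ^ Fintype.card ι *
        ENNReal.ofReal √(2 * Fintype.card ι * Real.log (2 * T.card)) := by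
        rw [ENNReal.ofReal_mul (by positivity), ENNReal.ofReal_pow zero_le_two,
          ENNReal.ofReal_ofNat]

end Rademacher

section Symmetrization

variable {ι Z A : Type*}

/-- Exchanges the two components of the pairs where `σ` is false. -/
def swapPairs (σ : ι → Bool) (w : ι → Z × Z) : ι → Z × Z :=
  fun k => if σ k then w k else (w k).swap

/-- The largest difference between the sums of a function of the family `f` over the two halves of
a double sample. -/
def ghostDeviation [Fintype ι] (f : A → Z → ℝ) (w : ι → Z × Z) : ENNReal :=
  ⨆ a, ‖∑ k, (f a (w k).1 - f a (w k).2)‖ₑ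

theorem ghostDeviation_swapPairs [Fintype ι] (f : A → Z → ℝ) (σ : ι → Bool) (w : ι → Z × Z) :
    ghostDeviation f (swapPairs σ w) =
      ⨆ a, ‖∑ k, boolSign (σ k) * (f a (w k).1 - f a (w k).2)‖ₑ := by
  refine iSup_congr fun a => congrArg _ (Finset.sum_congr rfl fun k _ => ?_)
  unfold swapPairs boolSign
  split_ifs <;> simp

variable [Fintype ι] [MeasurableSpace Z] {f : A → Z → ℝ}

theorem measurePreserving_swapPairs (P : Measure Z) [SigmaFinite P] (σ : ι → Bool) :
    MeasurePreserving (swapPairs σ) (Measure.pi fun _ : ι => P.prod P)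
      (Measure.pi fun _ : ι => P.prod P) := by
  refine measurePreserving_pi (fun _ : ι => P.prod P) (fun _ : ι => P.prod P)
    (f := fun k p => if σ k then p else p.swap) fun k => ?_
  cases σ k
  · simpa using Measure.measurePreserving_swap (μ := P) (ν := P)
  · simp only [if_true]
    exact MeasurePreserving.id (P.prod P)

theorem measurable_ghostDeviation [Countable A] (hf : ∀ a, Measurable (f a)) :
    Measurable (ghostDeviation (ι := ι) f) :=
  .iSup fun a => (Finset.measurable_sum _ fun k _ =>
    ((hf a).comp (measurable_fst.comp (measurable_pi_apply k))).sub
      ((hf a).comp (measurable_snd.comp (measurable_pi_apply k)))).enorm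

theorem enorm_sum_sub_integral_le (P : Measure Z) [IsProbabilityMeasure P]
    (hint : ∀ a, Integrable (f a) P) (S : ι → Z) (a : A) :
    ‖∑ k, (f a (S k) - ∫ z, f a z ∂P)‖ₑ ≤
      ∫⁻ S', ghostDeviation f (fun k => (S k, S' k)) ∂Measure.pi fun _ : ι => P := by
  have hterm : ∀ k : ι, Integrable (fun S' : ι → Z => f a (S' k)) (Measure.pi fun _ => P) :=
    fun k => integrable_comp_eval (hint a)
  have hmean : ∑ k, (f a (S k) - ∫ z, f a z ∂P) =
      ∫ S', ∑ k, (f a (S k) - f a (S' k)) ∂Measure.pi fun _ : ι => P := by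
    rw [integral_finsetSum (f := fun k (S' : ι → Z) => f a (S k) - f a (S' k)) _
      fun k _ => (integrable_const _).sub (hterm k)]
    refine Finset.sum_congr rfl fun k _ => ?_
    rw [integral_sub (integrable_const _) (hterm k),
      integral_comp_eval (hint a).aestronglyMeasurable, integral_const, probReal_univ, one_smul]
  rw [hmean]
  exact (enorm_integral_le_lintegral_enorm _).trans (lintegral_mono fun S' =>
    le_iSup (fun a => ‖∑ k, (f a (S k) - f a (S' k))‖ₑ) a)

variable [Countable A] (P : Measure Z) [IsProbabilityMeasure P]

theorem lintegral_iSup_enorm_sum_sub_integral_le_ghost (hf : ∀ a, Measurable (f a))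
    (hint : ∀ a, Integrable (f a) P) :
    ∫⁻ S, ⨆ a, ‖∑ k, (f a (S k) - ∫ z, f a z ∂P)‖ₑ ∂Measure.pi (fun _ : ι => P) ≤
      ∫⁻ w, ghostDeviation f w ∂Measure.pi fun _ : ι => P.prod P := by
  have hpair := measurePreserving_arrowProdEquivProdArrow Z Z ι (fun _ => P) (fun _ => P)
  have hmeas := (measurable_ghostDeviation (ι := ι) hf).comp
    (MeasurableEquiv.arrowProdEquivProdArrow Z Z ι).symm.measurable
  refine (lintegral_mono fun S => iSup_le (enorm_sum_sub_integral_le P hint S)).trans_eq ?_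
  rw [← hpair.symm.lintegral_comp (measurable_ghostDeviation hf)]
  exact (lintegral_prod _ hmeas.aemeasurable).symm

theorem lintegral_iSup_enorm_sum_sub_integral_le [Nonempty A] (hf : ∀ a, Measurable (f a))
    (hint : ∀ a, Integrable (f a) P) {K : ℝ}
    (hgrowth : ∀ w : ι → Z × Z, ∃ T : Finset (ι → ℝ), (T.card : ℝ) ≤ K ∧
      (∀ a, (fun k => f a (w k).1 - f a (w k).2) ∈ T) ∧ ∀ d ∈ T, ∀ k, |d k| ≤ 1) :
    ∫⁻ S, ⨆ a, ‖∑ k, (f a (S k) - ∫ z, f a z ∂P)‖ₑ ∂Measure.pi (fun _ : ι => P) ≤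
      ENNReal.ofReal √(2 * Fintype.card ι * Real.log (2 * K)) := by
  classical
  refine (lintegral_iSup_enorm_sum_sub_integral_le_ghost P hf hint).trans ?_
  have hmeas := measurable_ghostDeviation (ι := ι) hf
  have hswap : ∀ w : ι → Z × Z, ∑ σ : ι → Bool, ghostDeviation f (swapPairs σ w) ≤
      2 ^ Fintype.card ι * ENNReal.ofReal √(2 * Fintype.card ι * Real.log (2 * K)) := fun w => by
    obtain ⟨T, hTK, hT, hTle⟩ := hgrowth w
    have hTpos : 0 < T.card := Finset.card_pos.2 ⟨_, hT (Classical.arbitrary A)⟩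
    simp_rw [ghostDeviation_swapPairs]
    refine (sum_iSup_enorm_boolSign_le hT hTle).trans ?_
    gcongr
  refine (ENNReal.mul_le_mul_iff_right (a := 2 ^ Fintype.card ι) (by positivity)
    (by finiteness)).1 ?_
  calc 2 ^ Fintype.card ι * ∫⁻ w, ghostDeviation f w ∂Measure.pi (fun _ : ι => P.prod P)
      = ∑ σ : ι → Bool,
          ∫⁻ w, ghostDeviation f (swapPairs σ w) ∂Measure.pi fun _ : ι => P.prod P := by
        simp [(measurePreserving_swapPairs P _).lintegral_comp hmeas]
    _ = ∫⁻ w, ∑ σ : ι → Bool, ghostDeviation f (swapPairs σ w)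
          ∂Measure.pi fun _ : ι => P.prod P :=
        (lintegral_finsetSum _ fun σ _ =>
          hmeas.comp (measurePreserving_swapPairs P σ).measurable).symm
    _ ≤ 2 ^ Fintype.card ι * ENNReal.ofReal √(2 * Fintype.card ι * Real.log (2 * K)) :=
        (lintegral_mono hswap).trans_eq (by simp)

end Symmetrization

/-! ### Deviations on a split sample -/

section Empirical

variable {Z : Type*} [MeasurableSpace Z] {k : ℕ}

theorem isProbabilityMeasure_empirical (hk : 0 < k) (S : Fin k → Z) :
    IsProbabilityMeasure (empirical S) := by
  refine ⟨?_⟩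
  simpa [empirical] using
    ENNReal.inv_mul_cancel (Nat.cast_ne_zero.2 hk.ne') (ENNReal.natCast_ne_top k)

theorem integral_empirical {f : Z → ℝ} (hf : Measurable f) (S : Fin k → Z) :
    ∫ z, f z ∂empirical S = (k : ℝ)⁻¹ * ∑ b, f (S b) := by
  unfold empirical
  rw [integral_smul_measure, integral_finsetSum_measure fun b _ =>
    integrable_dirac' hf.stronglyMeasurable enorm_lt_top]
  simp [integral_dirac' f _ hf.stronglyMeasurable]

theorem lintegral_iSup_enorm_integral_empirical_sub_le {A : Type*} [Countable A] [Nonempty A]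
    (P : Measure Z) [IsProbabilityMeasure P] {f : A → Z → ℝ} (hf : ∀ a, Measurable (f a))
    (hint : ∀ a, Integrable (f a) P) (hk : 0 < k) {K : ℝ}
    (hgrowth : ∀ w : Fin k → Z × Z, ∃ T : Finset (Fin k → ℝ), (T.card : ℝ) ≤ K ∧
      (∀ a, (fun b => f a (w b).1 - f a (w b).2) ∈ T) ∧ ∀ d ∈ T, ∀ b, |d b| ≤ 1) :
    ∫⁻ S, ⨆ a, ‖∫ z, f a z ∂empirical S - ∫ z, f a z ∂P‖ₑ ∂Measure.pi (fun _ : Fin k => P) ≤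
      ENNReal.ofReal √(2 * Real.log (2 * K) / k) := by
  have hk0 : (0 : ℝ) < k := Nat.cast_pos.2 hk
  have hsum : ∀ (S : Fin k → Z) a, ∫ z, f a z ∂empirical S - ∫ z, f a z ∂P =
      (k : ℝ)⁻¹ * ∑ b, (f a (S b) - ∫ z, f a z ∂P) := fun S a => by
    rw [integral_empirical (hf a), Finset.sum_sub_distrib, mul_sub]
    simp [hk0.ne']
  have hrate : √(2 * Real.log (2 * K) / k) = (k : ℝ)⁻¹ * √(2 * k * Real.log (2 * K)) := by
    rw [← Real.sqrt_sq (inv_nonneg.2 hk0.le), ← Real.sqrt_mul (sq_nonneg _)]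
    congr 1
    field_simp
  simp_rw [hsum, enorm_mul, ← ENNReal.mul_iSup]
  rw [lintegral_const_mul' _ _ enorm_ne_top, hrate, ENNReal.ofReal_mul (by positivity),
    Real.enorm_of_nonneg (by positivity)]
  gcongr
  simpa only [Fintype.card_fin] using lintegral_iSup_enorm_sum_sub_integral_le P hf hint hgrowth

theorem tendsto_sqrt_log_div (N : ℕ) :
    Tendsto (fun k : ℕ => √(2 * Real.log (2 * (2 * k + 1) ^ N) / k)) atTop (𝓝 0) := by
  have hodd : Tendsto (fun k : ℕ => 2 * (k : ℝ) + 1) atTop atTop :=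
    tendsto_atTop_add_const_right _ _ (tendsto_natCast_atTop_atTop.const_mul_atTop zero_lt_two)
  have hlog : Tendsto (fun k : ℕ => Real.log (2 * k + 1) / (k : ℝ)) atTop (𝓝 0) := by
    refine ((Real.tendsto_pow_log_div_mul_add_atTop (1 / 2) (-(1 / 2)) 1 (by norm_num)).comp
      hodd).congr fun k => ?_
    simp only [Function.comp_apply, pow_one]
    congr 1
    ring
  have hquot := ((tendsto_const_div_atTop_nhds_zero_nat (Real.log 2)).add
    (hlog.const_mul (N : ℝ))).const_mul 2
  rw [← Real.sqrt_zero]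
  refine (Real.continuous_sqrt.tendsto 0).comp ((hquot.congr fun k => ?_).trans_eq ?_)
  · rw [Real.log_mul two_ne_zero (by positivity), Real.log_pow]
    ring
  · simp

end Empirical

section SampleSplitting

variable {n : ℕ} {X : Type*}

theorem exists_finset_plugIn_confIntegrand_sub_mem {ι : Type*} [Fintype ι] (η : X → Fin n → ℝ)
    (w : ι → (X × Fin n) × (X × Fin n)) (i j : Fin n) :
    ∃ T : Finset (ι → ℝ), T.card ≤ (2 * Fintype.card ι + 1) ^ (n * n) ∧
      (∀ G, (fun b => plugIn G η (w b).1.1 j * (if (w b).1.2 = i then 1 else 0) -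
        plugIn G η (w b).2.1 j * (if (w b).2.2 = i then 1 else 0)) ∈ T) ∧
      ∀ d ∈ T, ∀ b, |d b| ≤ 1 := by
  classical
  obtain ⟨T, hcard, hT, hT01⟩ := exists_finset_plugIn_mem η
    (Sum.elim (fun b => (w b).1.1) fun b => (w b).2.1) j
  rw [Fintype.card_sum, ← two_mul] at hcard
  refine ⟨T.image fun f b => f (Sum.inl b) * (if (w b).1.2 = i then 1 else 0) -
    f (Sum.inr b) * (if (w b).2.2 = i then 1 else 0), Finset.card_image_le.trans hcard,
    fun G => Finset.mem_image.2 ⟨_, hT G, rfl⟩, fun d hd b => ?_⟩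
  obtain ⟨f, hf, rfl⟩ := Finset.mem_image.1 hd
  obtain ⟨hl0, hl1⟩ := hT01 f hf (Sum.inl b)
  obtain ⟨hr0, hr1⟩ := hT01 f hf (Sum.inr b)
  rw [abs_le]
  dsimp only
  split_ifs <;> constructor <;> linarith

variable [MeasurableSpace X]

theorem lintegral_iSup_enorm_conf_sub_le [NeZero n] (D : Measure (X × Fin n))
    [IsProbabilityMeasure D] {η : X → Fin n → ℝ} (hη : Measurable η) {k : ℕ} (hk : 0 < k)
    (i j : Fin n) :
    ∫⁻ S, ⨆ a, ‖conf (empirical S) (plugIn (denseGain n a) η) i j -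
        conf D (plugIn (denseGain n a) η) i j‖ₑ ∂Measure.pi (fun _ : Fin k => D) ≤
      ENNReal.ofReal √(2 * Real.log (2 * (2 * k + 1) ^ (n * n)) / k) := by
  have hplug := fun a => isClassifier_plugIn (denseGain n a) hη
  refine lintegral_iSup_enorm_integral_empirical_sub_le D
    (fun a => (hplug a).measurable_confIntegrand i j)
    (fun a => (hplug a).integrable_confIntegrand D i j) hk fun w => ?_
  obtain ⟨T, hcard, hT, hTle⟩ := exists_finset_plugIn_confIntegrand_sub_mem η w i j
  rw [Fintype.card_fin] at hcard
  exact ⟨T, by exact_mod_cast hcard, fun a => hT (denseGain n a), hTle⟩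

/-- The largest deviation, over the plug-in classifiers of the model learnt from the first sample,
between entry `(i, j)` of the confusion matrix on the second sample and its population value. The
supremum runs over a countable dense family of gain matrices, so that it is measurable. -/
def splitDeviation (D : Measure (X × Fin n))
    (cpe : ∀ k : ℕ, (Fin k → X × Fin n) → X → Fin n → ℝ) {k₁ k₂ : ℕ} (i j : Fin n)
    (p : (Fin k₁ → X × Fin n) × (Fin k₂ → X × Fin n)) : ENNReal :=
  ⨆ a, ‖conf (empirical p.2) (plugIn (denseGain n a) (cpe k₁ p.1)) i j -
    conf D (plugIn (denseGain n a) (cpe k₁ p.1)) i j‖ₑ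

variable {cpe : ∀ k : ℕ, (Fin k → X × Fin n) → X → Fin n → ℝ}

theorem IsLearner.isClassifier (hcpe : IsLearner cpe) (k : ℕ) (S : Fin k → X × Fin n) :
    IsClassifier (cpe k S) :=
  ⟨(hcpe k).1.comp measurable_prodMk_left, (hcpe k).2 S⟩

theorem size₂_pos {α : ℝ} (hα : 0 < α) {m : ℕ} (hm : 0 < m) : 0 < size₂ α m :=
  Nat.ceil_pos.2 (mul_pos hα (Nat.cast_pos.2 hm))

theorem tendsto_size₂ {α : ℝ} (hα : 0 < α) : Tendsto (size₂ α) atTop atTop :=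
  tendsto_nat_ceil_atTop.comp (tendsto_natCast_atTop_atTop.const_mul_atTop hα)

theorem measurePreserving_split {Z : Type*} [MeasurableSpace Z] (P : Measure Z) [SigmaFinite P]
    {α : ℝ} (hα : α ∈ Set.Ioo (0 : ℝ) 1) (m : ℕ) :
    MeasurePreserving (fun S : Fin m → Z => (part₁ hα S, part₂ hα S))
      (Measure.pi fun _ => P) ((Measure.pi fun _ => P).prod (Measure.pi fun _ => P)) :=
  (measurePreserving_sumPiEquivProdPi fun _ : Fin (size₁ α m) ⊕ Fin (size₂ α m) => P).comp
    ((measurePreserving_piCongrLeft (fun _ : Fin m => P)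
      (finSumFinEquiv.trans (finCongr (size_add hα m)))).symm _)

variable [NeZero n] (D : Measure (X × Fin n)) [IsProbabilityMeasure D] (hcpe : IsLearner cpe)
include hcpe

theorem measurable_splitDeviation (k₁ k₂ : ℕ) (i j : Fin n) :
    Measurable (splitDeviation D cpe (k₁ := k₁) (k₂ := k₂) i j) := by
  refine .iSup fun a => (Measurable.sub ?_ ?_).enorm
  all_goals have hplug : Measurable fun p : (Fin k₁ → X × Fin n) × X =>
      plugIn (denseGain n a) (cpe k₁ p.1) p.2 j :=
    (measurable_pi_apply j).comp (measurable_plugIn (denseGain n a) (hcpe k₁).1)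
  · have hcl := fun S => isClassifier_plugIn (denseGain n a) (hcpe.isClassifier k₁ S).1
    unfold conf
    simp_rw [integral_empirical ((hcl _).measurable_confIntegrand i j)]
    exact (Finset.measurable_sum _ fun b _ =>
      (hplug.comp (measurable_fst.prodMk
        (measurable_fst.comp ((measurable_pi_apply b).comp measurable_snd)))).mul
      ((measurable_labelIndicator i).comp
        ((measurable_pi_apply b).comp measurable_snd))).const_mul _
  · have hintegrand : Measurable fun p : (Fin k₁ → X × Fin n) × (X × Fin n) =>
        plugIn (denseGain n a) (cpe k₁ p.1) p.2.1 j * (if p.2.2 = i then (1 : ℝ) else 0) :=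
      (hplug.comp (measurable_fst.prodMk (measurable_fst.comp measurable_snd))).mul
        ((measurable_labelIndicator i).comp measurable_snd)
    exact (hintegrand.stronglyMeasurable.integral_prod_right' (ν := D)).measurable.comp
      measurable_fst

theorem lintegral_splitDeviation_le {α : ℝ} (hα : α ∈ Set.Ioo (0 : ℝ) 1) {m : ℕ} (hm : 0 < m)
    (i j : Fin n) :
    ∫⁻ S, splitDeviation D cpe i j (part₁ hα S, part₂ hα S) ∂Measure.pi (fun _ : Fin m => D) ≤
      ENNReal.ofReal
        √(2 * Real.log (2 * (2 * size₂ α m + 1) ^ (n * n)) / size₂ α m) := by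
  have hmeas := measurable_splitDeviation D hcpe (size₁ α m) (size₂ α m) i j
  rw [(measurePreserving_split D hα m).lintegral_comp hmeas, lintegral_prod _ hmeas.aemeasurable]
  refine (lintegral_mono fun S => lintegral_iSup_enorm_conf_sub_le D
    (hcpe.isClassifier _ S).1 (size₂_pos hα.1 hm) i j).trans_eq ?_
  simp

theorem tendsto_measure_splitDeviation {α : ℝ} (hα : α ∈ Set.Ioo (0 : ℝ) 1) (i j : Fin n)
    {δ : ENNReal} (hδ : δ ≠ 0) (hδ_top : δ ≠ ⊤) :
    Tendsto (fun m => Measure.pi (fun _ : Fin m => D)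
      {S | δ ≤ splitDeviation D cpe i j (part₁ hα S, part₂ hα S)}) atTop (𝓝 0) := by
  have hrate : Tendsto (fun m => ENNReal.ofReal
      √(2 * Real.log (2 * (2 * size₂ α m + 1) ^ (n * n)) / size₂ α m) / δ) atTop (𝓝 0) := by
    have hofReal := (ENNReal.continuous_ofReal.tendsto 0).comp
      ((tendsto_sqrt_log_div (n * n)).comp (tendsto_size₂ hα.1))
    simpa using ENNReal.Tendsto.div_const hofReal (.inr hδ)
  refine tendsto_of_tendsto_of_tendsto_of_le_of_le' tendsto_const_nhds hrate
    (.of_forall fun m => zero_le) ?_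
  filter_upwards [eventually_gt_atTop 0] with m hm
  exact (meas_ge_le_lintegral_div ((measurable_splitDeviation D hcpe _ _ i j).comp
    (measurePreserving_split D hα m).measurable).aemeasurable hδ hδ_top).trans
    (ENNReal.div_le_div_right (lintegral_splitDeviation_le D hcpe hα hm i j) δ)

end SampleSplitting

/-! ### Consistency -/

section Consistency

theorem exists_diagonal {a : ℕ → ℕ → ENNReal} (ha : ∀ k, Tendsto (a k) atTop (𝓝 0)) :
    ∃ φ : ℕ → ℕ, Tendsto φ atTop atTop ∧ Tendsto (fun m => a (φ m) m) atTop (𝓝 0) := by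
  have hex : ∀ k : ℕ, ∃ N, ∀ m ≥ N, a k m ≤ ((k + 1 : ℕ) : ENNReal)⁻¹ := fun k =>
    eventually_atTop.1 ((ha k).eventually_le_const (ENNReal.inv_pos.2 (ENNReal.natCast_ne_top _)))
  choose N hN using hex
  let φ : ℕ → ℕ := fun m => Nat.findGreatest (fun k => N k ≤ m) m
  have hφ : Tendsto φ atTop atTop := tendsto_atTop.2 fun K => by
    filter_upwards [eventually_ge_atTop K, eventually_ge_atTop (N K)] with m hK hNK
    exact Nat.le_findGreatest hK hNK
  refine ⟨φ, hφ, tendsto_of_tendsto_of_tendsto_of_le_of_le' tendsto_const_nhds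
    ((ENNReal.tendsto_inv_nat_nhds_zero.comp (tendsto_add_atTop_nat 1)).comp hφ)
    (.of_forall fun m => zero_le) ?_⟩
  filter_upwards [eventually_ge_atTop (N 0)] with m hm
  exact hN _ _ (Nat.findGreatest_spec (P := fun k => N k ≤ m) (Nat.zero_le m) hm)

variable {n : ℕ} {X : Type*} [MeasurableSpace X] {ψ : Matrix (Fin n) (Fin n) ℝ → ℝ}

theorem abs_regret_le (D : Measure (X × Fin n)) {ψ' : Matrix (Fin n) (Fin n) ℝ → ℝ} {θ ε : ℝ}
    (hθ : ∀ C ∈ feasible D, |ψ C - ψ' C| ≤ θ) {h : X → Fin n → ℝ} (hh : IsClassifier h)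
    (hgap : ∀ C ∈ feasible D, ψ' C - ψ' (conf D h) ≤ ε) : |regret D ψ h| ≤ 2 * θ + ε := by
  have hle : ∀ g : {g : X → Fin n → ℝ // IsClassifier g},
      ψ (conf D g) ≤ ψ (conf D h) + (2 * θ + ε) := fun g => by
    have hg := (abs_le.1 (hθ (conf D g) ⟨g, g.2, rfl⟩)).2
    have hh := (abs_le.1 (hθ (conf D h) ⟨h, hh, rfl⟩)).1
    have := hgap (conf D g) ⟨g, g.2, rfl⟩
    linarith
  have : Nonempty {g : X → Fin n → ℝ // IsClassifier g} := ⟨⟨h, hh⟩⟩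
  have hsup : ψ (conf D h) ≤ ⨆ g : {g : X → Fin n → ℝ // IsClassifier g}, ψ (conf D g) :=
    le_ciSup (f := fun g : {g : X → Fin n → ℝ // IsClassifier g} => ψ (conf D g))
      ⟨_, Set.forall_mem_range.2 hle⟩ ⟨h, hh⟩
  rw [regret, abs_of_nonneg (sub_nonneg.2 hsup), sub_le_iff_le_add']
  exact ciSup_le hle

variable {α : ℝ} (hα : α ∈ Set.Ioo (0 : ℝ) 1) (κ : ℕ)
  (cpe h₀ : ∀ k : ℕ, (Fin k → X × Fin n) → X → Fin n → ℝ)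

/-- The event that some feasible confusion matrix improves on the output of the algorithm by at
least `ε`. -/
def gapEvent (D : Measure (X × Fin n)) (ψ : Matrix (Fin n) (Fin n) ℝ → ℝ) (ε : ℝ) (m : ℕ) :
    Set (Fin m → X × Fin n) :=
  {S | ∃ C ∈ feasible D, ε ≤ ψ C - ψ (conf D (bayesCG hα κ cpe h₀ ψ m S))}

variable {κ cpe h₀} [NeZero n] (D : Measure (X × Fin n)) [IsProbabilityMeasure D]
  (hκ : 0 < κ) (hcpe : IsLearner cpe) (hh₀ : IsLearner h₀)
include hκ hcpe hh₀

theorem sub_conf_bayesCG_le {β B δ : ℝ} (hψ : ConcaveOn ℝ (feasible D) ψ)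
    (hβ : SmoothL1On β ψ (cube n)) (hB : LipschitzL1On B ψ (cube n)) (hδ : 0 ≤ δ) {m : ℕ}
    (hm : 0 < m) {S : Fin m → X × Fin n}
    (hdev : ∀ i j, splitDeviation D cpe i j (part₁ hα S, part₂ hα S) ≤ ENNReal.ofReal δ)
    {C : Matrix (Fin n) (Fin n) ℝ} (hC : C ∈ feasible D) :
    ψ C - ψ (conf D (bayesCG hα κ cpe h₀ ψ m S)) ≤ 2 * (β * (n ^ 2 * δ)) +
      2 * B * cpeError D (cpe (size₁ α m) (part₁ hα S)) +
        (16 * β + 4 * B) / ((κ * m : ℕ) + 1) := by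
  have hη := hcpe.isClassifier (size₁ α m) (part₁ hα S)
  have := isProbabilityMeasure_empirical (size₂_pos hα.1 hm) (part₂ hα S)
  refine sub_conf_iterate_le hψ hβ hB hη (hh₀.isClassifier m S) (fun G i j =>
    abs_conf_plugIn_sub_le_of_denseGain hη _ D (fun a => ?_) G) hC (Nat.mul_pos hκ hm)
  have hsup := (iSup_le_iff.1 (hdev i j)) a
  rwa [Real.enorm_eq_ofReal_abs, ENNReal.ofReal_le_ofReal_iff hδ] at hsup

theorem gapEvent_subset {β B δ ε : ℝ} (hψ : ConcaveOn ℝ (feasible D) ψ)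
    (hβ : SmoothL1On β ψ (cube n)) (hB : LipschitzL1On B ψ (cube n)) (hδ : 0 ≤ δ) {m : ℕ}
    (hm : 0 < m)
    (hε : (2 * β * n ^ 2 + 2 * B) * δ + (16 * β + 4 * B) / ((κ * m : ℕ) + 1) < ε) :
    gapEvent hα κ cpe h₀ D ψ ε m ⊆
      {S | δ ≤ |cpeError D (cpe (size₁ α m) (part₁ hα S)) - 0|} ∪
      ⋃ i, ⋃ j, {S | ENNReal.ofReal δ ≤
        splitDeviation D cpe i j (part₁ hα S, part₂ hα S)} := by
  rintro S ⟨C, hC, hgap⟩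
  by_contra hS
  simp only [Set.mem_union, Set.mem_iUnion, Set.mem_ofPred_eq, not_or, not_exists, not_le,
    sub_zero] at hS
  obtain ⟨hcpeError, hdev⟩ := hS
  have hle := sub_conf_bayesCG_le hα D hκ hcpe hh₀ hψ hβ hB hδ hm (fun i j => (hdev i j).le) hC
  have hmodel : 2 * B * cpeError D (cpe (size₁ α m) (part₁ hα S)) ≤ 2 * B * δ :=
    mul_le_mul_of_nonneg_left ((le_abs_self _).trans hcpeError.le)
      (mul_nonneg zero_le_two hB.nonneg)
  linarith

theorem tendsto_measure_gapEvent
    (hcons : TendstoInProb D (fun m S => cpeError D (cpe (size₁ α m) (part₁ hα S))) 0)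
    {β B ε : ℝ} (hψ : ConcaveOn ℝ (feasible D) ψ) (hβ : SmoothL1On β ψ (cube n))
    (hB : LipschitzL1On B ψ (cube n)) (hε : 0 < ε) :
    Tendsto (fun m => Measure.pi (fun _ : Fin m => D) (gapEvent hα κ cpe h₀ D ψ ε m)) atTop
      (𝓝 0) := by
  obtain ⟨δ, hδ, hδε⟩ := exists_pos_mul_lt hε (2 * β * n ^ 2 + 2 * B)
  have hbad : Tendsto (fun m => Measure.pi (fun _ : Fin m => D)
      {S | δ ≤ |cpeError D (cpe (size₁ α m) (part₁ hα S)) - 0|} +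
      ∑ i, ∑ j, Measure.pi (fun _ : Fin m => D) {S | ENNReal.ofReal δ ≤
        splitDeviation D cpe i j (part₁ hα S, part₂ hα S)}) atTop (𝓝 0) := by
    simpa using (hcons δ hδ).add (tendsto_finsetSum Finset.univ fun i _ =>
      tendsto_finsetSum Finset.univ fun j _ => tendsto_measure_splitDeviation D hcpe hα i j
        (ENNReal.ofReal_pos.2 hδ).ne' ENNReal.ofReal_ne_top)
  have hiter : Tendsto (fun m : ℕ => (16 * β + 4 * B) / (((κ * m : ℕ) : ℝ) + 1)) atTop (𝓝 0) :=
    (tendsto_atTop_add_const_right _ _ (tendsto_natCast_atTop_atTop.comp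
      (tendsto_id.const_mul_atTop' hκ))).const_div_atTop _
  refine tendsto_of_tendsto_of_tendsto_of_le_of_le' tendsto_const_nhds hbad
    (.of_forall fun m => zero_le) ?_
  filter_upwards [hiter.eventually_lt_const (sub_pos.2 hδε), eventually_gt_atTop 0] with m hlt hm
  refine (measure_mono (gapEvent_subset hα D hκ hcpe hh₀ hψ hβ hB hδ.le hm
    (lt_sub_iff_add_lt'.1 hlt))).trans ((measure_union_le _ _).trans ?_)
  gcongr
  exact (measure_iUnion_fintype_le _ _).trans
    (Finset.sum_le_sum fun i _ => measure_iUnion_fintype_le _ _)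

theorem IsSmoothing.exists_tendstoInProb_regret
    (hcons : TendstoInProb D (fun m S => cpeError D (cpe (size₁ α m) (part₁ hα S))) 0)
    {ψρ : ℝ → Matrix (Fin n) (Fin n) ℝ → ℝ} {θ L β : ℝ → ℝ} (hs : IsSmoothing D ψ ψρ θ L β)
    (hθ : Tendsto θ (𝓝[>] 0) (𝓝 0)) :
    ∃ ρ : ℕ → ℝ, (∀ m, ρ m ∈ Set.Ioo (0 : ℝ) 1) ∧ Tendsto ρ atTop (𝓝 0) ∧
      TendstoInProb D
        (fun m S => regret D ψ (bayesCG hα κ cpe h₀ (ψρ (ρ m)) m S)) 0 := by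
  obtain ⟨q, -, hq, hq0⟩ := exists_seq_strictAnti_tendsto' (zero_lt_one' ℝ)
  obtain ⟨φ, hφ, hgap⟩ := exists_diagonal fun k =>
    tendsto_measure_gapEvent hα D hκ hcpe hh₀ hcons (hs _ (hq k)).1 (hs _ (hq k)).2.2.1
      (hs _ (hq k)).2.1 (hq k).1
  have hρ := hq0.comp hφ
  refine ⟨q ∘ φ, fun m => hq _, hρ, fun ε hε => ?_⟩
  have hbound : Tendsto (fun m => 2 * θ (q (φ m)) + q (φ m)) atTop (𝓝 0) := by
    simpa using ((hθ.comp (tendsto_nhdsWithin_iff.2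
      ⟨hρ, .of_forall fun m => (hq (φ m)).1⟩)).const_mul 2).add hρ
  refine tendsto_of_tendsto_of_tendsto_of_le_of_le' tendsto_const_nhds hgap
    (.of_forall fun m => zero_le) ?_
  filter_upwards [hbound.eventually_lt_const hε] with m hm
  refine measure_mono fun S (hS : ε ≤ |regret D ψ _ - 0|) => ?_
  by_contra hgood
  rw [sub_zero] at hS
  exact (hS.trans_lt ((abs_regret_le D (hs _ (hq (φ m))).2.2.2
    (isClassifier_iterate _ (hcpe.isClassifier _ _).1 (hh₀.isClassifier m S) _ _)
    fun C hC => (not_le.1 fun hle => hgood ⟨C, hC, hle⟩).le).trans_lt hm)).false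

end Consistency

end BayesCG

end

theorem mainTheorem7 {X : Type*} [MeasurableSpace X] {n : ℕ} [NeZero n]
    (D : MeasureTheory.Measure (X × Fin n)) [MeasureTheory.IsProbabilityMeasure D]
    (hprior : ∀ y, 0 < BayesCG.prior D y)
    {α : ℝ} (hα : α ∈ Set.Ioo (0 : ℝ) 1) {κ : ℕ} (hκ : 0 < κ)
    (cpe h₀ : ∀ k : ℕ, (Fin k → X × Fin n) → X → Fin n → ℝ)
    (hcpe : BayesCG.IsLearner cpe) (hh₀ : BayesCG.IsLearner h₀)
    (hcons : BayesCG.TendstoInProb D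
      (fun m S => BayesCG.cpeError D
        (cpe (BayesCG.size₁ α m) (BayesCG.part₁ hα S))) 0) :
    (BayesCG.IsSmoothing D BayesCG.hMean BayesCG.hMeanSmooth
        (fun ρ => n / BayesCG.priorMin D * ρ) (fun ρ => n / ρ) (fun ρ => 2 * n / ρ ^ 2) ∧
      ∃ ρ : ℕ → ℝ, (∀ m, ρ m ∈ Set.Ioo (0 : ℝ) 1) ∧ Tendsto ρ atTop (𝓝 0) ∧
        BayesCG.TendstoInProb D (fun m S => BayesCG.regret D BayesCG.hMean
          (BayesCG.bayesCG hα κ cpe h₀ (BayesCG.hMeanSmooth (ρ m)) m S)) 0) ∧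
    (BayesCG.IsSmoothing D BayesCG.qMean BayesCG.qMeanSmooth
        (fun ρ => 1 / BayesCG.priorMin D * ρ) (fun ρ => 1 / √(n : ℝ) * (1 / ρ))
        (fun ρ => 2 / √(n : ℝ) * (1 / ρ ^ 2) * (1 + 1 / ρ)) ∧
      ∃ ρ : ℕ → ℝ, (∀ m, ρ m ∈ Set.Ioo (0 : ℝ) 1) ∧ Tendsto ρ atTop (𝓝 0) ∧
        BayesCG.TendstoInProb D (fun m S => BayesCG.regret D BayesCG.qMean
          (BayesCG.bayesCG hα κ cpe h₀ (BayesCG.qMeanSmooth (ρ m)) m S)) 0) ∧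
    (BayesCG.IsSmoothing D BayesCG.gMean BayesCG.gMeanSmooth
        (fun ρ => 2 * (ρ / BayesCG.priorMin D) ^ (1 / (n : ℝ)))
        (fun ρ => 1 / (n : ℝ) * (1 / ρ) * (1 + 1 / ρ) ^ (1 - 1 / (n : ℝ)))
        (fun ρ => 2 / (n * ρ ^ 2)) ∧
      ∃ ρ : ℕ → ℝ, (∀ m, ρ m ∈ Set.Ioo (0 : ℝ) 1) ∧ Tendsto ρ atTop (𝓝 0) ∧
        BayesCG.TendstoInProb D (fun m S => BayesCG.regret D BayesCG.gMean
          (BayesCG.bayesCG hα κ cpe h₀ (BayesCG.gMeanSmooth (ρ m)) m S)) 0) := by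
  have hH := BayesCG.isSmoothing_hMean D hprior
  have hQ := BayesCG.isSmoothing_qMean D hprior
  have hG := BayesCG.isSmoothing_gMean D hprior
  have hn : 0 < 1 / (n : ℝ) := one_div_pos.2 (Nat.cast_pos.2 (NeZero.pos n))
  refine ⟨⟨hH, hH.exists_tendstoInProb_regret hα D hκ hcpe hh₀ hcons ?_⟩,
    ⟨hQ, hQ.exists_tendstoInProb_regret hα D hκ hcpe hh₀ hcons ?_⟩,
    ⟨hG, hG.exists_tendstoInProb_regret hα D hκ hcpe hh₀ hcons ?_⟩⟩ <;>
    refine (Continuous.tendsto' ?_ _ _ ?_).mono_left nhdsWithin_le_nhds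
  · exact continuous_const_mul _
  · exact mul_zero _
  · exact continuous_const_mul _
  · exact mul_zero _
  · exact continuous_const.mul ((continuous_id.div_const _).rpow_const fun _ => .inr hn.le)
  · rw [zero_div, Real.zero_rpow hn.ne', mul_zero]
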